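/- Let $H\in(0,1)$ and $T\ge 0$. Let $\mu(d\lambda)=(2\pi)^{-1}\sin(\pi H)\,\Gamma(1+2H)\,|\lambda|^{1-2H}\,d\lambda$ on $\mathbb R$ (the spectral measure of the fractional Brownian motion with Hurst index $H$), let $e_t(\lambda)=(e^{i\lambda t}-1)/(i\lambda)$, and let $\mathcal L_T$ be the closure in the complex space $L^2(\mu)$ of the complex linear span of $\{e_t:t\in[0,T]\}$. Let $$V_t=d_H^2\,t^{2-2H},\qquad d_H^2=\frac{\Gamma(3/2-H)}{2H\,\Gamma(H+1/2)\,\Gamma(3-2H)},$$ and let $L^2([0,T],V)$ be the complex $L^2$ space of the measure $dV_u$ on $[0,T]$, with norm $\|\cdot\|_V$. For $t\in[0,T]$ let $$x_t(u)=2H\Big(t^{H-1/2}(t-u)^{H-1/2}-\int_u^t (v-u)^{H-1/2}\,d\big(v^{H-1/2}\big)\Big)\mathbb 1_{(0,t)}(u).$$ Finally, with $J_\nu$ the Bessel function of the first kind of order $\nu$, let $$\varphi(z)=\Gamma(1-H)\Big(\frac z4\Big)^{H}e^{iz/2}\Big(J_{-H}\big(\tfrac z2\big)+i\,J_{1-H}\big(\tfrac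 z2\big)\Big)\quad(z\in\mathbb R,\ z\ne0),\qquad \varphi(0)=1.$$ Then there is exactly one surjective linear isometry $U:L^2([0,T],V)\to\mathcal L_T$ such that $x_t\in L^2([0,T],V)$ and $Ux_t=e_t$ for every $t\in[0,T]$, and the following hold. 1. For every $f\in L^2([0,T],V)$, the function $u\mapsto f(u)\varphi(u\lambda)$ is $dV$-integrable for every $\lambda\in\mathbb R$, and $$Uf(\lambda)=\int_0^T f(u)\,\varphi(u\lambda)\,dV_u\qquad\text{for $\mu$-almost all }\lambda\in\mathbb R.$$ 2. The class $$\mathcal L'_T=\Big\{\psi\in\mathcal L_T:\int_{\mathbb R}\|\varphi(\cdot\,\lambda)\|_V\,|\psi(\lambda)|\,\mu(d\lambda)<\infty\Big\}$$ is dense in $\mathcal L_T$. 3. $U^*=U^{-1}$, where $U^*$ is the adjoint of $U$, and for every $\psi\in\mathcal L'_T$ and for $V$-almost every $u\in[0,T]$, the function $\lambda\mapsto\psi(\lambda)\overline{\varphi(u\lambda)}$ is $\mu$-integrable and $$U^*\psi(u)=U^{-1}\psi(u)=\int_{\mathbb R}\psi(\lambda)\,\overline{\varphi(u\lambda)}\,\mu(d\lambda).$$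 -/

import Mathlib

open MeasureTheory

noncomputable section

namespace FBM

/-- The Bessel function of the first kind of real order `ν`,
`J_ν(z) = ∑ₖ (-1)ᵏ / (k! Γ(k + ν + 1)) (z/2)^(2k + ν)`, with the principal branch of `(z/2)^ν`. -/
def besselJ (ν : ℝ) (z : ℂ) : ℂ :=
  (z / 2) ^ (ν : ℂ) *
    ∑' k : ℕ, (-1) ^ k / ((k.factorial : ℂ) * Complex.Gamma (k + ν + 1)) * (z / 2) ^ (2 * k)

/-- The Fourier kernel `φ(z) = Γ(1-H) (z/4)^H e^{iz/2} (J_{-H}(z/2) + i J_{1-H}(z/2))`, `φ(0) = 1`.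
For negative `z` all powers are principal ones; their branches cancel in the product. -/
def phi (H : ℝ) (z : ℝ) : ℂ :=
  if z = 0 then 1
  else (Real.Gamma (1 - H) : ℂ) * ((z : ℂ) / 4) ^ (H : ℂ) * Complex.exp (Complex.I * z / 2) *
    (besselJ (-H) ((z : ℂ) / 2) + Complex.I * besselJ (1 - H) ((z : ℂ) / 2))

/-- The spectral measure `μ(dλ) = (2π)⁻¹ sin(πH) Γ(1+2H) |λ|^{1-2H} dλ` on `ℝ` of the
fractional Brownian motion with Hurst index `H`. -/
def specMeasure (H : ℝ) : Measure ℝ :=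
  volume.withDensity fun l =>
    ENNReal.ofReal ((2 * Real.pi)⁻¹ * Real.sin (Real.pi * H) * Real.Gamma (1 + 2 * H) *
      |l| ^ (1 - 2 * H))

/-- `e_t(λ) = (e^{iλt} - 1) / (iλ)`, the Fourier transform of the indicator of `(0, t)`. -/
def expFun (t l : ℝ) : ℂ :=
  if l = 0 then (t : ℂ) else (Complex.exp (Complex.I * l * t) - 1) / (Complex.I * l)

/-- The frequency domain `𝓛_T`: the closure in `L²(μ)` of the complex linear span of the
(classes of the) functions `e_t`, `t ∈ [0, T]`. -/
abbrev freqDomain (H T : ℝ) : Submodule ℂ (Lp ℂ 2 (specMeasure H)) :=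
  (Submodule.span ℂ {ψ : Lp ℂ 2 (specMeasure H) |
    ∃ t ∈ Set.Icc 0 T, ψ =ᵐ[specMeasure H] expFun t}).topologicalClosure

/-- The constant `d_H² = Γ(3/2 - H) / (2H Γ(H + 1/2) Γ(3 - 2H))`. -/
def dSq (H : ℝ) : ℝ :=
  Real.Gamma (3 / 2 - H) / (2 * H * Real.Gamma (H + 1 / 2) * Real.Gamma (3 - 2 * H))

/-- The variance function `V_t = d_H² t^{2-2H}` of the fundamental martingale. -/
def varFun (H t : ℝ) : ℝ := dSq H * t ^ (2 - 2 * H)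

/-- The measure `dV_u = d_H² (2 - 2H) u^{1-2H} du` on `[0, T]` (regarded as a measure on `ℝ` that is
carried by `[0, T]`). -/
def varMeasure (H T : ℝ) : Measure ℝ :=
  (volume.withDensity fun u =>
    ENNReal.ofReal (dSq H * (2 - 2 * H) * u ^ (1 - 2 * H))).restrict (Set.Icc 0 T)

/-- `varMeasure H T` is the Lebesgue-Stieltjes measure of the variance function on `[0, T]`. -/
theorem varMeasure_Icc {H T t : ℝ} (hH0 : 0 < H) (hH1 : H < 1) (ht : 0 ≤ t) (htT : t ≤ T) :
    varMeasure H T (Set.Icc 0 t) = ENNReal.ofReal (varFun H t) := by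
  have hd : 0 ≤ dSq H := by
    unfold dSq
    have h1 := Real.Gamma_pos_of_pos (show (0 : ℝ) < 3 / 2 - H by linarith)
    have h2 := Real.Gamma_pos_of_pos (show (0 : ℝ) < H + 1 / 2 by linarith)
    have h3 := Real.Gamma_pos_of_pos (show (0 : ℝ) < 3 - 2 * H by linarith)
    positivity
  have hc : 0 ≤ dSq H * (2 - 2 * H) := mul_nonneg hd (by linarith)
  have hi : IntervalIntegrable (fun u : ℝ => dSq H * (2 - 2 * H) * u ^ (1 - 2 * H)) volume 0 t :=
    (intervalIntegral.intervalIntegrable_rpow' (by linarith)).const_mul _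
  rw [varMeasure, Measure.restrict_apply measurableSet_Icc,
    Set.inter_eq_left.2 (Set.Icc_subset_Icc_right htT), withDensity_apply _ measurableSet_Icc,
    ← ofReal_integral_eq_lintegral_ofReal, integral_Icc_eq_integral_Ioc,
    ← intervalIntegral.integral_of_le ht, intervalIntegral.integral_const_mul,
    integral_rpow (Or.inl (by linarith))]
  · congr 1
    have h : (1 - 2 * H + 1) = 2 - 2 * H := by ring
    have h' : 2 - 2 * H ≠ 0 := by linarith
    rw [h, Real.zero_rpow h', varFun, sub_zero, mul_assoc, mul_div_cancel₀ _ h']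
  · exact (integrableOn_Icc_iff_integrableOn_Ioc).2
      ((intervalIntegrable_iff_integrableOn_Ioc_of_le ht).1 hi)
  · refine (ae_restrict_iff' measurableSet_Icc).2 (Filter.Eventually.of_forall fun u hu => ?_)
    exact mul_nonneg hc (Real.rpow_nonneg hu.1 _)

/-- The moving average kernel of the fractional Brownian motion with respect to the fundamental
martingale, so that `X_t = ∫_0^t x_t(u) dM_u`:
`x_t(u) = 2H (t^{H-1/2} (t-u)^{H-1/2} - ∫_u^t (v-u)^{H-1/2} d(v^{H-1/2})) 1_{(0,t)}(u)`. -/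
def maKernel (H t u : ℝ) : ℝ :=
  (Set.Ioo 0 t).indicator (fun u =>
    2 * H * (t ^ (H - 1 / 2) * (t - u) ^ (H - 1 / 2) -
      ∫ v in u..t, (v - u) ^ (H - 1 / 2) * ((H - 1 / 2) * v ^ (H - 3 / 2)))) u

/-- `U : L²([0,T], V) → 𝓛_T` is the isometry induced by the correspondences `X_t ↔ x_t` and
`X_t ↔ e_t`: for every `t ∈ [0, T]` the function `x_t` lies in `L²([0,T], V)` and `U x_t = e_t`. -/
def IsSpectralIsometry (H T : ℝ)
    (U : Lp ℂ 2 (varMeasure H T) ≃ₗᵢ[ℂ] freqDomain H T) : Prop :=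
  ∀ t ∈ Set.Icc 0 T, ∃ x : Lp ℂ 2 (varMeasure H T),
    x =ᵐ[varMeasure H T] (fun u => (maKernel H t u : ℂ)) ∧
    (U x : Lp ℂ 2 (specMeasure H)) =ᵐ[specMeasure H] expFun t

/-- The class `𝓛'_T` of all `ψ ∈ 𝓛_T` with `∫ ‖φ(· λ)‖_V |ψ(λ)| μ(dλ) < ∞`, where `‖·‖_V` is the
norm of `L²([0,T], V)`. -/
def freqDomain' (H T : ℝ) : Set (freqDomain H T) :=
  {ψ | ∫⁻ l, eLpNorm (fun u => phi H (u * l)) 2 (varMeasure H T) *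
      ‖(ψ : Lp ℂ 2 (specMeasure H)) l‖ₑ ∂(specMeasure H) < ⊤}

end FBM

end

open MeasureTheory

noncomputable section

open Filter Topology
open scoped InnerProductSpace

namespace FBM

/-! The kernel φ is the Kummer function M(3/2 - H, 2 - 2H, i·) (`hasSum_phi`), an entire series with
explicit coefficients. An identity ∫ f(u) φ(uλ) du = g(λ) is therefore an identity between the
moments of f and the Taylor coefficients of g, and two such identities reduce to Beta integrals. The
density x_t dV gives ∫ x_t φ(·λ) dV = e_t(λ) (`integral_maKernel_mul_phi`). The density 1_(0,t] dV
gives m_t(λ) = ∫_0^t e^{iλr} w_t(r) dr, the spectral image of the fundamental martingale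
(`martFun_eq_integral_phi`).

The analytic heart is ⟨m_t, m_s⟩_μ = V_s for s ≤ t (`integral_martFun_mul_conj`). After damping by
e^{-ε|λ|}, Fubini turns the inner product into the integral over r in (0, s) of w_s(r) times the
real part of a Laplace transform of λ^{1-2H} m_t, taken at ε + ir. Up to constants that transform is
∫_0^∞ K(ε + ir + x) dx with K(ζ) = ζ^{-b} (ζ - it)^{-b}, b = 3/2 - H. At ε = 0 its derivative in r
is -iK(ir), and K is real on the segment between its branch points 0 and it. So the real part does
not depend on r in (0, t); its value at r = t/2 is elementary and cancels all constants. What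
remains is ∫_0^s w_s = V_s.

The indicators of (0, t], t < T, are total in L²(V) and have the same Gram matrix, so 1_(0,t] ↦ m_t
extends to an isometry U. The formula Uf(λ) = ∫ f φ(·λ) dV holds for step functions and survives L²
limits, because for each λ its right-hand side is a continuous functional of f. Applied to x_t it
gives U x_t = e_t, so the closed range of U contains 𝓛_T; conversely m_t lies in 𝓛_T as a limit of
superpositions of the e_r.

Uniqueness holds because the inverse is prescribed on the total family e_t. The inversion formula is
⟨1_S, U⁻¹ψ⟩ = ⟨U1_S, ψ⟩ followed by Fubini, for which membership in 𝓛'_T is exactly enough. Density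
of 𝓛'_T comes from averaging e_t until it decays like |λ|⁻³, while φ grows at most linearly. -/

/-! ### The Taylor series of φ and the Kummer function -/

/-- The Taylor coefficients `(3/2 - H)_k / (2 - 2H)_k` of the Kummer function
`M(3/2 - H, 2 - 2H, ·)`. -/
def kummerCoeff (H : ℝ) (k : ℕ) : ℝ :=
  Real.Gamma (k + (3 / 2 - H)) * Real.Gamma (2 - 2 * H) /
    (Real.Gamma (3 / 2 - H) * Real.Gamma (k + (2 - 2 * H)))

theorem kummerCoeff_zero {H : ℝ} (hH1 : H < 1) : kummerCoeff H 0 = 1 := by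
  have h1 := Real.Gamma_pos_of_pos (show (0 : ℝ) < 3 / 2 - H by linarith)
  have h2 := Real.Gamma_pos_of_pos (show (0 : ℝ) < 2 - 2 * H by linarith)
  simp only [kummerCoeff, Nat.cast_zero, zero_add]
  exact div_self (by positivity)

theorem kummerCoeff_succ {H : ℝ} (hH1 : H < 1) (k : ℕ) :
    kummerCoeff H (k + 1) * (k + (2 - 2 * H)) = kummerCoeff H k * (k + (3 / 2 - H)) := by
  have hk : (0 : ℝ) ≤ k := k.cast_nonneg
  have ha : (0 : ℝ) < k + (3 / 2 - H) := by linarith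
  have hb : (0 : ℝ) < k + (2 - 2 * H) := by linarith
  have h1 := Real.Gamma_pos_of_pos (show (0 : ℝ) < 3 / 2 - H by linarith)
  have h3 := Real.Gamma_pos_of_pos hb
  have e1 : ((k + 1 : ℕ) : ℝ) + (3 / 2 - H) = (k + (3 / 2 - H)) + 1 := by push_cast; ring
  have e2 : ((k + 1 : ℕ) : ℝ) + (2 - 2 * H) = (k + (2 - 2 * H)) + 1 := by push_cast; ring
  simp only [kummerCoeff]
  rw [e1, e2, Real.Gamma_add_one ha.ne', Real.Gamma_add_one hb.ne']
  generalize (k : ℝ) + (2 - 2 * H) = b at *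
  generalize (k : ℝ) + (3 / 2 - H) = a at *
  generalize Real.Gamma (3 / 2 - H) = g at *
  field_simp

theorem kummerCoeff_nonneg {H : ℝ} (hH1 : H < 1) (k : ℕ) : 0 ≤ kummerCoeff H k := by
  have hk : (0 : ℝ) ≤ k := k.cast_nonneg
  have h1 := Real.Gamma_pos_of_pos (show (0 : ℝ) < 3 / 2 - H by linarith)
  have h2 := Real.Gamma_pos_of_pos (show (0 : ℝ) < 2 - 2 * H by linarith)
  have h3 := Real.Gamma_pos_of_pos (show (0 : ℝ) < k + (3 / 2 - H) by linarith)
  have h4 := Real.Gamma_pos_of_pos (show (0 : ℝ) < k + (2 - 2 * H) by linarith)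
  unfold kummerCoeff
  positivity

/-- The ratios `(k + a) / (k + b)` of consecutive Kummer coefficients are bounded. -/
theorem exists_kummerCoeff_le_pow {H : ℝ} (hH1 : H < 1) :
    ∃ R : ℝ, 0 < R ∧ ∀ k, kummerCoeff H k ≤ R ^ k := by
  have hb : (0 : ℝ) < 2 - 2 * H := by linarith
  have ha : (0 : ℝ) < 3 / 2 - H := by linarith
  refine ⟨1 + (3 / 2 - H) / (2 - 2 * H), by positivity, fun k => ?_⟩
  induction k with
  | zero => simp [kummerCoeff_zero hH1]
  | succ k ih =>
    have hk : (0 : ℝ) ≤ k := k.cast_nonneg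
    have hkb : (0 : ℝ) < k + (2 - 2 * H) := by linarith
    have h := kummerCoeff_succ hH1 k
    have h' : (k : ℝ) + (3 / 2 - H) ≤ (1 + (3 / 2 - H) / (2 - 2 * H)) * (k + (2 - 2 * H)) := by
      have : (1 + (3 / 2 - H) / (2 - 2 * H)) * (k + (2 - 2 * H))
          = k + (2 - 2 * H) + k * ((3 / 2 - H) / (2 - 2 * H)) + (3 / 2 - H) := by
        generalize 2 - 2 * H = b at *
        generalize 3 / 2 - H = a at *
        field_simp; ring
      rw [this]
      have : 0 ≤ k * ((3 / 2 - H) / (2 - 2 * H)) := by positivity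
      linarith
    rw [← mul_le_mul_iff_of_pos_right hkb, h, pow_succ, mul_assoc]
    exact mul_le_mul ih h' (by linarith) (by positivity)

theorem Gamma_div_Gamma_add_nat_le {s : ℝ} (hs : 0 < s) (k : ℕ) :
    Real.Gamma s / Real.Gamma (k + s) ≤ (1 / s) ^ k := by
  induction k with
  | zero => simp [(Real.Gamma_pos_of_pos hs).ne']
  | succ k ih =>
    have hk : (0 : ℝ) < k + s := by positivity
    have e : ((k + 1 : ℕ) : ℝ) + s = (k + s) + 1 := by push_cast; ring
    have h3 := Real.Gamma_pos_of_pos hk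
    have h4 := Real.Gamma_pos_of_pos hs
    rw [e, Real.Gamma_add_one hk.ne', pow_succ, mul_comm (k + s), ← div_div, div_eq_mul_one_div]
    gcongr
    linarith [(Nat.cast_nonneg k : (0 : ℝ) ≤ k)]

/-- The coefficients of the normalized Bessel series
`Γ(1-H) ∑ₖ (-1)ᵏ / (k! Γ(k + s)) y^(2k)`. -/
def besselCoeff (H s : ℝ) (k : ℕ) : ℂ :=
  (-1) ^ k * ((Real.Gamma (1 - H) / (k.factorial * Real.Gamma (k + s)) : ℝ) : ℂ)

theorem summable_norm_besselCoeff {H s : ℝ} (hs : 0 < s) (y : ℂ) :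
    Summable fun k => ‖besselCoeff H s k * y ^ k‖ := by
  have hg := Real.Gamma_pos_of_pos hs
  refine Summable.of_nonneg_of_le (fun _ => norm_nonneg _) (fun k => ?_)
    ((Real.summable_pow_div_factorial (‖y‖ / s)).mul_left (|Real.Gamma (1 - H)| / Real.Gamma s))
  have h := Gamma_div_Gamma_add_nat_le hs k
  have h3 := Real.Gamma_pos_of_pos (show (0 : ℝ) < k + s by positivity)
  rw [besselCoeff, norm_mul, norm_mul, norm_pow, norm_neg, norm_one, one_pow, one_mul, norm_pow,
    Complex.norm_real, Real.norm_eq_abs, abs_div, abs_of_pos (by positivity :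
      0 < (k.factorial : ℝ) * Real.Gamma (k + s)), div_pow]
  have e : |Real.Gamma (1 - H)| / (k.factorial * Real.Gamma (k + s)) * ‖y‖ ^ k =
      |Real.Gamma (1 - H)| / Real.Gamma s * ((Real.Gamma s / Real.Gamma (k + s)) *
        (‖y‖ ^ k / k.factorial)) := by field_simp
  rw [e]
  have e' : ‖y‖ ^ k / s ^ k / k.factorial = (1 / s) ^ k * (‖y‖ ^ k / k.factorial) := by
    rw [one_div, inv_pow]; field_simp
  rw [e']
  gcongr

/-- The even part of the Taylor series of `e^{-iz/2} φ(z)`. -/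
def evenSeries (H : ℝ) : PowerSeries ℂ :=
  PowerSeries.mk fun n => if Even n then besselCoeff H (1 - H) (n / 2) * (1 / 4) ^ n else 0

/-- The odd part of the Taylor series of `e^{-iz/2} φ(z)`, divided by `i`. -/
def oddSeries (H : ℝ) : PowerSeries ℂ :=
  PowerSeries.mk fun n => if Even n then 0 else besselCoeff H (2 - H) (n / 2) * (1 / 4) ^ n

/-- This is the Bessel recurrence (x^H J_{-H})' = -x^H J_{1-H}, read off coefficientwise. -/
theorem derivative_evenSeries {H : ℝ} (hH1 : H < 1) :
    PowerSeries.derivative ℂ (evenSeries H) = PowerSeries.C (-1 / 2) * oddSeries H := by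
  ext n
  rw [PowerSeries.coeff_derivative, PowerSeries.coeff_C_mul, evenSeries, oddSeries,
    PowerSeries.coeff_mk, PowerSeries.coeff_mk]
  rcases Nat.even_or_odd' n with ⟨k, rfl | rfl⟩
  · simp
  · have h1 : ¬ Even (2 * k + 1) := by simp
    have h2 : Even (2 * k + 1 + 1) := by simp [Nat.even_add_one]
    rw [if_neg h1, if_pos h2, show (2 * k + 1 + 1) / 2 = k + 1 by omega,
      show (2 * k + 1) / 2 = k by omega, besselCoeff, besselCoeff]
    have hk : (0 : ℝ) < k + (2 - H) := by linarith [(Nat.cast_nonneg k : (0 : ℝ) ≤ k)]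
    have hg := (Real.Gamma_pos_of_pos hk).ne'
    have e : ((k + 1 : ℕ) : ℝ) + (1 - H) = k + (2 - H) := by push_cast; ring
    rw [e, Nat.factorial_succ]
    have hf : (k.factorial : ℂ) ≠ 0 := by exact_mod_cast k.factorial_ne_zero
    have hk' : (k : ℂ) + 1 ≠ 0 := by exact_mod_cast k.succ_ne_zero
    have hg' : (Real.Gamma (k + (2 - H)) : ℂ) ≠ 0 := by exact_mod_cast hg
    push_cast
    field_simp
    ring

/-- The Bessel recurrence (x^{1-H} J_{1-H})' = x^{1-H} J_{-H} is behind this. The odd part carries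
the factor x^H instead of x^{1-H}, hence the extra term with 2H - 1; multiplication by `X` avoids
the division by z. -/
theorem X_mul_derivative_oddSeries {H : ℝ} (hH1 : H < 1) :
    PowerSeries.X * PowerSeries.derivative ℂ (oddSeries H) =
      PowerSeries.C (1 / 2) * (PowerSeries.X * evenSeries H) +
        PowerSeries.C ((2 * H - 1 : ℝ) : ℂ) * oddSeries H := by
  ext n
  rw [map_add, PowerSeries.coeff_C_mul, PowerSeries.coeff_C_mul]
  rcases n with _ | n
  · simp [oddSeries]
  rw [PowerSeries.coeff_succ_X_mul, PowerSeries.coeff_succ_X_mul, PowerSeries.coeff_derivative,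
    evenSeries, oddSeries, PowerSeries.coeff_mk, PowerSeries.coeff_mk]
  rcases Nat.even_or_odd' n with ⟨k, rfl | rfl⟩
  · have h1 : ¬ Even (2 * k + 1) := by simp
    have h2 : Even (2 * k) := by simp
    rw [if_neg h1, if_pos h2, show (2 * k) / 2 = k by omega,
      show (2 * k + 1) / 2 = k by omega, besselCoeff, besselCoeff]
    have hk : (0 : ℝ) < k + (1 - H) := by linarith [(Nat.cast_nonneg k : (0 : ℝ) ≤ k)]
    have hg := (Real.Gamma_pos_of_pos hk).ne'
    have e : (k : ℝ) + (2 - H) = k + (1 - H) + 1 := by ring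
    rw [e, Real.Gamma_add_one hk.ne']
    have hf : (k.factorial : ℂ) ≠ 0 := by exact_mod_cast k.factorial_ne_zero
    have hk' : (k : ℂ) + (1 - H) ≠ 0 := by exact_mod_cast hk.ne'
    have hg' : (Real.Gamma (k + (1 - H)) : ℂ) ≠ 0 := by exact_mod_cast hg
    push_cast
    field_simp
    ring
  · have h1 : ¬ Even (2 * k + 1) := by simp
    have h2 : Even (2 * k + 1 + 1) := by simp [Nat.even_add_one]
    simp [h1, h2]

/-- The Taylor series of `e^{iz/2}`. -/
def halfExpSeries : PowerSeries ℂ :=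
  PowerSeries.mk fun n => (Complex.I / 2) ^ n / n.factorial

theorem derivative_halfExpSeries :
    PowerSeries.derivative ℂ halfExpSeries = PowerSeries.C (Complex.I / 2) * halfExpSeries := by
  ext n
  rw [PowerSeries.coeff_derivative, PowerSeries.coeff_C_mul, halfExpSeries,
    PowerSeries.coeff_mk, PowerSeries.coeff_mk, Nat.factorial_succ]
  have hf : (n.factorial : ℂ) ≠ 0 := by exact_mod_cast n.factorial_ne_zero
  have hk' : (n : ℂ) + 1 ≠ 0 := by exact_mod_cast n.succ_ne_zero
  push_cast
  field_simp
  ring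

/-- The Taylor series of `φ`. -/
def phiSeries (H : ℝ) : PowerSeries ℂ :=
  halfExpSeries * (evenSeries H + PowerSeries.C Complex.I * oddSeries H)

/-- The two Bessel recurrences make P = E(A + iB) and Q = E(A - iB) a first order linear system, zP'
= izP + κ(P - Q) and zQ' = -κ(P - Q) with κ = H - 1/2. Eliminating Q leaves Kummer's two-term
recursion for the coefficients of P. -/
theorem coeff_phiSeries_succ {H : ℝ} (hH1 : H < 1) (n : ℕ) :
    PowerSeries.coeff (n + 1) (phiSeries H) * ((n + 1) * (n + (2 - 2 * H))) =
      Complex.I * PowerSeries.coeff n (phiSeries H) * (n + (3 / 2 - H)) := by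
  set E := halfExpSeries
  set A := evenSeries H
  set B := oddSeries H
  set P := phiSeries H
  set Q : PowerSeries ℂ := E * (A - PowerSeries.C Complex.I * B)
  set κ : ℂ := ((H - 1 / 2 : ℝ) : ℂ)
  have hE := derivative_halfExpSeries
  have hA := derivative_evenSeries hH1
  have hB := X_mul_derivative_oddSeries hH1
  have hI : PowerSeries.C Complex.I * PowerSeries.C Complex.I = (-1 : PowerSeries ℂ) := by
    rw [← map_mul, Complex.I_mul_I, map_neg, map_one]
  have hI2 : PowerSeries.C (Complex.I / 2) = PowerSeries.C Complex.I * PowerSeries.C (1 / 2) := by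
    rw [← map_mul]; congr 1; ring
  have hm : PowerSeries.C (-1 / 2 : ℂ) = - PowerSeries.C (1 / 2) := by
    rw [← map_neg]; congr 1; ring
  have h2 : PowerSeries.C (1 / 2 : ℂ) + PowerSeries.C (1 / 2 : ℂ) = 1 := by
    rw [← map_add]; norm_num
  have hκ : PowerSeries.C ((2 * H - 1 : ℝ) : ℂ) = PowerSeries.C κ + PowerSeries.C κ := by
    rw [← map_add]; congr 1; simp only [κ]; push_cast; ring
  have hP : PowerSeries.X * PowerSeries.derivative ℂ P =
      PowerSeries.C Complex.I * (PowerSeries.X * P) + PowerSeries.C κ * (P - Q) := by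
    simp only [P, Q, phiSeries, Derivation.leibniz, map_add, smul_eq_mul, PowerSeries.derivative_C,
      mul_zero, add_zero]
    rw [hE, hA]
    linear_combination (exp := 1) E * PowerSeries.C Complex.I * hB
      + E * PowerSeries.X * (A + PowerSeries.C Complex.I * B) * hI2
      + E * PowerSeries.X * B * hm + E * PowerSeries.C Complex.I * B * hκ
      + (PowerSeries.X * E * B * PowerSeries.C (1 / 2) - PowerSeries.X * E * B) * hI
      + PowerSeries.X * E * (PowerSeries.C Complex.I * A - B) * h2
  have hQ : PowerSeries.X * PowerSeries.derivative ℂ Q = - PowerSeries.C κ * (P - Q) := by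
    simp only [P, Q, phiSeries, Derivation.leibniz, map_sub, smul_eq_mul, PowerSeries.derivative_C,
      mul_zero, add_zero]
    rw [hE, hA]
    linear_combination (exp := 1) -E * PowerSeries.C Complex.I * hB
      + E * PowerSeries.X * (A - PowerSeries.C Complex.I * B) * hI2
      + E * PowerSeries.X * B * hm - E * PowerSeries.C Complex.I * B * hκ
      - (PowerSeries.X * E * B * PowerSeries.C (1 / 2)) * hI
  have hP' := congrArg (PowerSeries.coeff (n + 1)) hP
  have hQ' := congrArg (PowerSeries.coeff (n + 1)) hQ
  rw [PowerSeries.coeff_succ_X_mul, PowerSeries.coeff_derivative, map_add, PowerSeries.coeff_C_mul,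
    PowerSeries.coeff_succ_X_mul, PowerSeries.coeff_C_mul, map_sub] at hP'
  rw [PowerSeries.coeff_succ_X_mul, PowerSeries.coeff_derivative, ← map_neg,
    PowerSeries.coeff_C_mul, map_sub] at hQ'
  have hk : κ = H - 1 / 2 := by simp only [κ]; push_cast; ring
  rw [hk] at hP' hQ'
  -- The multipliers n + 1 - κ and -κ are those that cancel the coefficient of Q.
  linear_combination (n + 1 - (H - 1 / 2 : ℂ)) * hP' - (H - 1 / 2 : ℂ) * hQ'

theorem coeff_phiSeries {H : ℝ} (hH1 : H < 1) (n : ℕ) :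
    PowerSeries.coeff n (phiSeries H) =
      (kummerCoeff H n : ℂ) * (Complex.I ^ n / n.factorial) := by
  induction n with
  | zero =>
    have hg : (Real.Gamma (1 - H) : ℂ) ≠ 0 := by
      exact_mod_cast (Real.Gamma_pos_of_pos (by linarith)).ne'
    simp [phiSeries, halfExpSeries, evenSeries, oddSeries, kummerCoeff_zero hH1, besselCoeff, hg,
      PowerSeries.coeff_mul]
  | succ n ih =>
    have h := coeff_phiSeries_succ hH1 n
    have hk := kummerCoeff_succ hH1 n
    have hk' : (kummerCoeff H (n + 1) : ℂ) * (n + (2 - 2 * H)) =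
        kummerCoeff H n * (n + (3 / 2 - H)) := by
      have := congrArg (fun x : ℝ => (x : ℂ)) hk
      push_cast at this
      exact this
    have h1 : (n : ℂ) + 1 ≠ 0 := by exact_mod_cast n.succ_ne_zero
    have h2 : (n : ℂ) + (2 - 2 * H) ≠ 0 := by
      have : (n : ℝ) + (2 - 2 * H) ≠ 0 := by
        have := (Nat.cast_nonneg n : (0 : ℝ) ≤ n)
        linarith
      exact_mod_cast this
    have hf : (n.factorial : ℂ) ≠ 0 := by exact_mod_cast n.factorial_ne_zero
    rw [← mul_left_inj' (mul_ne_zero h1 h2), h, ih, Nat.factorial_succ]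
    push_cast
    field_simp
    linear_combination -2 * Complex.I ^ (n + 1) * hk'

theorem hasSum_evenSeries {H : ℝ} (hH1 : H < 1) (z : ℂ) :
    HasSum (fun n => PowerSeries.coeff n (evenSeries H) * z ^ n)
      (∑' k, besselCoeff H (1 - H) k * ((z / 4) ^ 2) ^ k) ∧
    Summable fun n => ‖PowerSeries.coeff n (evenSeries H) * z ^ n‖ := by
  have hinj : Function.Injective fun k : ℕ => 2 * k := fun a b h => by simpa using h
  have hs := summable_norm_besselCoeff (H := H) (show 0 < 1 - H by linarith) ((z / 4) ^ 2)
  have h0 : ∀ n ∉ Set.range (fun k : ℕ => 2 * k),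
      PowerSeries.coeff n (evenSeries H) * z ^ n = 0 := by
    intro n hn
    have : ¬ Even n := fun ⟨k, hk⟩ => hn ⟨k, by simp only; omega⟩
    simp [evenSeries, this]
  have he : ∀ k : ℕ, PowerSeries.coeff (2 * k) (evenSeries H) * z ^ (2 * k) =
      besselCoeff H (1 - H) k * ((z / 4) ^ 2) ^ k := by
    intro k
    rw [evenSeries, PowerSeries.coeff_mk, if_pos (by simp), show 2 * k / 2 = k by omega,
      ← pow_mul, div_pow, div_pow]
    ring
  constructor
  · rw [← hinj.hasSum_iff h0]
    exact (hs.of_norm.hasSum).congr_fun he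
  · rw [← hinj.summable_iff (fun n hn => by rw [h0 n hn, norm_zero])]
    exact hs.congr fun k => by simp only [Function.comp, he]

theorem hasSum_oddSeries {H : ℝ} (hH1 : H < 1) (z : ℂ) :
    HasSum (fun n => PowerSeries.coeff n (oddSeries H) * z ^ n)
      (z / 4 * ∑' k, besselCoeff H (2 - H) k * ((z / 4) ^ 2) ^ k) ∧
    Summable fun n => ‖PowerSeries.coeff n (oddSeries H) * z ^ n‖ := by
  have hinj : Function.Injective fun k : ℕ => 2 * k + 1 := fun a b h => by simpa using h
  have hs := summable_norm_besselCoeff (H := H) (show 0 < 2 - H by linarith) ((z / 4) ^ 2)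
  have h0 : ∀ n ∉ Set.range (fun k : ℕ => 2 * k + 1),
      PowerSeries.coeff n (oddSeries H) * z ^ n = 0 := by
    intro n hn
    have : Even n := by
      by_contra h
      obtain ⟨k, hk⟩ := Nat.not_even_iff_odd.1 h
      exact hn ⟨k, hk.symm⟩
    simp [oddSeries, this]
  have he : ∀ k : ℕ, PowerSeries.coeff (2 * k + 1) (oddSeries H) * z ^ (2 * k + 1) =
      z / 4 * (besselCoeff H (2 - H) k * ((z / 4) ^ 2) ^ k) := by
    intro k
    rw [oddSeries, PowerSeries.coeff_mk, if_neg (by simp), show (2 * k + 1) / 2 = k by omega,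
      ← pow_mul, div_pow, div_pow]
    ring
  constructor
  · rw [← hinj.hasSum_iff h0]
    exact (hs.of_norm.hasSum.mul_left _).congr_fun he
  · rw [← hinj.summable_iff (fun n hn => by rw [h0 n hn, norm_zero])]
    exact (hs.mul_left ‖z / 4‖).congr fun k => by simp only [Function.comp, he, norm_mul]

theorem phi_eq_bessel_series {H : ℝ} {z : ℝ} (hz : z ≠ 0) :
    phi H z = Complex.exp (Complex.I / 2 * z) *
      ((∑' k, besselCoeff H (1 - H) k * (((z : ℂ) / 4) ^ 2) ^ k) +
        Complex.I * ((z : ℂ) / 4 * ∑' k, besselCoeff H (2 - H) k * (((z : ℂ) / 4) ^ 2) ^ k)) := by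
  have hz4 : (z : ℂ) / 4 ≠ 0 := by simpa using hz
  have hz4' : (z : ℂ) / 2 / 2 = z / 4 := by ring
  -- `Complex.cpow_add` needs only a nonzero base, so the principal branches cancel for negative z
  -- too.
  have e1 : ((z : ℂ) / 4) ^ (H : ℂ) * ((z : ℂ) / 4) ^ ((-H : ℝ) : ℂ) = 1 := by
    rw [← Complex.cpow_add _ _ hz4]; simp
  have e2 : ((z : ℂ) / 4) ^ (H : ℂ) * ((z : ℂ) / 4) ^ ((1 - H : ℝ) : ℂ) = z / 4 := by
    rw [← Complex.cpow_add _ _ hz4]; simp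
  have key : ∀ ν s : ℝ, ν + 1 = s → (Real.Gamma (1 - H) : ℂ) *
      (∑' k : ℕ, (-1) ^ k / ((k.factorial : ℂ) * Complex.Gamma (k + ν + 1)) *
        ((z : ℂ) / 4) ^ (2 * k)) = ∑' k, besselCoeff H s k * (((z : ℂ) / 4) ^ 2) ^ k := by
    intro ν s hs
    rw [← tsum_mul_left]
    refine tsum_congr fun k => ?_
    have : (k : ℂ) + ν + 1 = ((k + s : ℝ) : ℂ) := by rw [← hs]; push_cast; ring
    rw [this, Complex.Gamma_ofReal, besselCoeff, pow_mul]
    push_cast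
    ring
  rw [phi, if_neg hz, besselJ, besselJ, hz4', ← key (-H) (1 - H) (by ring),
    ← key (1 - H) (2 - H) (by ring), show Complex.I * (z : ℂ) / 2 = Complex.I / 2 * z by ring]
  linear_combination (Real.Gamma (1 - H) : ℂ) * Complex.exp (Complex.I / 2 * z) *
    ((∑' k : ℕ, (-1) ^ k / ((k.factorial : ℂ) * Complex.Gamma (k + ((-H : ℝ) : ℂ) + 1)) *
        ((z : ℂ) / 4) ^ (2 * k)) * e1 + Complex.I *
      (∑' k : ℕ, (-1) ^ k / ((k.factorial : ℂ) * Complex.Gamma (k + ((1 - H : ℝ) : ℂ) + 1)) *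
        ((z : ℂ) / 4) ^ (2 * k)) * e2)

/-- The Fourier kernel is the Kummer function `φ(z) = M(3/2 - H, 2 - 2H, iz)`. -/
theorem hasSum_phi {H : ℝ} (hH1 : H < 1) (z : ℝ) :
    HasSum (fun k => (kummerCoeff H k : ℂ) * ((Complex.I * z) ^ k / k.factorial)) (phi H z) := by
  rcases eq_or_ne z 0 with rfl | hz
  · rw [phi, if_pos rfl]
    convert hasSum_single (f := fun k : ℕ =>
      (kummerCoeff H k : ℂ) * ((Complex.I * ((0 : ℝ) : ℂ)) ^ k / k.factorial)) 0
      (fun k hk => by simp [hk]) using 1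
    simp [kummerCoeff_zero hH1]
  rw [phi_eq_bessel_series hz]
  obtain ⟨hA, hA'⟩ := hasSum_evenSeries hH1 (z : ℂ)
  obtain ⟨hB, hB'⟩ := hasSum_oddSeries hH1 (z : ℂ)
  have hE : HasSum (fun n => PowerSeries.coeff n halfExpSeries * (z : ℂ) ^ n)
      (Complex.exp (Complex.I / 2 * z)) := by
    rw [Complex.exp_eq_exp_ℂ]
    refine (NormedSpace.exp_series_hasSum_exp' (𝕂 := ℂ) (Complex.I / 2 * z)).congr_fun
      fun n => ?_
    rw [halfExpSeries, PowerSeries.coeff_mk, smul_eq_mul, mul_pow]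
    ring
  have hE' : Summable fun n => ‖PowerSeries.coeff n halfExpSeries * (z : ℂ) ^ n‖ :=
    hE.summable.norm
  have hC := hA.add (hB.mul_left Complex.I)
  have hC' := hC.summable.norm
  have hprod := (summable_norm_sum_mul_antidiagonal_of_summable_norm hE' hC').of_norm.hasSum
  rw [← tsum_mul_tsum_eq_tsum_sum_antidiagonal_of_summable_norm hE' hC', hE.tsum_eq,
    hC.tsum_eq] at hprod
  refine hprod.congr_fun fun n => ?_
  have : (kummerCoeff H n : ℂ) * ((Complex.I * z) ^ n / n.factorial) =
      PowerSeries.coeff n (phiSeries H) * (z : ℂ) ^ n := by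
    rw [coeff_phiSeries hH1, mul_pow]; ring
  rw [this, phiSeries, PowerSeries.coeff_mul, Finset.sum_mul]
  refine Finset.sum_congr rfl fun p hp => ?_
  rw [← Finset.HasAntidiagonal.mem_antidiagonal.1 hp, pow_add, map_add, PowerSeries.coeff_C_mul]
  ring

/-! ### Termwise integration, Beta integrals and the growth of φ -/

theorem intervalIntegrable_ofReal {f : ℝ → ℝ} {a b : ℝ} (hf : IntervalIntegrable f volume a b) :
    IntervalIntegrable (fun x => (f x : ℂ)) volume a b :=
  ⟨hf.1.ofReal, hf.2.ofReal⟩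

theorem intervalIntegrable_rpow_mul_sub_rpow {p q : ℝ} (hp : 0 < p) (hq : 0 < q) {t : ℝ}
    (ht : 0 ≤ t) :
    IntervalIntegrable (fun r : ℝ => r ^ (p - 1) * (t - r) ^ (q - 1)) volume 0 t := by
  rcases ht.eq_or_lt with rfl | ht
  · simp
  -- Each half of the interval meets only one endpoint singularity; the reflection r ↦ t - r
  -- exchanges the halves.
  have key : ∀ {p q : ℝ}, 0 < p →
      IntervalIntegrable (fun r : ℝ => r ^ (p - 1) * (t - r) ^ (q - 1)) volume 0 (t / 2) := by
    intro p q hp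
    refine (intervalIntegral.intervalIntegrable_rpow' (by linarith)).mul_continuousOn ?_
    refine ContinuousOn.rpow_const (by fun_prop) fun x hx => Or.inl ?_
    rw [Set.uIcc_of_le (by linarith)] at hx
    linarith [hx.2]
  refine (key hp).trans ?_
  have h := ((key (p := q) (q := p) hq).comp_sub_left t).symm
  simp only [sub_zero, sub_sub_cancel] at h
  rw [show t - t / 2 = t / 2 by ring] at h
  refine h.congr ?_
  exact fun r _ => mul_comm _ _

theorem integral_rpow_mul_sub_rpow {p q : ℝ} (hp : 0 < p) (hq : 0 < q) {t : ℝ} (ht : 0 < t) :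
    ∫ r in (0 : ℝ)..t, r ^ (p - 1) * (t - r) ^ (q - 1) =
      t ^ (p + q - 1) * (Real.Gamma p * Real.Gamma q / Real.Gamma (p + q)) := by
  have h := Complex.betaIntegral_scaled (p : ℂ) (q : ℂ) ht
  rw [Complex.betaIntegral_eq_Gamma_mul_div _ _ (by simpa) (by simpa), ← Complex.ofReal_add,
    Complex.Gamma_ofReal, Complex.Gamma_ofReal, Complex.Gamma_ofReal] at h
  apply Complex.ofReal_injective
  rw [← intervalIntegral.integral_ofReal]
  have e : (t : ℂ) ^ (((p + q : ℝ) : ℂ) - 1) = ((t ^ (p + q - 1) : ℝ) : ℂ) := by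
    rw [Complex.ofReal_cpow ht.le]; push_cast; rfl
  rw [e] at h
  push_cast at h ⊢
  rw [← h]
  refine intervalIntegral.integral_congr fun r hr => ?_
  rw [Set.uIcc_of_le ht.le] at hr
  rw [Complex.ofReal_cpow hr.1, Complex.ofReal_cpow (by linarith [hr.2])]
  push_cast
  rfl

/-- Termwise integration of a power series with coefficients of exponential growth over `k!`. -/
theorem hasSum_integral_mul_series {c : ℕ → ℝ} {R : ℝ} (hc : ∀ k, |c k| ≤ R ^ k) (hR : 0 ≤ R)
    {F : ℝ → ℂ} (hF : ∀ x : ℝ, HasSum (fun k => (c k : ℂ) * ((Complex.I * x) ^ k / k.factorial)) (F x))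
    {f : ℝ → ℂ} {t : ℝ} (ht : 0 ≤ t) (hf : IntervalIntegrable f volume 0 t) (l : ℝ) :
    HasSum (fun k => (c k : ℂ) * ((Complex.I * l) ^ k / k.factorial) *
      ∫ u in (0 : ℝ)..t, f u * (u : ℂ) ^ k) (∫ u in (0 : ℝ)..t, f u * F (u * l)) := by
  simp_rw [← intervalIntegral.integral_const_mul]
  refine intervalIntegral.hasSum_integral_of_dominated_convergence
    (fun k u => ‖f u‖ * ((R * (|l| * t)) ^ k / k.factorial)) (fun k => ?_) (fun k => ?_) ?_ ?_ ?_
  · have h1 := hf.aestronglyMeasurable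
    rw [Set.uIoc_of_le ht]
    refine AEStronglyMeasurable.const_mul (h1.mul ?_) _
    exact (by fun_prop : Continuous fun u : ℝ => (u : ℂ) ^ k).aestronglyMeasurable
  · refine Filter.Eventually.of_forall fun u hu => ?_
    rw [Set.uIoc_of_le ht] at hu
    rw [norm_mul, norm_mul, norm_mul, norm_div, norm_pow, norm_pow, norm_mul, Complex.norm_I,
      one_mul, Complex.norm_real, Complex.norm_real, Complex.norm_real, Complex.norm_natCast,
      Real.norm_eq_abs, Real.norm_eq_abs, Real.norm_eq_abs, abs_of_pos hu.1, mul_pow, mul_pow]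
    have e : |c k| * (|l| ^ k / k.factorial) * (‖f u‖ * u ^ k) =
      ‖f u‖ * (|c k| * (|l| ^ k * u ^ k) / k.factorial) := by ring
    rw [e]
    have := hc k
    have := hu.1.le
    have := hu.2
    gcongr
  · exact Filter.Eventually.of_forall fun u _ =>
      (Real.summable_pow_div_factorial _).mul_left _
  · simp_rw [tsum_mul_left]
    exact hf.norm.mul_const _
  · refine Filter.Eventually.of_forall fun u _ => ?_
    refine ((hF (u * l)).mul_left (f u)).congr_fun fun k => ?_
    push_cast
    ring

theorem measurable_phi {H : ℝ} (hH1 : H < 1) : Measurable (phi H) := by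
  refine measurable_of_tendsto_metrizable (f := fun n (z : ℝ) => ∑ k ∈ Finset.range n,
    (kummerCoeff H k : ℂ) * ((Complex.I * z) ^ k / k.factorial)) (fun n => ?_) ?_
  · fun_prop
  · exact tendsto_pi_nhds.2 fun z => (hasSum_phi hH1 z).tendsto_sum_nat

theorem hasSum_exp_I_mul (x : ℝ) :
    HasSum (fun k => ((1 : ℝ) : ℂ) * ((Complex.I * x) ^ k / k.factorial))
      (Complex.exp (Complex.I * x)) := by
  rw [Complex.exp_eq_exp_ℂ]
  refine (NormedSpace.exp_series_hasSum_exp' (𝕂 := ℂ) (Complex.I * x)).congr_fun fun n => ?_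
  rw [smul_eq_mul]
  push_cast
  ring

theorem hasSum_one_add_mul_exp (a x : ℝ) :
    HasSum (fun k : ℕ => ((1 + k * a : ℝ) : ℂ) * ((Complex.I * x) ^ k / k.factorial))
      ((1 + a * (Complex.I * x)) * Complex.exp (Complex.I * x)) := by
  have h := hasSum_exp_I_mul x
  have h1 : HasSum (fun k : ℕ => (k : ℂ) * ((Complex.I * x) ^ k / k.factorial))
      (Complex.I * x * Complex.exp (Complex.I * x)) := by
    rw [← hasSum_nat_add_iff' 1]
    simp only [Finset.range_one, Finset.sum_singleton, Nat.cast_zero, zero_mul, sub_zero]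
    refine (h.mul_left (Complex.I * x)).congr_fun fun k => ?_
    have hf : (k.factorial : ℂ) ≠ 0 := by exact_mod_cast k.factorial_ne_zero
    have hk' : (k : ℂ) + 1 ≠ 0 := by exact_mod_cast k.succ_ne_zero
    rw [Nat.factorial_succ]
    push_cast
    field_simp
    ring
  have h2 := h.add (h1.mul_left (a : ℂ))
  rw [add_mul, one_mul, mul_assoc]
  refine h2.congr_fun fun k => ?_
  push_cast
  ring

/-- The moments of a symmetric Beta weight, as complex integrals. -/
theorem integral_beta_weight_mul_pow {p q t : ℝ} (hp : 0 < p) (hq : 0 < q) (ht : 0 < t) (k : ℕ) :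
    ∫ r in (0 : ℝ)..t, ((r ^ (p - 1) * (t - r) ^ (q - 1) : ℝ) : ℂ) * (r : ℂ) ^ k =
      ((t ^ (k + p + q - 1) *
        (Real.Gamma (k + p) * Real.Gamma q / Real.Gamma (k + p + q)) : ℝ) : ℂ) := by
  have hk : (0 : ℝ) ≤ k := k.cast_nonneg
  rw [← integral_rpow_mul_sub_rpow (by linarith) hq ht, ← intervalIntegral.integral_ofReal]
  rw [intervalIntegral.integral_of_le ht.le, intervalIntegral.integral_of_le ht.le]
  refine setIntegral_congr_fun measurableSet_Ioc fun r hr => ?_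
  have : r ^ (k + p - 1) = r ^ (p - 1) * r ^ k := by
    rw [← Real.rpow_natCast, ← Real.rpow_add hr.1]; congr 1; ring
  simp only [this]
  push_cast
  ring

/-- The Kummer function is a mixture of exponentials and their derivatives. -/
theorem phi_eq_integral {H : ℝ} (hH1 : H < 1) (z : ℝ) :
    phi H z = ((Real.Gamma (3 - 2 * H) / Real.Gamma (3 / 2 - H) ^ 2 : ℝ) : ℂ) *
      ∫ s in (0 : ℝ)..1, ((s ^ (3 / 2 - H - 1) * (1 - s) ^ (3 / 2 - H - 1) : ℝ) : ℂ) *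
        ((1 + (((2 - 2 * H)⁻¹ : ℝ) : ℂ) * (Complex.I * ((s * z : ℝ) : ℂ))) *
          Complex.exp (Complex.I * ((s * z : ℝ) : ℂ))) := by
  have hb : 0 < 3 / 2 - H := by linarith
  have ha : 0 < 2 - 2 * H := by linarith
  have ha' : 0 < (2 - 2 * H)⁻¹ := inv_pos.2 ha
  have h := hasSum_integral_mul_series (c := fun k : ℕ => 1 + k * (2 - 2 * H)⁻¹)
    (R := 1 + (2 - 2 * H)⁻¹) (fun k => ?_) (by positivity)
    (hasSum_one_add_mul_exp (2 - 2 * H)⁻¹) zero_le_one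
    (intervalIntegrable_ofReal (intervalIntegrable_rpow_mul_sub_rpow hb hb zero_le_one)) z
  swap
  · rw [abs_of_pos (by positivity)]
    exact one_add_mul_le_pow (by linarith) k
  refine (hasSum_phi hH1 z).unique
    ((h.mul_left ((Real.Gamma (3 - 2 * H) / Real.Gamma (3 / 2 - H) ^ 2 : ℝ) : ℂ)).congr_fun
      fun k => ?_)
  have hk : (0 : ℝ) ≤ k := k.cast_nonneg
  -- Euler's integral for M(3/2 - H, 2 - 2H, ·) would need the weight (1 - s)^{-1/2-H}, which is not
  -- integrable when H ≥ 1/2. Raising the second parameter to 3 - 2H = 2(3/2 - H) gives a symmetric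
  -- Beta weight for every H < 1. The price is the factor 1 + k/(2 - 2H) in the coefficients, that
  -- is, the operator 1 + (2 - 2H)⁻¹ z d/dz acting on the exponentials.
  have h2 : kummerCoeff H k = Real.Gamma (3 - 2 * H) / Real.Gamma (3 / 2 - H) ^ 2 *
      ((1 + k * (2 - 2 * H)⁻¹) * (Real.Gamma (k + (3 / 2 - H)) * Real.Gamma (3 / 2 - H) /
        Real.Gamma (k + (3 / 2 - H) + (3 / 2 - H)))) := by
    have e1 : (3 - 2 * H) = (2 - 2 * H) + 1 := by ring
    have e2 : (k : ℝ) + (3 / 2 - H) + (3 / 2 - H) = (k + (2 - 2 * H)) + 1 := by ring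
    have hka : 0 < (k : ℝ) + (2 - 2 * H) := by linarith
    rw [e1, e2, Real.Gamma_add_one ha.ne', Real.Gamma_add_one hka.ne', kummerCoeff]
    have g1 := (Real.Gamma_pos_of_pos hka).ne'
    have g2 := (Real.Gamma_pos_of_pos hb).ne'
    have hka := hka.ne'
    have ha := ha.ne'
    generalize Real.Gamma (k + (2 - 2 * H)) = x1 at *
    generalize Real.Gamma (3 / 2 - H) = x2 at *
    generalize (2 - 2 * H) = a at *
    field_simp
    ring
  rw [integral_beta_weight_mul_pow hb hb one_pos, Real.one_rpow, one_mul, h2]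
  push_cast
  ring

/-- In the mixture `phi_eq_integral` the exponentials have modulus one and the weight is a
probability density after normalization, so only the derivative term grows. Linear growth is not
sharp, but it is all that the integrability arguments require. -/
theorem norm_phi_le {H : ℝ} (hH1 : H < 1) (z : ℝ) : ‖phi H z‖ ≤ 1 + (2 - 2 * H)⁻¹ * |z| := by
  have hb : 0 < 3 / 2 - H := by linarith
  have ha : 0 < 2 - 2 * H := by linarith
  have g1 := Real.Gamma_pos_of_pos (show 0 < 3 - 2 * H by linarith)
  have g2 := Real.Gamma_pos_of_pos hb
  have hi := intervalIntegrable_rpow_mul_sub_rpow hb hb zero_le_one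
  have h1 := integral_rpow_mul_sub_rpow hb hb one_pos
  rw [Real.one_rpow, one_mul, show 3 / 2 - H + (3 / 2 - H) = 3 - 2 * H by ring] at h1
  rw [phi_eq_integral hH1, norm_mul, Complex.norm_real, Real.norm_eq_abs,
    abs_of_pos (by positivity)]
  have h2 : ‖∫ s in (0 : ℝ)..1, ((s ^ (3 / 2 - H - 1) * (1 - s) ^ (3 / 2 - H - 1) : ℝ) : ℂ) *
        ((1 + (((2 - 2 * H)⁻¹ : ℝ) : ℂ) * (Complex.I * ((s * z : ℝ) : ℂ))) *
          Complex.exp (Complex.I * ((s * z : ℝ) : ℂ)))‖ ≤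
      ∫ s in (0 : ℝ)..1, s ^ (3 / 2 - H - 1) * (1 - s) ^ (3 / 2 - H - 1) *
        (1 + (2 - 2 * H)⁻¹ * |z|) := by
    refine intervalIntegral.norm_integral_le_of_norm_le zero_le_one
      (Filter.Eventually.of_forall fun s hs => ?_) (hi.mul_const _)
    have hs0 := hs.1.le
    have hs1 : 0 ≤ 1 - s := by linarith [hs.2]
    rw [norm_mul, Complex.norm_real, Real.norm_eq_abs, abs_of_nonneg (by positivity), norm_mul,
      Complex.norm_exp_I_mul_ofReal, mul_one]
    gcongr
    refine (norm_add_le _ _).trans ?_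
    rw [norm_one, norm_mul, norm_mul, Complex.norm_I, one_mul, Complex.norm_real,
      Complex.norm_real, Real.norm_eq_abs, Real.norm_eq_abs, abs_of_pos (inv_pos.2 ha), abs_mul,
      abs_of_nonneg hs0]
    gcongr
    exact mul_le_of_le_one_left (abs_nonneg _) hs.2
  rw [intervalIntegral.integral_mul_const, h1] at h2
  refine (mul_le_mul_of_nonneg_left h2 (by positivity)).trans (le_of_eq ?_)
  generalize Real.Gamma (3 / 2 - H) = x at *
  field_simp

/-! ### The fundamental martingale in the spectral domain -/

/-- The weight of the fundamental martingale, so that `M_t = ∫_0^t w_t(r) dX_r`. -/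
def weight (H t r : ℝ) : ℝ :=
  (2 * H * Real.Gamma (H + 1 / 2) * Real.Gamma (3 / 2 - H))⁻¹ *
    (r ^ (3 / 2 - H - 1) * (t - r) ^ (3 / 2 - H - 1))

/-- The spectral representation `∫_0^t e^{iλr} w_t(r) dr` of the fundamental martingale. -/
def martFun (H t l : ℝ) : ℂ :=
  ∫ r in (0 : ℝ)..t, (weight H t r : ℂ) * Complex.exp (Complex.I * ((r * l : ℝ) : ℂ))

/-- The density of `dV_u`. -/
def varDens (H u : ℝ) : ℝ := dSq H * (2 - 2 * H) * u ^ (1 - 2 * H)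

theorem intervalIntegrable_weight {H : ℝ} (hH1 : H < 1) {t : ℝ} (ht : 0 ≤ t) :
    IntervalIntegrable (weight H t) volume 0 t :=
  (intervalIntegrable_rpow_mul_sub_rpow (by linarith) (by linarith) ht).const_mul _

theorem intervalIntegrable_varDens {H : ℝ} (hH1 : H < 1) (s t : ℝ) :
    IntervalIntegrable (varDens H) volume s t :=
  (intervalIntegral.intervalIntegrable_rpow' (by linarith)).const_mul _

theorem dSq_pos {H : ℝ} (hH0 : 0 < H) (hH1 : H < 1) : 0 < dSq H := by
  unfold dSq
  have h1 := Real.Gamma_pos_of_pos (show (0 : ℝ) < 3 / 2 - H by linarith)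
  have h2 := Real.Gamma_pos_of_pos (show (0 : ℝ) < H + 1 / 2 by linarith)
  have h3 := Real.Gamma_pos_of_pos (show (0 : ℝ) < 3 - 2 * H by linarith)
  positivity

theorem varDens_nonneg {H : ℝ} (hH0 : 0 < H) (hH1 : H < 1) {u : ℝ} (hu : 0 ≤ u) :
    0 ≤ varDens H u :=
  mul_nonneg (mul_nonneg (dSq_pos hH0 hH1).le (by linarith)) (Real.rpow_nonneg hu _)

/-- Both sides are power series in λ. The k-th moment of w_t is a Beta integral, that of dV is a
pure power of t, and their quotient is the k-th Kummer coefficient; the constant in dV is fixed by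
the case k = 0. -/
theorem martFun_eq_integral_phi {H : ℝ} (hH0 : 0 < H) (hH1 : H < 1) {t : ℝ} (ht : 0 ≤ t) (l : ℝ) :
    ∫ u in (0 : ℝ)..t, (varDens H u : ℂ) * phi H (u * l) = martFun H t l := by
  rcases ht.eq_or_lt with rfl | ht
  · simp [martFun]
  have hb : 0 < 3 / 2 - H := by linarith
  have ha : 0 < 2 - 2 * H := by linarith
  obtain ⟨R, hR, hc⟩ := exists_kummerCoeff_le_pow hH1
  have h1 := hasSum_integral_mul_series
    (fun k => (abs_of_nonneg (kummerCoeff_nonneg hH1 k)).trans_le (hc k)) hR.le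
    (hasSum_phi hH1) ht.le (intervalIntegrable_ofReal (intervalIntegrable_varDens hH1 0 t)) l
  have h2 := hasSum_integral_mul_series (c := fun _ => 1) (R := 1) (fun k => by simp) zero_le_one
    hasSum_exp_I_mul ht.le (intervalIntegrable_ofReal (intervalIntegrable_weight hH1 ht.le)) l
  refine h1.unique (h2.congr_fun fun k => ?_)
  have hk : (0 : ℝ) ≤ k := k.cast_nonneg
  have i1 : ∫ u in (0 : ℝ)..t, (varDens H u : ℂ) * (u : ℂ) ^ k =
      ((dSq H * (2 - 2 * H) * (t ^ (k + (2 - 2 * H)) / (k + (2 - 2 * H))) : ℝ) : ℂ) := by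
    have : t ^ (k + (2 - 2 * H)) / (k + (2 - 2 * H)) =
        ∫ u in (0 : ℝ)..t, u ^ (k + (1 - 2 * H)) := by
      rw [integral_rpow (Or.inl (by linarith)), show (k : ℝ) + (1 - 2 * H) + 1 = k + (2 - 2 * H)
        by ring, Real.zero_rpow (by linarith), sub_zero]
    rw [this, ← intervalIntegral.integral_const_mul, ← intervalIntegral.integral_ofReal,
      intervalIntegral.integral_of_le ht.le, intervalIntegral.integral_of_le ht.le]
    refine setIntegral_congr_fun measurableSet_Ioc fun r hr => ?_
    simp only [varDens]
    rw [Real.rpow_add hr.1, Real.rpow_natCast]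
    push_cast
    ring
  have i2 : ∫ r in (0 : ℝ)..t, (weight H t r : ℂ) * (r : ℂ) ^ k =
      (((2 * H * Real.Gamma (H + 1 / 2) * Real.Gamma (3 / 2 - H))⁻¹ * (t ^ (k + (2 - 2 * H)) *
        (Real.Gamma (k + (3 / 2 - H)) * Real.Gamma (3 / 2 - H) /
          ((k + (2 - 2 * H)) * Real.Gamma (k + (2 - 2 * H))))) : ℝ) : ℂ) := by
    have := integral_beta_weight_mul_pow hb hb ht k
    rw [show (k : ℝ) + (3 / 2 - H) + (3 / 2 - H) = k + (2 - 2 * H) + 1 by ring,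
      Real.Gamma_add_one (by linarith), add_sub_cancel_right] at this
    rw [Complex.ofReal_mul, ← this, ← intervalIntegral.integral_const_mul]
    refine intervalIntegral.integral_congr fun r _ => ?_
    simp only [weight]
    push_cast
    ring
  rw [i1, i2]
  have e : kummerCoeff H k *
      (dSq H * (2 - 2 * H) * (t ^ (k + (2 - 2 * H)) / (k + (2 - 2 * H)))) =
      (2 * H * Real.Gamma (H + 1 / 2) * Real.Gamma (3 / 2 - H))⁻¹ * (t ^ (k + (2 - 2 * H)) *
        (Real.Gamma (k + (3 / 2 - H)) * Real.Gamma (3 / 2 - H) /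
          ((k + (2 - 2 * H)) * Real.Gamma (k + (2 - 2 * H))))) := by
    have hka : 0 < (k : ℝ) + (2 - 2 * H) := by linarith
    have g1 := (Real.Gamma_pos_of_pos hka).ne'
    have g2 := (Real.Gamma_pos_of_pos hb).ne'
    have g3 := (Real.Gamma_pos_of_pos ha).ne'
    have g4 := (Real.Gamma_pos_of_pos (show 0 < H + 1 / 2 by linarith)).ne'
    have hka := hka.ne'
    have ha := ha.ne'
    rw [kummerCoeff, dSq, show 3 - 2 * H = (2 - 2 * H) + 1 by ring, Real.Gamma_add_one ha]
    generalize Real.Gamma (k + (2 - 2 * H)) = x1 at *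
    generalize Real.Gamma (3 / 2 - H) = x2 at *
    generalize Real.Gamma (2 - 2 * H) = x3 at *
    generalize Real.Gamma (H + 1 / 2) = x4 at *
    generalize (k : ℝ) + (2 - 2 * H) = y at *
    generalize (2 - 2 * H) = a at *
    have := hH0.ne'
    field_simp
  rw [Complex.ofReal_one, one_mul, mul_right_comm, ← Complex.ofReal_mul, e]
  ring

/-! ### The measure dV and the moving average kernel -/

theorem measurable_varDens (H : ℝ) : Measurable (varDens H) := by
  unfold varDens; fun_prop

theorem varMeasure_eq_withDensity (H T : ℝ) :
    varMeasure H T =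
      (volume.restrict (Set.Ioc 0 T)).withDensity fun u => ENNReal.ofReal (varDens H u) := by
  rw [varMeasure, restrict_withDensity measurableSet_Icc, Measure.restrict_congr_set Ioc_ae_eq_Icc.symm]
  rfl

theorem integrable_varMeasure_iff {H T : ℝ} (hH0 : 0 < H) (hH1 : H < 1) {g : ℝ → ℂ} :
    Integrable g (varMeasure H T) ↔
      IntegrableOn (fun u => (varDens H u : ℂ) * g u) (Set.Ioc 0 T) := by
  rw [varMeasure_eq_withDensity, integrable_withDensity_iff_integrable_smul'
    (measurable_varDens H).ennreal_ofReal (Filter.Eventually.of_forall fun _ => ENNReal.ofReal_lt_top)]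
  refine integrable_congr ((ae_restrict_iff' measurableSet_Ioc).2
    (Filter.Eventually.of_forall fun u hu => ?_))
  simp only
  rw [ENNReal.toReal_ofReal (varDens_nonneg hH0 hH1 hu.1.le), Complex.real_smul]

theorem integral_varMeasure {H T : ℝ} (hH0 : 0 < H) (hH1 : H < 1) (g : ℝ → ℂ) :
    ∫ u, g u ∂(varMeasure H T) = ∫ u in Set.Ioc 0 T, (varDens H u : ℂ) * g u := by
  rw [varMeasure_eq_withDensity, integral_withDensity_eq_integral_toReal_smul
    (measurable_varDens H).ennreal_ofReal (Filter.Eventually.of_forall fun _ => ENNReal.ofReal_lt_top)]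
  refine setIntegral_congr_fun measurableSet_Ioc fun u hu => ?_
  rw [ENNReal.toReal_ofReal (varDens_nonneg hH0 hH1 hu.1.le), Complex.real_smul]

theorem isFiniteMeasure_varMeasure {H T : ℝ} (hH0 : 0 < H) (hH1 : H < 1) (hT : 0 ≤ T) :
    IsFiniteMeasure (varMeasure H T) := by
  refine ⟨?_⟩
  have h : varMeasure H T Set.univ = varMeasure H T (Set.Icc 0 T) := by
    rw [varMeasure, Measure.restrict_apply MeasurableSet.univ,
      Measure.restrict_apply measurableSet_Icc, Set.univ_inter, Set.inter_self]
  rw [h, varMeasure_Icc hH0 hH1 hT le_rfl]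
  exact ENNReal.ofReal_lt_top

/-- The integral in the definition of the moving average kernel. -/
def maTail (H t u : ℝ) : ℝ :=
  ∫ v in u..t, (v - u) ^ (H - 1 / 2) * v ^ (H - 3 / 2)

theorem maKernel_of_mem {H t u : ℝ} (hu : u ∈ Set.Ioo 0 t) :
    maKernel H t u =
      2 * H * (t ^ (H - 1 / 2) * (t - u) ^ (H - 1 / 2) - (H - 1 / 2) * maTail H t u) := by
  rw [maKernel, Set.indicator_of_mem hu, maTail, ← intervalIntegral.integral_const_mul]
  congr 2
  refine intervalIntegral.integral_congr fun v _ => ?_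
  ring

/-- Since 3/2 - H = (1 - H)² + (1/2 + H - H²), the factor v^{H-3/2} can be shared between u and v -
u. The power of v - u that results is H² - 1, which is integrable at v = u. The square of the bound
against u^{1-2H} has exponent -1 + 2H(1 - H) > -1, which is what square integrability of x_t needs
for every H in (0, 1). -/
theorem norm_maTail_le {H t u : ℝ} (hH0 : 0 < H) (hH1 : H < 1) (hu : u ∈ Set.Ioc 0 t) :
    ‖maTail H t u‖ ≤ t ^ (H ^ 2) / H ^ 2 * u ^ (-(1 - H) ^ 2) := by
  have hH2 : 0 < H ^ 2 := by positivity
  have h0 : IntervalIntegrable (fun v : ℝ => (v - u) ^ (H ^ 2 - 1)) volume u t := by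
    have := (intervalIntegral.intervalIntegrable_rpow' (a := 0) (b := t - u)
      (show -1 < H ^ 2 - 1 by linarith)).comp_sub_right u
    simpa using this
  refine (intervalIntegral.norm_integral_le_of_norm_le hu.2
    (g := fun v => u ^ (-(1 - H) ^ 2) * (v - u) ^ (H ^ 2 - 1))
    (Filter.Eventually.of_forall fun v hv => ?_) (h0.const_mul _)).trans ?_
  · have hvu : 0 < v - u := sub_pos.2 hv.1
    have hv0 : 0 < v := hu.1.trans hv.1
    have e1 : v ^ (H - 3 / 2) = v ^ (-(1 - H) ^ 2) * v ^ (-(1 / 2 + H - H ^ 2)) := by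
      rw [← Real.rpow_add hv0]; congr 1; ring
    have e2 : (v - u) ^ (H ^ 2 - 1) =
        (v - u) ^ (H - 1 / 2) * (v - u) ^ (-(1 / 2 + H - H ^ 2)) := by
      rw [← Real.rpow_add hvu]; congr 1; ring
    have h1 : v ^ (-(1 - H) ^ 2) ≤ u ^ (-(1 - H) ^ 2) :=
      Real.rpow_le_rpow_of_nonpos hu.1 hv.1.le (by nlinarith)
    have h2 : v ^ (-(1 / 2 + H - H ^ 2)) ≤ (v - u) ^ (-(1 / 2 + H - H ^ 2)) :=
      Real.rpow_le_rpow_of_nonpos hvu (by linarith [hu.1]) (by nlinarith)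
    rw [Real.norm_of_nonneg (by positivity), e1, e2]
    have := Real.rpow_pos_of_pos hu.1 (-(1 - H) ^ 2)
    calc _ = (v ^ (-(1 - H) ^ 2) * ((v - u) ^ (H - 1 / 2) * v ^ (-(1 / 2 + H - H ^ 2)))) := by ring
      _ ≤ _ := by gcongr
  · have hI : ∫ v in u..t, (v - u) ^ (H ^ 2 - 1) = (t - u) ^ (H ^ 2) / H ^ 2 := by
      rw [intervalIntegral.integral_comp_sub_right (fun v => v ^ (H ^ 2 - 1)), sub_self,
        integral_rpow (Or.inl (by linarith)), sub_add_cancel, Real.zero_rpow hH2.ne', sub_zero]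
    rw [intervalIntegral.integral_const_mul, hI, mul_comm]
    have := Real.rpow_pos_of_pos hu.1 (-(1 - H) ^ 2)
    have : 0 ≤ t - u := sub_nonneg.2 hu.2
    have := hu.1
    gcongr
    linarith

/-- Fubini for the double integral that defines the moments of `maTail`. -/
theorem integral_rpow_mul_maTail {H t : ℝ} (hH0 : 0 < H) (hH1 : H < 1) (ht : 0 < t) (k : ℕ) :
    IntegrableOn (fun u => u ^ (k + (1 - 2 * H)) * maTail H t u) (Set.Ioc 0 t) ∧
    ∫ u in Set.Ioc 0 t, u ^ (k + (1 - 2 * H)) * maTail H t u =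
      t ^ (k + 1) / (k + 1) * (Real.Gamma (k + (2 - 2 * H)) * Real.Gamma (H + 1 / 2) /
        Real.Gamma (k + (3 / 2 - H) + 1)) := by
  have hk : (0 : ℝ) ≤ k := k.cast_nonneg
  set β := Real.Gamma (k + (2 - 2 * H)) * Real.Gamma (H + 1 / 2) /
        Real.Gamma (k + (3 / 2 - H) + 1) with hβ
  set G : ℝ × ℝ → ℝ := fun p => if p.1 < p.2 then
    p.1 ^ (k + (1 - 2 * H)) * ((p.2 - p.1) ^ (H - 1 / 2) * p.2 ^ (H - 3 / 2)) else 0 with hG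
  have hGm : Measurable G := Measurable.ite (measurableSet_lt measurable_fst measurable_snd)
    (by fun_prop) measurable_const
  have hGnn : ∀ u ∈ Set.Ioc 0 t, ∀ v, 0 ≤ G (u, v) := by
    intro u hu v
    simp only [hG]
    split_ifs with h
    · have := hu.1
      have : 0 < v := by linarith
      have : 0 < v - u := by linarith
      positivity
    · exact le_rfl
  -- For fixed v the integral over u < v is a Beta integral, and all non-integer powers of v cancel,
  -- leaving v^k.
  have sec : ∀ v ∈ Set.Ioc 0 t, IntegrableOn (fun u => G (u, v)) (Set.Ioc 0 t) ∧
      ∫ u in Set.Ioc 0 t, G (u, v) = v ^ k * β := by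
    intro v hv
    have e : (fun u => G (u, v)) = (Set.Iio v).indicator (fun u =>
        v ^ (H - 3 / 2) * (u ^ ((k + (2 - 2 * H)) - 1) * (v - u) ^ ((H + 1 / 2) - 1))) := by
      ext u
      simp only [hG, Set.indicator, Set.mem_Iio]
      split_ifs
      · rw [show (k : ℝ) + (2 - 2 * H) - 1 = k + (1 - 2 * H) by ring,
          show H + 1 / 2 - 1 = H - 1 / 2 by ring]
        ring
      · rfl
    have es : Set.Ioc 0 t ∩ Set.Iio v = Set.Ioo 0 v := by
      ext x; simp only [Set.mem_inter_iff, Set.mem_Ioc, Set.mem_Iio, Set.mem_Ioo]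
      constructor
      · rintro ⟨⟨a, b⟩, c⟩; exact ⟨a, c⟩
      · rintro ⟨a, c⟩; exact ⟨⟨a, by linarith [hv.2]⟩, c⟩
    have hI := intervalIntegrable_rpow_mul_sub_rpow (p := k + (2 - 2 * H)) (q := H + 1 / 2)
      (by linarith) (by linarith) hv.1.le
    constructor
    · rw [e, IntegrableOn, integrable_indicator_iff measurableSet_Iio, IntegrableOn,
        Measure.restrict_restrict measurableSet_Iio, Set.inter_comm, es]
      exact ((intervalIntegrable_iff_integrableOn_Ioo_of_le hv.1.le).1 hI).const_mul _
    · rw [e, setIntegral_indicator measurableSet_Iio, es, ← integral_Ioc_eq_integral_Ioo,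
        ← intervalIntegral.integral_of_le hv.1.le, intervalIntegral.integral_const_mul,
        integral_rpow_mul_sub_rpow (by linarith) (by linarith) hv.1, ← mul_assoc,
        ← Real.rpow_add hv.1, hβ, show (k : ℝ) + (2 - 2 * H) + (H + 1 / 2) =
          k + (3 / 2 - H) + 1 by ring, ← Real.rpow_natCast]
      congr 2
      ring
  have hGi : Integrable G ((volume.restrict (Set.Ioc 0 t)).prod (volume.restrict (Set.Ioc 0 t))) := by
    rw [integrable_prod_iff' hGm.aestronglyMeasurable]
    constructor
    · exact (ae_restrict_iff' measurableSet_Ioc).2 (Filter.Eventually.of_forall fun v hv =>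
        (sec v hv).1)
    · have : Integrable (fun v : ℝ => v ^ k * β) (volume.restrict (Set.Ioc 0 t)) :=
        ((by fun_prop : Continuous fun v : ℝ => v ^ k * β).integrableOn_Icc).mono_set
          Set.Ioc_subset_Icc_self
      refine this.congr ((ae_restrict_iff' measurableSet_Ioc).2
        (Filter.Eventually.of_forall fun v hv => ?_))
      change v ^ k * β = _
      rw [← (sec v hv).2]
      exact setIntegral_congr_fun measurableSet_Ioc fun u hu =>
        (Real.norm_of_nonneg (hGnn u hu v)).symm
  have inner : ∀ u ∈ Set.Ioc 0 t, ∫ v in Set.Ioc 0 t, G (u, v) =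
      u ^ (k + (1 - 2 * H)) * maTail H t u := by
    intro u hu
    have e : (fun v => G (u, v)) = (Set.Ioi u).indicator (fun v =>
        u ^ (k + (1 - 2 * H)) * ((v - u) ^ (H - 1 / 2) * v ^ (H - 3 / 2))) := by
      ext v
      simp only [hG, Set.indicator, Set.mem_Ioi]
    have es : Set.Ioc 0 t ∩ Set.Ioi u = Set.Ioc u t := by
      ext x; simp only [Set.mem_inter_iff, Set.mem_Ioc, Set.mem_Ioi]
      constructor
      · rintro ⟨⟨a, b⟩, c⟩; exact ⟨c, b⟩
      · rintro ⟨a, c⟩; exact ⟨⟨by linarith [hu.1], c⟩, a⟩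
    rw [e, setIntegral_indicator measurableSet_Ioi, es, maTail,
      intervalIntegral.integral_of_le hu.2, integral_const_mul]
  constructor
  · exact hGi.integral_prod_left.congr ((ae_restrict_iff' measurableSet_Ioc).2
      (Filter.Eventually.of_forall inner))
  · rw [← setIntegral_congr_fun measurableSet_Ioc inner, integral_integral_swap hGi,
      setIntegral_congr_fun measurableSet_Ioc fun v hv => (sec v hv).2, integral_mul_const,
      ← intervalIntegral.integral_of_le ht.le, integral_pow]
    simp

/-- Fubini already provides measurability of u^{1-2H} times the tail (k = 0); the power is divided
out. -/
theorem aestronglyMeasurable_maTail {H t : ℝ} (hH0 : 0 < H) (hH1 : H < 1) (ht : 0 < t) :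
    AEStronglyMeasurable (maTail H t) (volume.restrict (Set.Ioc 0 t)) := by
  have h := (integral_rpow_mul_maTail hH0 hH1 ht 0).1.aestronglyMeasurable
  have h2 : AEStronglyMeasurable (fun u : ℝ => u ^ (-((0 : ℕ) + (1 - 2 * H))))
      (volume.restrict (Set.Ioc 0 t)) :=
    (by fun_prop : Measurable fun u : ℝ => u ^ (-((0 : ℕ) + (1 - 2 * H)))).aestronglyMeasurable
  refine (h2.mul h).congr ((ae_restrict_iff' measurableSet_Ioc).2
    (Filter.Eventually.of_forall fun u hu => ?_))
  simp only [Pi.mul_apply]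
  rw [← mul_assoc, ← Real.rpow_add hu.1, neg_add_cancel, Real.rpow_zero, one_mul]

/-- The two terms of x_t contribute with the factor 1 - (H - 1/2)/(k + 1) = (k + 3/2 - H)/(k + 1).
Its numerator lowers Γ(k + 5/2 - H) to the Gamma factor of the Kummer coefficient, after which
everything cancels. -/
theorem Gamma_moment_identity {H : ℝ} (hH0 : 0 < H) (hH1 : H < 1) (k : ℕ) :
    kummerCoeff H k * (dSq H * (2 - 2 * H) * (2 * H) *
      ((Real.Gamma (k + (2 - 2 * H)) * Real.Gamma (H + 1 / 2) /
        Real.Gamma (k + (3 / 2 - H) + 1)) * (1 - (H - 1 / 2) / (k + 1)))) = 1 / (k + 1) := by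
  have hk : (0 : ℝ) ≤ k := k.cast_nonneg
  have h1 : 0 < (k : ℝ) + (3 / 2 - H) := by linarith
  have ha : 0 < 2 - 2 * H := by linarith
  have g1 := (Real.Gamma_pos_of_pos h1).ne'
  have g2 := (Real.Gamma_pos_of_pos (show 0 < 3 / 2 - H by linarith)).ne'
  have g3 := (Real.Gamma_pos_of_pos ha).ne'
  have g4 := (Real.Gamma_pos_of_pos (show 0 < H + 1 / 2 by linarith)).ne'
  have g5 := (Real.Gamma_pos_of_pos (show 0 < k + (2 - 2 * H) by linarith)).ne'
  have hk1 : (k : ℝ) + 1 ≠ 0 := by linarith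
  have e : 1 - (H - 1 / 2) / ((k : ℝ) + 1) = (k + (3 / 2 - H)) / (k + 1) := by
    field_simp
    ring
  rw [e, Real.Gamma_add_one h1.ne', kummerCoeff, dSq, show 3 - 2 * H = (2 - 2 * H) + 1 by ring,
    Real.Gamma_add_one ha.ne']
  have h1 := h1.ne'
  have ha := ha.ne'
  have := hH0.ne'
  generalize Real.Gamma (k + (2 - 2 * H)) = x1 at *
  generalize Real.Gamma (3 / 2 - H) = x2 at *
  generalize Real.Gamma (2 - 2 * H) = x3 at *
  generalize Real.Gamma (H + 1 / 2) = x4 at *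
  generalize Real.Gamma (k + (3 / 2 - H)) = x5 at *
  generalize (k : ℝ) + (3 / 2 - H) = y at *
  generalize (2 - 2 * H) = a at *
  field_simp

/-- The value t^{k+1}/(k+1) is the k-th moment of Lebesgue measure on (0, t). Pairing x_t dV with
the Kummer series therefore has the same effect as pairing dv with the exponential series. -/
theorem maKernel_moments {H t : ℝ} (hH0 : 0 < H) (hH1 : H < 1) (ht : 0 < t) (k : ℕ) :
    IntegrableOn (fun u => varDens H u * maKernel H t u * u ^ k) (Set.Ioc 0 t) ∧
    kummerCoeff H k * ∫ u in Set.Ioc 0 t, varDens H u * maKernel H t u * u ^ k =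
      t ^ (k + 1) / (k + 1) := by
  have hk : (0 : ℝ) ≤ k := k.cast_nonneg
  obtain ⟨i1, e1⟩ := integral_rpow_mul_maTail hH0 hH1 ht k
  have hp : 0 < (k : ℝ) + (2 - 2 * H) := by linarith
  have hq : 0 < H + 1 / 2 := by linarith
  have i2 := (intervalIntegrable_iff_integrableOn_Ioc_of_le ht.le).1
    (intervalIntegrable_rpow_mul_sub_rpow hp hq ht.le)
  have e2 := integral_rpow_mul_sub_rpow hp hq ht
  rw [intervalIntegral.integral_of_le ht.le] at e2
  have hc : ∀ᵐ u ∂(volume.restrict (Set.Ioc 0 t)), dSq H * (2 - 2 * H) * (2 * H) *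
      (t ^ (H - 1 / 2) * (u ^ ((k : ℝ) + (2 - 2 * H) - 1) * (t - u) ^ (H + 1 / 2 - 1)) -
        (H - 1 / 2) * (u ^ (k + (1 - 2 * H)) * maTail H t u)) =
      varDens H u * maKernel H t u * u ^ k := by
    rw [Measure.restrict_congr_set Ioo_ae_eq_Ioc.symm]
    refine (ae_restrict_iff' measurableSet_Ioo).2 (Filter.Eventually.of_forall fun u hu => ?_)
    rw [maKernel_of_mem hu, varDens, show (k : ℝ) + (2 - 2 * H) - 1 = k + (1 - 2 * H) by ring,
      show H + 1 / 2 - 1 = H - 1 / 2 by ring, Real.rpow_add hu.1, Real.rpow_natCast]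
    ring
  have i3 := ((i2.const_mul (t ^ (H - 1 / 2))).sub (i1.const_mul (H - 1 / 2))).const_mul
    (dSq H * (2 - 2 * H) * (2 * H))
  refine ⟨Integrable.congr i3 hc, ?_⟩
  rw [← integral_congr_ae hc, integral_const_mul, integral_sub (i2.const_mul _) (i1.const_mul _),
    integral_const_mul, integral_const_mul, e1, e2, ← mul_assoc (t ^ (H - 1 / 2)),
    ← Real.rpow_add ht, show H - 1 / 2 + ((k : ℝ) + (2 - 2 * H) + (H + 1 / 2) - 1) =
      ((k + 1 : ℕ) : ℝ) by push_cast; ring, Real.rpow_natCast,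
    show (k : ℝ) + (2 - 2 * H) + (H + 1 / 2) = k + (3 / 2 - H) + 1 by ring]
  have h := Gamma_moment_identity hH0 hH1 k
  linear_combination t ^ (k + 1) * h

/-- By the moments, the Taylor coefficients in λ are those of ∫_0^t e^{iλv} dv. This is what later
forces U x_t = e_t, without any direct computation of inner products of the x_t. -/
theorem integral_maKernel_mul_phi {H t : ℝ} (hH0 : 0 < H) (hH1 : H < 1) (ht : 0 ≤ t) (l : ℝ) :
    ∫ u in (0 : ℝ)..t, ((varDens H u * maKernel H t u : ℝ) : ℂ) * phi H (u * l) = expFun t l := by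
  rcases ht.eq_or_lt with rfl | ht
  · simp [expFun]
  obtain ⟨R, hR, hc⟩ := exists_kummerCoeff_le_pow hH1
  have hi : IntervalIntegrable (fun u => varDens H u * maKernel H t u) volume 0 t := by
    refine (intervalIntegrable_iff_integrableOn_Ioc_of_le ht.le).2 ?_
    simpa using (maKernel_moments hH0 hH1 ht 0).1
  have h1 := hasSum_integral_mul_series
    (fun k => (abs_of_nonneg (kummerCoeff_nonneg hH1 k)).trans_le (hc k)) hR.le
    (hasSum_phi hH1) ht.le (intervalIntegrable_ofReal hi) l
  refine h1.unique ?_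
  have e : ∀ k : ℕ, (kummerCoeff H k : ℂ) * ((Complex.I * l) ^ k / k.factorial) *
      ∫ u in (0 : ℝ)..t, ((varDens H u * maKernel H t u : ℝ) : ℂ) * (u : ℂ) ^ k =
      (Complex.I * l) ^ k * t ^ (k + 1) / (k + 1).factorial := by
    intro k
    have h := (maKernel_moments hH0 hH1 ht k).2
    rw [← intervalIntegral.integral_of_le ht.le] at h
    have h' : ∫ u in (0 : ℝ)..t, ((varDens H u * maKernel H t u : ℝ) : ℂ) * (u : ℂ) ^ k =
        ((∫ u in (0 : ℝ)..t, varDens H u * maKernel H t u * u ^ k : ℝ) : ℂ) := by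
      rw [← intervalIntegral.integral_ofReal]
      refine intervalIntegral.integral_congr fun u _ => ?_
      push_cast
      ring
    rw [h', mul_right_comm, ← Complex.ofReal_mul, h, Nat.factorial_succ]
    have hf : (k.factorial : ℂ) ≠ 0 := by exact_mod_cast k.factorial_ne_zero
    have hk' : (k : ℂ) + 1 ≠ 0 := by exact_mod_cast k.succ_ne_zero
    push_cast
    field_simp
  suffices HasSum (fun k : ℕ => (Complex.I * (l : ℂ)) ^ k * (t : ℂ) ^ (k + 1) / (k + 1).factorial)
    (expFun t l) from this.congr_fun e
  rw [expFun]
  split_ifs with hl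
  · subst hl
    convert hasSum_single (f := fun k : ℕ =>
      (Complex.I * ((0 : ℝ) : ℂ)) ^ k * (t : ℂ) ^ (k + 1) / (k + 1).factorial) 0
      (fun k hk => by simp [hk]) using 1
    simp
  · have hl' : Complex.I * (l : ℂ) ≠ 0 := by simp [hl]
    have h := (hasSum_nat_add_iff' 1).2 (hasSum_exp_I_mul (l * t))
    simp only [Finset.range_one, Finset.sum_singleton, pow_zero, Nat.factorial_zero, Nat.cast_one,
      Complex.ofReal_one, one_mul, div_one] at h
    have h2 := h.div_const (Complex.I * l)
    rw [show Complex.I * ((l * t : ℝ) : ℂ) = Complex.I * l * t by push_cast; ring] at h2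
    refine h2.congr_fun fun k => ?_
    generalize Complex.I * (l : ℂ) = w at hl'
    rw [div_right_comm, mul_pow, eq_comm, pow_succ w, mul_right_comm,
      mul_div_cancel_right₀ _ hl']

theorem memLp_maKernel {H t T : ℝ} (hH0 : 0 < H) (hH1 : H < 1) (ht : 0 ≤ t) (htT : t ≤ T) :
    MemLp (fun u => (maKernel H t u : ℂ)) 2 (varMeasure H T) := by
  rcases ht.eq_or_lt with rfl | ht
  · simp [maKernel]
  have key : ∀ {f : ℝ → ℝ}, AEStronglyMeasurable f (volume.restrict (Set.Ioc 0 t)) →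
      IntegrableOn (fun u => u ^ (1 - 2 * H) * f u ^ 2) (Set.Ioc 0 t) →
      MemLp (fun u => (((Set.Ioc 0 t).indicator f u : ℝ) : ℂ)) 2 (varMeasure H T) := by
    intro f hf hi
    have hm : AEStronglyMeasurable (fun u => (((Set.Ioc 0 t).indicator f u : ℝ) : ℂ))
        (varMeasure H T) := by
      refine Complex.continuous_ofReal.comp_aestronglyMeasurable ?_
      rw [aestronglyMeasurable_indicator_iff measurableSet_Ioc]
      refine hf.mono_ac ?_
      rw [varMeasure_eq_withDensity]
      exact ((withDensity_absolutelyContinuous _ _).trans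
        Measure.restrict_le_self.absolutelyContinuous).restrict _
    rw [memLp_two_iff_integrable_sq_norm hm, ← integrable_norm_iff (by fun_prop)]
    have : Integrable (fun u => ((‖(((Set.Ioc 0 t).indicator f u : ℝ) : ℂ)‖ ^ 2 : ℝ) : ℂ))
        (varMeasure H T) := by
      rw [integrable_varMeasure_iff hH0 hH1]
      have h1 : Integrable (fun u => (((Set.Ioc 0 t).indicator (fun u => dSq H * (2 - 2 * H) *
          (u ^ (1 - 2 * H) * f u ^ 2)) u : ℝ) : ℂ)) :=
        ((integrable_indicator_iff measurableSet_Ioc).2 (hi.const_mul _)).ofReal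
      refine h1.integrableOn.congr (Filter.Eventually.of_forall fun u => ?_)
      by_cases hu : u ∈ Set.Ioc 0 t
      · simp only [Set.indicator_of_mem hu, Complex.norm_real, varDens, Real.norm_eq_abs, sq_abs]
        push_cast
        ring
      · simp [Set.indicator_of_notMem hu]
    exact (this.re.congr (Filter.Eventually.of_forall fun u => by simp [-Complex.ofReal_pow])).norm
  have m1 : AEStronglyMeasurable (fun u : ℝ => (t - u) ^ (H - 1 / 2))
      (volume.restrict (Set.Ioc 0 t)) :=
    (by fun_prop : Measurable fun u : ℝ => (t - u) ^ (H - 1 / 2)).aestronglyMeasurable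
  have m2 := aestronglyMeasurable_maTail hH0 hH1 ht
  have i1 : IntegrableOn (fun u : ℝ => u ^ (1 - 2 * H) * ((t - u) ^ (H - 1 / 2)) ^ 2)
      (Set.Ioc 0 t) := by
    have := (intervalIntegrable_iff_integrableOn_Ioc_of_le ht.le).1
      (intervalIntegrable_rpow_mul_sub_rpow (p := 2 - 2 * H) (q := 2 * H) (by linarith)
        (by linarith) ht.le)
    refine this.congr_fun (fun u hu => ?_) measurableSet_Ioc
    simp only
    rw [← Real.rpow_natCast, ← Real.rpow_mul (by linarith [hu.2])]
    congr 2
    · ring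
    · push_cast; ring
  have i2 : IntegrableOn (fun u : ℝ => u ^ (1 - 2 * H) * (maTail H t u) ^ 2) (Set.Ioc 0 t) := by
    have h : IntegrableOn (fun u : ℝ => (t ^ (H ^ 2) / H ^ 2) ^ 2 *
        u ^ (1 - 2 * H - 2 * (1 - H) ^ 2)) (Set.Ioc 0 t) :=
      ((intervalIntegrable_iff_integrableOn_Ioc_of_le ht.le).1
        (intervalIntegral.intervalIntegrable_rpow' (by nlinarith))).const_mul _
    refine Integrable.mono' h ?_ ((ae_restrict_iff' measurableSet_Ioc).2
      (Filter.Eventually.of_forall fun u hu => ?_))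
    · exact (by fun_prop : Measurable fun u : ℝ => u ^ (1 - 2 * H)).aestronglyMeasurable.mul
        (m2.pow 2)
    · have hb := norm_maTail_le hH0 hH1 hu
      have hp := Real.rpow_nonneg hu.1.le (1 - 2 * H)
      rw [norm_mul, norm_pow, Real.norm_of_nonneg hp]
      refine (mul_le_mul_of_nonneg_left (pow_le_pow_left₀ (norm_nonneg _) hb 2) hp).trans_eq ?_
      rw [mul_pow, ← Real.rpow_natCast (u ^ _), ← Real.rpow_mul hu.1.le, mul_left_comm,
        ← Real.rpow_add hu.1]
      congr 2
      push_cast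
      ring
  refine (((key m1 i1).const_mul ((2 * H * t ^ (H - 1 / 2) : ℝ) : ℂ)).sub
    ((key m2 i2).const_mul ((2 * H * (H - 1 / 2) : ℝ) : ℂ))).ae_eq ?_
  -- The kernel is cut off to the open interval, the two summands to the half-open one; they may
  -- differ at u = t only.
  have hae : ∀ᵐ u ∂(varMeasure H T), u ≠ t := by
    rw [varMeasure_eq_withDensity]
    refine (withDensity_absolutelyContinuous _ _).ae_le (ae_restrict_of_ae ?_)
    exact Measure.ae_ne volume t
  filter_upwards [hae] with u hut
  by_cases hu : u ∈ Set.Ioc 0 t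
  · simp only [Pi.sub_apply, Set.indicator_of_mem hu]
    rw [maKernel_of_mem ⟨hu.1, lt_of_le_of_ne hu.2 hut⟩]
    push_cast
    ring
  · have : u ∉ Set.Ioo 0 t := fun h => hu ⟨h.1, h.2.le⟩
    simp [Set.indicator_of_notMem hu, maKernel, Set.indicator_of_notMem this]

/-! ### The Laplace transform of λ^{1-2H} m_t -/

theorem integrableOn_rpow_mul_exp_neg {s x : ℝ} (hs : -1 < s) (hx : 0 < x) :
    IntegrableOn (fun l : ℝ => l ^ s * Real.exp (-x * l)) (Set.Ioi 0) := by
  simpa using integrableOn_rpow_mul_exp_neg_mul_rpow hs one_pos hx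

theorem norm_exp_neg_mul_ofReal (z : ℂ) (l : ℝ) :
    ‖Complex.exp (-z * l)‖ = Real.exp (-z.re * l) := by
  rw [Complex.norm_exp]; simp

theorem integrableOn_rpow_mul_cexp_neg {s : ℝ} {z : ℂ} (hs : -1 < s) (hz : 0 < z.re) :
    IntegrableOn (fun l : ℝ => ((l ^ s : ℝ) : ℂ) * Complex.exp (-z * l)) (Set.Ioi 0) := by
  refine Integrable.mono' (integrableOn_rpow_mul_exp_neg hs hz)
    (by fun_prop : Measurable fun l : ℝ => ((l ^ s : ℝ) : ℂ) * Complex.exp (-z * l)).aestronglyMeasurable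
    ((ae_restrict_iff' measurableSet_Ioi).2 (Filter.Eventually.of_forall fun l hl => ?_))
  rw [norm_mul, norm_exp_neg_mul_ofReal, Complex.norm_real,
    Real.norm_of_nonneg (Real.rpow_nonneg (le_of_lt hl) _)]

/-- The Laplace transform of a power, at a complex point. -/
theorem integral_rpow_mul_cexp_neg {a : ℝ} (ha : 0 < a) {z : ℂ} (hz : 0 < z.re) :
    ∫ l in Set.Ioi (0 : ℝ), ((l ^ (a - 1) : ℝ) : ℂ) * Complex.exp (-z * l) =
      Real.Gamma a * z ^ ((-a : ℝ) : ℂ) := by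
  set S : Set ℂ := {z | 0 < z.re}
  have hS : IsOpen S := isOpen_lt continuous_const Complex.continuous_re
  have hSc : IsPreconnected S := (convex_halfSpace_re_gt 0).isPreconnected
  have hF : DifferentiableOn ℂ (fun z : ℂ => ∫ l in Set.Ioi (0 : ℝ),
      ((l ^ (a - 1) : ℝ) : ℂ) * Complex.exp (-z * l)) S := by
    intro z hz
    have hz : 0 < z.re := hz
    refine (hasDerivAt_integral_of_dominated_loc_of_deriv_le
      (F' := fun (z : ℂ) (l : ℝ) => ((l ^ (a - 1) : ℝ) : ℂ) * (Complex.exp (-z * l) * (-l)))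
      (bound := fun l : ℝ => l ^ a * Real.exp (-(z.re / 2) * l))
      (Metric.ball_mem_nhds z (half_pos hz)) ?_ ?_ ?_ ?_ ?_ ?_).2.differentiableAt.differentiableWithinAt
    · exact Filter.Eventually.of_forall fun w => (by fun_prop : Measurable fun l : ℝ =>
        ((l ^ (a - 1) : ℝ) : ℂ) * Complex.exp (-w * l)).aestronglyMeasurable
    · exact integrableOn_rpow_mul_cexp_neg (by linarith) hz
    · exact (by fun_prop : Measurable fun l : ℝ =>
        ((l ^ (a - 1) : ℝ) : ℂ) * (Complex.exp (-z * l) * (-l))).aestronglyMeasurable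
    · refine (ae_restrict_iff' measurableSet_Ioi).2 (Filter.Eventually.of_forall fun l hl w hw => ?_)
      have hl : 0 < l := hl
      have hw' : z.re / 2 ≤ w.re := by
        have h1 := (Complex.abs_re_le_norm (w - z)).trans_lt (mem_ball_iff_norm.1 hw)
        rw [Complex.sub_re, abs_lt] at h1
        linarith
      rw [norm_mul, norm_mul, norm_exp_neg_mul_ofReal, norm_neg, Complex.norm_real,
        Complex.norm_real, Real.norm_of_nonneg hl.le, Real.norm_of_nonneg (by positivity),
        mul_left_comm, mul_comm, ← Real.rpow_add_one hl.ne', sub_add_cancel]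
      have : 0 < l ^ a := Real.rpow_pos_of_pos hl a
      gcongr
    · exact integrableOn_rpow_mul_exp_neg (by linarith) (half_pos hz)
    · refine Filter.Eventually.of_forall fun l w _ => ?_
      have h1 : HasDerivAt (fun w : ℂ => -w * l) (-1 * l) w := (hasDerivAt_id w).neg.mul_const _
      have h2 := (h1.cexp).const_mul ((l ^ (a - 1) : ℝ) : ℂ)
      simpa using h2
  have hG : DifferentiableOn ℂ (fun z : ℂ => (Real.Gamma a : ℂ) * z ^ ((-a : ℝ) : ℂ)) S := by
    intro z hz
    exact ((differentiableAt_id.cpow_const (Or.inl hz)).const_mul _).differentiableWithinAt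
  have hreal : ∀ x : ℝ, 0 < x → ∫ l in Set.Ioi (0 : ℝ), ((l ^ (a - 1) : ℝ) : ℂ) *
      Complex.exp (-(x : ℂ) * l) = Real.Gamma a * (x : ℂ) ^ ((-a : ℝ) : ℂ) := by
    intro x hx
    have h := Real.integral_rpow_mul_exp_neg_mul_Ioi ha hx
    rw [← Complex.ofReal_cpow hx.le, ← Complex.ofReal_mul, Real.rpow_neg hx.le, mul_comm,
      ← Real.inv_rpow hx.le, ← one_div, ← h, ← integral_complex_ofReal]
    refine setIntegral_congr_fun measurableSet_Ioi fun l _ => ?_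
    push_cast
    rw [neg_mul]
  -- Both sides are analytic on the right half plane and agree on the positive reals, which
  -- accumulate at 1.
  refine (hF.analyticOnNhd hS).eqOn_of_preconnected_of_frequently_eq (hG.analyticOnNhd hS) hSc
    (z₀ := 1) (by simp [S]) ?_ hz
  have ht : Filter.Tendsto (fun n : ℕ => (((1 + 1 / ((n : ℝ) + 1) : ℝ)) : ℂ)) Filter.atTop
      (nhdsWithin 1 {1}ᶜ) := by
    refine tendsto_nhdsWithin_iff.2 ⟨?_, Filter.Eventually.of_forall fun n => ?_⟩
    · have := (tendsto_one_div_add_atTop_nhds_zero_nat (𝕜 := ℝ)).const_add 1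
      have := (Complex.continuous_ofReal.tendsto _).comp this
      simpa [Function.comp_def] using this
    · have : (1 + 1 / ((n : ℝ) + 1) : ℝ) ≠ 1 := by
        have : 0 < 1 / ((n : ℝ) + 1) := by positivity
        linarith
      exact fun h => this (Complex.ofReal_injective (by simpa using h))
  exact ht.frequently (Filter.Eventually.of_forall fun n => hreal _ (by positivity)).frequently

theorem weight_nonneg {H : ℝ} (hH0 : 0 < H) (hH1 : H < 1) {t r : ℝ} (hr : r ∈ Set.Icc 0 t) :
    0 ≤ weight H t r := by
  have g1 := Real.Gamma_pos_of_pos (show 0 < H + 1 / 2 by linarith)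
  have g2 := Real.Gamma_pos_of_pos (show 0 < 3 / 2 - H by linarith)
  have := hr.1
  have : 0 ≤ t - r := sub_nonneg.2 hr.2
  unfold weight
  positivity

theorem measurable_weight (H t : ℝ) : Measurable (weight H t) := by
  unfold weight; fun_prop

theorem norm_martFun_le {H : ℝ} (hH0 : 0 < H) (hH1 : H < 1) {t : ℝ} (ht : 0 ≤ t) (l : ℝ) :
    ‖martFun H t l‖ ≤ ∫ r in (0 : ℝ)..t, weight H t r := by
  refine intervalIntegral.norm_integral_le_of_norm_le ht (Filter.Eventually.of_forall
    fun r hr => ?_) (intervalIntegrable_weight hH1 ht)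
  rw [norm_mul, Complex.norm_exp_I_mul_ofReal, mul_one, Complex.norm_real,
    Real.norm_of_nonneg (weight_nonneg hH0 hH1 ⟨hr.1.le, hr.2⟩)]

theorem continuous_martFun {H : ℝ} (hH0 : 0 < H) (hH1 : H < 1) {t : ℝ} (ht : 0 ≤ t) :
    Continuous (martFun H t) := by
  refine intervalIntegral.continuous_of_dominated_interval (bound := weight H t)
    (fun l => ?_) (fun l => Filter.Eventually.of_forall fun r hr => ?_)
    (intervalIntegrable_weight hH1 ht) (Filter.Eventually.of_forall fun r _ => by fun_prop)
  · have := measurable_weight H t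
    exact (by fun_prop : Measurable fun r : ℝ => (weight H t r : ℂ) *
      Complex.exp (Complex.I * ((r * l : ℝ) : ℂ))).aestronglyMeasurable
  · rw [Set.uIoc_of_le ht] at hr
    rw [norm_mul, Complex.norm_exp_I_mul_ofReal, mul_one, Complex.norm_real,
      Real.norm_of_nonneg (weight_nonneg hH0 hH1 ⟨hr.1.le, hr.2⟩)]

theorem martFun_neg (H t l : ℝ) : martFun H t (-l) = starRingEnd ℂ (martFun H t l) := by
  simp only [martFun, intervalIntegral, map_sub, ← integral_conj]
  simp [← Complex.exp_conj]

/-- The integrand `ζ^{-b} (ζ - it)^{-b}`, `b = 3/2 - H`, of the Laplace transform of `martFun`. -/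
def laplaceKernel (H t : ℝ) (ζ : ℂ) : ℂ :=
  ζ ^ ((-(3 / 2 - H) : ℝ) : ℂ) * (ζ - Complex.I * t) ^ ((-(3 / 2 - H) : ℝ) : ℂ)

/-- The constant in the Laplace transform of `martFun`. -/
def laplaceConst (H t : ℝ) : ℝ :=
  (2 * H * Real.Gamma (H + 1 / 2) * Real.Gamma (3 / 2 - H))⁻¹ * t ^ (2 - 2 * H) *
    Real.Gamma (3 / 2 - H) ^ 2

/-- The substitution x = λr/t turns λ^{2-2H} m_t(λ) e^{-ζλ} into a constant times the convolution at
λ of x^{b-1} e^{-(ζ-it)x} and x^{b-1} e^{-ζx}, b = 3/2 - H. The integral of a convolution on the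
half line is the product of the integrals. -/
theorem integral_rpow_mul_martFun_mul_exp {H : ℝ} (hH1 : H < 1) {t : ℝ}
    (ht : 0 < t) {ζ : ℂ} (hζ : 0 < ζ.re) :
    ∫ l in Set.Ioi (0 : ℝ), ((l ^ (2 - 2 * H) : ℝ) : ℂ) * martFun H t l * Complex.exp (-ζ * l) =
      laplaceConst H t * laplaceKernel H t ζ := by
  have hb : 0 < 3 / 2 - H := by linarith
  have hζ' : 0 < (ζ - Complex.I * t).re := by simpa using hζ
  have h := integral_posConvolution (μ := volume) (ν := volume)
    (integrableOn_rpow_mul_cexp_neg (s := 3 / 2 - H - 1) (by linarith) hζ')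
    (integrableOn_rpow_mul_cexp_neg (s := 3 / 2 - H - 1) (by linarith) hζ)
    (ContinuousLinearMap.mul ℝ ℂ)
  rw [integral_rpow_mul_cexp_neg hb hζ', integral_rpow_mul_cexp_neg hb hζ] at h
  simp only [ContinuousLinearMap.mul_apply'] at h
  set c := (2 * H * Real.Gamma (H + 1 / 2) * Real.Gamma (3 / 2 - H))⁻¹ with hc
  have e : laplaceConst H t * laplaceKernel H t ζ = ((c * t ^ (2 - 2 * H) : ℝ) : ℂ) *
      ((Real.Gamma (3 / 2 - H) * (ζ - Complex.I * t) ^ ((-(3 / 2 - H) : ℝ) : ℂ)) *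
      (Real.Gamma (3 / 2 - H) * ζ ^ ((-(3 / 2 - H) : ℝ) : ℂ))) := by
    rw [laplaceConst, laplaceKernel, ← hc]
    push_cast
    ring
  rw [e, ← h, ← integral_const_mul]
  refine setIntegral_congr_fun measurableSet_Ioi fun l hl => ?_
  have hl : 0 < l := hl
  have hlt : 0 < l / t := div_pos hl ht
  have hs := intervalIntegral.integral_comp_mul_left (a := 0) (b := t) (c := l / t)
    (fun x : ℝ => ((x ^ (3 / 2 - H - 1) : ℝ) : ℂ) * Complex.exp (-(ζ - Complex.I * t) * x) *
      ((((l - x) ^ (3 / 2 - H - 1) : ℝ) : ℂ) * Complex.exp (-ζ * (l - x : ℝ)))) hlt.ne'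
  rw [mul_zero, div_mul_cancel₀ _ ht.ne', eq_inv_smul_iff₀ hlt.ne'] at hs
  rw [← hs, martFun, ← intervalIntegral.integral_smul, ← intervalIntegral.integral_const_mul,
    ← intervalIntegral.integral_const_mul, ← intervalIntegral.integral_mul_const]
  refine intervalIntegral.integral_congr_ae (Filter.Eventually.of_forall fun r hr => ?_)
  rw [Set.uIoc_of_le ht.le] at hr
  have htr : 0 ≤ t - r := sub_nonneg.2 hr.2
  have e1 : (l / t * r) ^ (3 / 2 - H - 1) = (l / t) ^ (3 / 2 - H - 1) * r ^ (3 / 2 - H - 1) :=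
    Real.mul_rpow hlt.le hr.1.le
  have e2 : (l - l / t * r) ^ (3 / 2 - H - 1) =
      (l / t) ^ (3 / 2 - H - 1) * (t - r) ^ (3 / 2 - H - 1) := by
    rw [← Real.mul_rpow hlt.le htr]
    congr 1
    field_simp
  have e3 : l ^ (2 - 2 * H) =
      t ^ (2 - 2 * H) * (l / t * ((l / t) ^ (3 / 2 - H - 1) * (l / t) ^ (3 / 2 - H - 1))) := by
    rw [← Real.rpow_add hlt, mul_comm (l / t), ← Real.rpow_add_one hlt.ne',
      show 3 / 2 - H - 1 + (3 / 2 - H - 1) + 1 = 2 - 2 * H by ring,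
      ← Real.mul_rpow ht.le hlt.le, mul_div_cancel₀ _ ht.ne']
  have e4 : Complex.exp (Complex.I * ((r * l : ℝ) : ℂ)) * Complex.exp (-ζ * l) =
      Complex.exp (-(ζ - Complex.I * t) * ((l / t * r : ℝ) : ℂ)) *
        Complex.exp (-ζ * ((l - l / t * r : ℝ) : ℂ)) := by
    rw [← Complex.exp_add, ← Complex.exp_add]
    congr 1
    have : (t : ℂ) ≠ 0 := by exact_mod_cast ht.ne'
    push_cast
    field_simp
    ring
  rw [e1, e2, e3, weight, ← hc, Complex.real_smul]
  push_cast at e4 ⊢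
  linear_combination (c : ℂ) * ((t ^ (2 - 2 * H) : ℝ) : ℂ) * (l / t) *
    (((l / t) ^ (3 / 2 - H - 1) : ℝ) : ℂ) ^ 2 * ((r ^ (3 / 2 - H - 1) : ℝ) : ℂ) *
    (((t - r) ^ (3 / 2 - H - 1) : ℝ) : ℂ) * e4

theorem integral_cexp_neg_mul_Ioi {l : ℝ} (hl : 0 < l) (z : ℂ) :
    IntegrableOn (fun x : ℝ => Complex.exp (-(z + x) * l)) (Set.Ioi 0) ∧
    ∫ x in Set.Ioi (0 : ℝ), Complex.exp (-(z + x) * l) = Complex.exp (-z * l) / l := by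
  have hre : (-(l : ℂ)).re < 0 := by simpa using hl
  have h1 := integrableOn_exp_mul_complex_Ioi hre 0
  have h2 := integral_exp_mul_complex_Ioi hre 0
  have e : ∀ x : ℝ, Complex.exp (-(z + x) * l) =
      Complex.exp (-z * l) * Complex.exp (-(l : ℂ) * x) := by
    intro x
    rw [← Complex.exp_add]; congr 1; ring
  simp_rw [e]
  refine ⟨h1.const_mul _, ?_⟩
  rw [integral_const_mul, h2]
  simp [div_eq_mul_inv]

/-- Writing 1/λ = ∫_0^∞ e^{-xλ} dx lowers the power λ^{2-2H}, for which the transform is a product,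
to the power λ^{1-2H} of the spectral density. -/
theorem laplace_martFun {H : ℝ} (hH0 : 0 < H) (hH1 : H < 1) {t : ℝ} (ht : 0 < t) {z : ℂ}
    (hz : 0 < z.re) :
    ∫ l in Set.Ioi (0 : ℝ), ((l ^ (1 - 2 * H) : ℝ) : ℂ) * martFun H t l * Complex.exp (-z * l) =
      laplaceConst H t * ∫ x in Set.Ioi (0 : ℝ), laplaceKernel H t (z + x) := by
  set M := ∫ r in (0 : ℝ)..t, weight H t r
  have hM := norm_martFun_le hH0 hH1 ht.le
  have hm := (continuous_martFun hH0 hH1 ht.le).measurable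
  have hG : Integrable (fun p : ℝ × ℝ => ((p.1 ^ (2 - 2 * H) : ℝ) : ℂ) * martFun H t p.1 *
      Complex.exp (-(z + p.2) * p.1))
      ((volume.restrict (Set.Ioi 0)).prod (volume.restrict (Set.Ioi 0))) := by
    have hGm : Measurable (fun p : ℝ × ℝ => ((p.1 ^ (2 - 2 * H) : ℝ) : ℂ) * martFun H t p.1 *
      Complex.exp (-(z + p.2) * p.1)) := by fun_prop
    rw [integrable_prod_iff hGm.aestronglyMeasurable]
    constructor
    · exact (ae_restrict_iff' measurableSet_Ioi).2 (Filter.Eventually.of_forall fun l hl =>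
        (integral_cexp_neg_mul_Ioi hl z).1.const_mul (((l ^ (2 - 2 * H) : ℝ) : ℂ) * martFun H t l))
    · refine ((integrableOn_rpow_mul_exp_neg (s := 1 - 2 * H) (by linarith) hz).const_mul M).mono'
        hGm.norm.stronglyMeasurable.integral_prod_right'.aestronglyMeasurable ?_
      refine (ae_restrict_iff' measurableSet_Ioi).2 (Filter.Eventually.of_forall fun l hl => ?_)
      have hl : 0 < l := hl
      have hI : ∫ x in Set.Ioi (0 : ℝ), ‖Complex.exp (-(z + x) * l)‖ =
          Real.exp (-z.re * l) / l := by
        have h := congrArg Complex.re (integral_cexp_neg_mul_Ioi hl (z.re : ℂ)).2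
        have e : ∀ x : ℝ, Complex.exp (-(z.re + x) * l) = ((‖Complex.exp (-(z + x) * l)‖ : ℝ) : ℂ) := by
          intro x
          rw [norm_exp_neg_mul_ofReal]
          push_cast
          simp
        simp_rw [e] at h
        rw [integral_complex_ofReal] at h
        rw [← Complex.ofReal_re (∫ x in Set.Ioi (0 : ℝ), ‖Complex.exp (-(z + x) * l)‖), h]
        rw [← Complex.ofReal_re (Real.exp (-z.re * l) / l)]
        push_cast
        rfl
      simp only [norm_mul]
      rw [integral_const_mul, hI, Complex.norm_real, Real.norm_of_nonneg (by positivity),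
        Real.norm_of_nonneg (by positivity)]
      have e : l ^ (2 - 2 * H) = l ^ (1 - 2 * H) * l := by
        rw [← Real.rpow_add_one hl.ne']; congr 1; ring
      rw [e]
      have : l ^ (1 - 2 * H) * l * ‖martFun H t l‖ * (Real.exp (-z.re * l) / l) =
        ‖martFun H t l‖ * (l ^ (1 - 2 * H) * Real.exp (-z.re * l)) := by field_simp
      rw [this]
      gcongr
      exact hM l
  have h := integral_integral_swap (f := fun l x : ℝ => ((l ^ (2 - 2 * H) : ℝ) : ℂ) *
    martFun H t l * Complex.exp (-(z + x) * l)) hG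
  rw [← integral_const_mul]
  have e1 : ∀ x ∈ Set.Ioi (0 : ℝ), ∫ l in Set.Ioi (0 : ℝ), ((l ^ (2 - 2 * H) : ℝ) : ℂ) *
      martFun H t l * Complex.exp (-(z + x) * l) = laplaceConst H t * laplaceKernel H t (z + x) := by
    intro x hx
    refine integral_rpow_mul_martFun_mul_exp hH1 ht ?_
    have : (0 : ℝ) < x := hx
    simp only [Complex.add_re, Complex.ofReal_re]
    linarith
  rw [← setIntegral_congr_fun measurableSet_Ioi e1, ← h]
  refine setIntegral_congr_fun measurableSet_Ioi fun l hl => ?_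
  have hl : 0 < l := hl
  rw [integral_const_mul, (integral_cexp_neg_mul_Ioi hl z).2]
  have e : l ^ (2 - 2 * H) = l ^ (1 - 2 * H) * l := by
    rw [← Real.rpow_add_one hl.ne']; congr 1; ring
  have hl' : (l : ℂ) ≠ 0 := by exact_mod_cast hl.ne'
  rw [e]
  push_cast
  field_simp

/-! ### Boundary values of the Laplace transform on the imaginary segment -/

theorem norm_laplaceKernel (H t : ℝ) (ζ : ℂ) :
    ‖laplaceKernel H t ζ‖ =
      ‖ζ‖ ^ (-(3 / 2 - H)) * ‖ζ - Complex.I * t‖ ^ (-(3 / 2 - H)) := by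
  rw [laplaceKernel, norm_mul, Complex.norm_cpow_real, Complex.norm_cpow_real]

theorem measurable_laplaceKernel (H t : ℝ) : Measurable (laplaceKernel H t) := by
  unfold laplaceKernel; fun_prop

/-- A majorant of the Laplace kernel on a half line `ir + (0, ∞)`, `0 < r < t`. -/
def kernelBound (H t r x : ℝ) : ℝ :=
  if x ≤ 1 then x ^ (-(1 / 2) : ℝ) * (r ^ (-(5 / 4 - H)) * (t - r) ^ (-(5 / 4 - H)))
  else x ^ (-(3 - 2 * H))

theorem norm_laplaceKernel_le {H t r x ε : ℝ} (hH1 : H < 1) (hr : r ∈ Set.Ioo 0 t) (hx : 0 < x)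
    (hε : 0 ≤ ε) : ‖laplaceKernel H t (ε + Complex.I * r + x)‖ ≤ kernelBound H t r x := by
  have htr : 0 < t - r := sub_pos.2 hr.2
  have h1 : x ≤ ‖(ε + Complex.I * r + x : ℂ)‖ := by
    refine le_trans ?_ ((le_abs_self _).trans (Complex.abs_re_le_norm _))
    simp [hε]
  have h2 : r ≤ ‖(ε + Complex.I * r + x : ℂ)‖ := by
    refine le_trans ?_ ((le_abs_self _).trans (Complex.abs_im_le_norm _))
    simp
  have h3 : x ≤ ‖(ε + Complex.I * r + x - Complex.I * t : ℂ)‖ := by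
    refine le_trans ?_ ((le_abs_self _).trans (Complex.abs_re_le_norm _))
    simp [hε]
  have h4 : t - r ≤ ‖(ε + Complex.I * r + x - Complex.I * t : ℂ)‖ := by
    refine le_trans ?_ ((neg_le_abs _).trans (Complex.abs_im_le_norm _))
    simp
  rw [norm_laplaceKernel, kernelBound]
  generalize ‖(ε + Complex.I * r + x : ℂ)‖ = m at *
  generalize ‖(ε + Complex.I * r + x - Complex.I * t : ℂ)‖ = n at *
  have hm : 0 < m := hx.trans_le h1
  have hn : 0 < n := hx.trans_le h3
  split_ifs
  · have key : ∀ {m r : ℝ}, 0 < r → x ≤ m → r ≤ m →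
        m ^ (-(3 / 2 - H)) ≤ x ^ (-(1 / 4) : ℝ) * r ^ (-(5 / 4 - H)) := by
      intro m r hr hxm hrm
      rw [show -(3 / 2 - H) = -(1 / 4) + -(5 / 4 - H) by ring, Real.rpow_add (hr.trans_le hrm)]
      have a1 := Real.rpow_le_rpow_of_nonpos hx hxm (show (-(1 / 4) : ℝ) ≤ 0 by norm_num)
      have a2 := Real.rpow_le_rpow_of_nonpos hr hrm (show -(5 / 4 - H) ≤ 0 by linarith)
      have a3 := Real.rpow_nonneg (hr.trans_le hrm).le (-(5 / 4 - H))
      have a4 := Real.rpow_nonneg hx.le (-(1 / 4))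
      exact mul_le_mul a1 a2 a3 a4
    refine (mul_le_mul (key hr.1 h1 h2) (key htr h3 h4) (by positivity) ?_).trans_eq ?_
    · have := hr.1
      positivity
    · rw [mul_mul_mul_comm, ← Real.rpow_add hx]
      norm_num
  · rw [show -(3 - 2 * H) = -(3 / 2 - H) + -(3 / 2 - H) by ring, Real.rpow_add hx]
    have a1 := Real.rpow_le_rpow_of_nonpos hx h1 (show -(3 / 2 - H) ≤ 0 by linarith)
    have a2 := Real.rpow_le_rpow_of_nonpos hx h3 (show -(3 / 2 - H) ≤ 0 by linarith)
    exact mul_le_mul a1 a2 (by positivity) (by positivity)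

theorem integral_kernelBound {H t r : ℝ} (hH1 : H < 1) :
    IntegrableOn (kernelBound H t r) (Set.Ioi 0) ∧
    ∫ x in Set.Ioi (0 : ℝ), kernelBound H t r x =
      2 * (r ^ (-(5 / 4 - H)) * (t - r) ^ (-(5 / 4 - H))) + 1 / (2 - 2 * H) := by
  have hu : Set.Ioi (0 : ℝ) = Set.Ioc 0 1 ∪ Set.Ioi 1 :=
    (Set.Ioc_union_Ioi_eq_Ioi zero_le_one).symm
  have hd : Disjoint (Set.Ioc (0 : ℝ) 1) (Set.Ioi 1) := Set.Ioc_disjoint_Ioi le_rfl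
  have c1 : Set.EqOn (fun x : ℝ => x ^ (-(1 / 2) : ℝ) * (r ^ (-(5 / 4 - H)) *
      (t - r) ^ (-(5 / 4 - H)))) (kernelBound H t r) (Set.Ioc 0 1) := fun x hx => by
    simp only [kernelBound, if_pos hx.2]
  have c2 : Set.EqOn (fun x : ℝ => x ^ (-(3 - 2 * H))) (kernelBound H t r) (Set.Ioi 1) :=
    fun x hx => by simp only [kernelBound, if_neg (not_le.2 (Set.mem_Ioi.1 hx))]
  have i1 : IntegrableOn (kernelBound H t r) (Set.Ioc 0 1) :=
    IntegrableOn.congr_fun (Integrable.mul_const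
      ((intervalIntegrable_iff_integrableOn_Ioc_of_le zero_le_one).1
        (intervalIntegral.intervalIntegrable_rpow' (by norm_num))) _) c1 measurableSet_Ioc
  have i2 : IntegrableOn (kernelBound H t r) (Set.Ioi 1) :=
    (integrableOn_Ioi_rpow_of_lt (by linarith) one_pos).congr_fun c2 measurableSet_Ioi
  refine ⟨by rw [hu]; exact i1.union i2, ?_⟩
  rw [hu, setIntegral_union hd measurableSet_Ioi i1 i2,
    ← setIntegral_congr_fun measurableSet_Ioc c1, ← setIntegral_congr_fun measurableSet_Ioi c2,
    integral_mul_const, ← intervalIntegral.integral_of_le zero_le_one,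
    integral_rpow (Or.inl (by norm_num)), integral_Ioi_rpow_of_lt (by linarith) one_pos]
  congr 1
  · norm_num
  · rw [Real.one_rpow, show -(3 - 2 * H) + 1 = -(2 - 2 * H) by ring, div_neg, neg_div, neg_neg]

theorem integrable_laplaceKernel {H t r ε : ℝ} (hH1 : H < 1) (hr : r ∈ Set.Ioo 0 t)
    (hε : 0 ≤ ε) :
    IntegrableOn (fun x : ℝ => laplaceKernel H t (ε + Complex.I * r + x)) (Set.Ioi 0) := by
  have hm := measurable_laplaceKernel H t
  exact (integral_kernelBound hH1).1.mono' (by fun_prop : Measurable fun x : ℝ =>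
    laplaceKernel H t (ε + Complex.I * r + x)).aestronglyMeasurable
    ((ae_restrict_iff' measurableSet_Ioi).2 (Eventually.of_forall fun x hx =>
      norm_laplaceKernel_le hH1 hr hx hε))

theorem norm_integral_laplaceKernel_le {H t r ε : ℝ} (hH1 : H < 1) (hr : r ∈ Set.Ioo 0 t)
    (hε : 0 ≤ ε) :
    ‖∫ x in Set.Ioi (0 : ℝ), laplaceKernel H t (ε + Complex.I * r + x)‖ ≤
      2 * (r ^ (-(5 / 4 - H)) * (t - r) ^ (-(5 / 4 - H))) + 1 / (2 - 2 * H) := by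
  rw [← (integral_kernelBound hH1).2]
  exact norm_integral_le_of_norm_le (integral_kernelBound hH1).1
    ((ae_restrict_iff' measurableSet_Ioi).2 (Eventually.of_forall fun x hx =>
      norm_laplaceKernel_le hH1 hr hx hε))

/-- The derivative of the Laplace kernel. -/
def laplaceKernelDeriv (H t : ℝ) (ζ : ℂ) : ℂ :=
  ((-(3 / 2 - H) : ℝ) : ℂ) * (ζ ^ ((-(3 / 2 - H) - 1 : ℝ) : ℂ) *
      (ζ - Complex.I * t) ^ ((-(3 / 2 - H) : ℝ) : ℂ) +
    ζ ^ ((-(3 / 2 - H) : ℝ) : ℂ) * (ζ - Complex.I * t) ^ ((-(3 / 2 - H) - 1 : ℝ) : ℂ))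

theorem hasDerivAt_laplaceKernel {H t : ℝ} {ζ : ℂ} (h1 : ζ ∈ Complex.slitPlane)
    (h2 : ζ - Complex.I * t ∈ Complex.slitPlane) :
    HasDerivAt (laplaceKernel H t) (laplaceKernelDeriv H t ζ) ζ := by
  have d1 := (hasDerivAt_id ζ).cpow_const (c := ((-(3 / 2 - H) : ℝ) : ℂ)) h1
  have d2 := ((hasDerivAt_id ζ).sub_const (Complex.I * t)).cpow_const
    (c := ((-(3 / 2 - H) : ℝ) : ℂ)) h2
  have d := d1.mul d2
  refine HasDerivAt.congr_deriv d ?_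
  simp only [laplaceKernelDeriv, id]
  push_cast
  ring

theorem mem_slitPlane_of_mem_Ioo {t r x : ℝ} (hr : r ∈ Set.Ioo 0 t) :
    (Complex.I * r + x : ℂ) ∈ Complex.slitPlane ∧
      (Complex.I * r + x - Complex.I * t : ℂ) ∈ Complex.slitPlane := by
  constructor
  · right; simpa using hr.1.ne'
  · right
    have := hr.2
    simp
    linarith

theorem tendsto_integral_laplaceKernel {H t r : ℝ} (hH1 : H < 1) (hr : r ∈ Set.Ioo 0 t) :
    Tendsto (fun ε : ℝ => ∫ x in Set.Ioi (0 : ℝ), laplaceKernel H t (ε + Complex.I * r + x))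
      (𝓝[>] 0) (𝓝 (∫ x in Set.Ioi (0 : ℝ), laplaceKernel H t (Complex.I * r + x))) := by
  have hm := measurable_laplaceKernel H t
  refine tendsto_integral_filter_of_dominated_convergence (kernelBound H t r)
    (Eventually.of_forall fun ε => (by fun_prop : Measurable fun x : ℝ =>
      laplaceKernel H t (ε + Complex.I * r + x)).aestronglyMeasurable) ?_
    (integral_kernelBound hH1).1 (Eventually.of_forall fun x => ?_)
  · filter_upwards [self_mem_nhdsWithin] with ε hε
    exact (ae_restrict_iff' measurableSet_Ioi).2 (Eventually.of_forall fun x hx =>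
      norm_laplaceKernel_le hH1 hr hx (le_of_lt hε))
  · have h := mem_slitPlane_of_mem_Ioo (x := x) hr
    have hc := (hasDerivAt_laplaceKernel (H := H) h.1 h.2).continuousAt
    have hl : Tendsto (fun ε : ℝ => (ε + Complex.I * r + x : ℂ)) (𝓝[>] 0)
        (𝓝 (Complex.I * r + x)) := by
      have : Continuous fun ε : ℝ => (ε + Complex.I * r + x : ℂ) := by fun_prop
      have h0 := (this.tendsto 0).mono_left (nhdsWithin_le_nhds (s := Set.Ioi 0))
      simpa using h0
    exact hc.tendsto.comp hl

/-- Both branch points 0 and it stay at distance at least max(x, δ) ≥ (x + δ)/2 from ir + x. The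
bound is integrable in x and uniform for r at distance δ from the endpoints, as differentiation
under the integral requires. -/
theorem norm_laplaceKernelDeriv_le {H t r x δ : ℝ} (hH1 : H < 1) (hx : 0 < x) (hδ : 0 < δ)
    (hr : δ ≤ r) (hrt : δ ≤ t - r) :
    ‖laplaceKernelDeriv H t (Complex.I * r + x)‖ ≤
      (2 * (3 / 2 - H)) * ((x + δ) / 2) ^ (-(4 - 2 * H)) := by
  have h1 : (x + δ) / 2 ≤ ‖(Complex.I * r + x : ℂ)‖ := by
    have a := (le_abs_self _).trans (Complex.abs_re_le_norm (Complex.I * r + x : ℂ))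
    have b := (le_abs_self _).trans (Complex.abs_im_le_norm (Complex.I * r + x : ℂ))
    simp at a b
    linarith
  have h2 : (x + δ) / 2 ≤ ‖(Complex.I * r + x - Complex.I * t : ℂ)‖ := by
    have a := (le_abs_self _).trans (Complex.abs_re_le_norm (Complex.I * r + x - Complex.I * t : ℂ))
    have b := (neg_le_abs _).trans (Complex.abs_im_le_norm (Complex.I * r + x - Complex.I * t : ℂ))
    simp at a b
    linarith
  have hp : 0 < (x + δ) / 2 := by positivity
  have hb : 0 < 3 / 2 - H := by linarith
  rw [laplaceKernelDeriv, norm_mul, Complex.norm_real, Real.norm_eq_abs, abs_neg, abs_of_pos hb]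
  have e : (2 * (3 / 2 - H)) * ((x + δ) / 2) ^ (-(4 - 2 * H)) = (3 / 2 - H) *
      (((x + δ) / 2) ^ (-(3 / 2 - H) - 1) * ((x + δ) / 2) ^ (-(3 / 2 - H)) +
        ((x + δ) / 2) ^ (-(3 / 2 - H)) * ((x + δ) / 2) ^ (-(3 / 2 - H) - 1)) := by
    rw [← Real.rpow_add hp, ← Real.rpow_add hp,
      show -(3 / 2 - H) - 1 + -(3 / 2 - H) = -(4 - 2 * H) by ring,
      show -(3 / 2 - H) + (-(3 / 2 - H) - 1) = -(4 - 2 * H) by ring]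
    ring
  rw [e]
  refine mul_le_mul_of_nonneg_left ((norm_add_le _ _).trans ?_) hb.le
  rw [norm_mul, norm_mul, Complex.norm_cpow_real, Complex.norm_cpow_real, Complex.norm_cpow_real,
    Complex.norm_cpow_real]
  have a1 := Real.rpow_le_rpow_of_nonpos hp h1 (show -(3 / 2 - H) ≤ 0 by linarith)
  have a2 := Real.rpow_le_rpow_of_nonpos hp h2 (show -(3 / 2 - H) ≤ 0 by linarith)
  have a3 := Real.rpow_le_rpow_of_nonpos hp h1 (show -(3 / 2 - H) - 1 ≤ 0 by linarith)
  have a4 := Real.rpow_le_rpow_of_nonpos hp h2 (show -(3 / 2 - H) - 1 ≤ 0 by linarith)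
  gcongr

theorem integrableOn_kernelDeriv_bound {H δ : ℝ} (hH1 : H < 1) (hδ : 0 < δ) :
    IntegrableOn (fun x : ℝ => (2 * (3 / 2 - H)) * ((x + δ) / 2) ^ (-(4 - 2 * H)))
      (Set.Ioi 0) := by
  have h := integrableOn_add_rpow_Ioi_of_lt (a := -(4 - 2 * H)) (c := 0) (m := δ)
    (by linarith) (by linarith)
  refine IntegrableOn.congr_fun
    ((h.div_const (2 ^ (-(4 - 2 * H)))).const_mul (2 * (3 / 2 - H)))
    (fun x hx => ?_) measurableSet_Ioi
  have : (0 : ℝ) < x := hx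
  rw [Real.div_rpow (by linarith) (by norm_num)]

/-- Between the branch points, ir and ir - it have arguments π/2 and -π/2. Both are raised to the
same real power, so the phases cancel. -/
theorem laplaceKernel_I_mul_im {H t r : ℝ} (hr : r ∈ Set.Ioo 0 t) :
    (laplaceKernel H t (Complex.I * r)).im = 0 := by
  have htr : 0 < t - r := sub_pos.2 hr.2
  have e1 : Complex.I * (r : ℂ) = (r : ℂ) * Complex.I := mul_comm _ _
  have e2 : Complex.I * (r : ℂ) - Complex.I * t = ((t - r : ℝ) : ℂ) * (-Complex.I) := by
    push_cast; ring
  have n1 : (r : ℂ) * Complex.I ≠ 0 := mul_ne_zero (by exact_mod_cast hr.1.ne') Complex.I_ne_zero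
  have n2 : ((t - r : ℝ) : ℂ) * (-Complex.I) ≠ 0 :=
    mul_ne_zero (by exact_mod_cast htr.ne') (neg_ne_zero.2 Complex.I_ne_zero)
  rw [laplaceKernel, e2, e1, Complex.cpow_def_of_ne_zero n1, Complex.cpow_def_of_ne_zero n2,
    Complex.log_ofReal_mul hr.1 Complex.I_ne_zero,
    Complex.log_ofReal_mul htr (neg_ne_zero.2 Complex.I_ne_zero), Complex.log_I, Complex.log_neg_I,
    ← Complex.exp_add]
  have : ((Real.log r : ℂ) + Real.pi / 2 * Complex.I) * ((-(3 / 2 - H) : ℝ) : ℂ) +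
      ((Real.log (t - r) : ℂ) + -(Real.pi / 2) * Complex.I) * ((-(3 / 2 - H) : ℝ) : ℂ) =
      (((Real.log r + Real.log (t - r)) * (-(3 / 2 - H)) : ℝ) : ℂ) := by
    push_cast; ring
  rw [this, ← Complex.ofReal_exp, Complex.ofReal_im]

theorem integral_laplaceKernelDeriv {H t r : ℝ} (hH1 : H < 1) (hr : r ∈ Set.Ioo 0 t) :
    ∫ x in Set.Ioi (0 : ℝ), laplaceKernelDeriv H t (Complex.I * r + x) =
      -laplaceKernel H t (Complex.I * r) := by
  set δ := min r (t - r)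
  have hδ : 0 < δ := lt_min hr.1 (sub_pos.2 hr.2)
  have hm : Measurable (laplaceKernelDeriv H t) := by unfold laplaceKernelDeriv; fun_prop
  have hi : IntegrableOn (fun x : ℝ => laplaceKernelDeriv H t (Complex.I * r + x)) (Set.Ioi 0) :=
    (integrableOn_kernelDeriv_bound hH1 hδ).mono' (by fun_prop : Measurable fun x : ℝ =>
      laplaceKernelDeriv H t (Complex.I * r + x)).aestronglyMeasurable
      ((ae_restrict_iff' measurableSet_Ioi).2 (Eventually.of_forall fun x hx =>
        norm_laplaceKernelDeriv_le hH1 hx hδ (min_le_left _ _) (min_le_right _ _)))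
  have ht : Tendsto (fun x : ℝ => laplaceKernel H t (Complex.I * r + x)) atTop (𝓝 0) := by
    refine squeeze_zero_norm' (a := fun x : ℝ => x ^ (-(3 - 2 * H))) ?_
      (tendsto_rpow_neg_atTop (by linarith))
    filter_upwards [eventually_gt_atTop 1] with x hx
    have h := norm_laplaceKernel_le hH1 hr (show 0 < x by linarith) le_rfl
    rw [kernelBound, if_neg (not_le.2 hx)] at h
    simpa using h
  have h := integral_Ioi_of_hasDerivAt_of_tendsto' (a := 0)
    (f := fun x : ℝ => laplaceKernel H t (Complex.I * r + x))
    (fun x _ => ?_) hi ht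
  · rw [h]; simp
  · have hs := mem_slitPlane_of_mem_Ioo (x := x) hr
    exact ((hasDerivAt_laplaceKernel hs.1 hs.2).comp_const_add (Complex.I * r) (x : ℂ)).comp_ofReal

/-- Moving r translates the half line of integration, so the r-derivative is i times the integral of
the x-derivative of the kernel, which is minus its value at the endpoint ir. -/
theorem hasDerivAt_integral_laplaceKernel {H t r : ℝ} (hH1 : H < 1) (hr : r ∈ Set.Ioo 0 t) :
    HasDerivAt (fun r : ℝ => ∫ x in Set.Ioi (0 : ℝ), laplaceKernel H t (Complex.I * r + x))
      (-laplaceKernel H t (Complex.I * r) * Complex.I) r := by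
  have hm := measurable_laplaceKernel H t
  have hm' : Measurable (laplaceKernelDeriv H t) := by unfold laplaceKernelDeriv; fun_prop
  set δ := min r (t - r) / 2
  have hδ : 0 < δ := half_pos (lt_min hr.1 (sub_pos.2 hr.2))
  have hball : ∀ s ∈ Metric.ball r δ, δ ≤ s ∧ δ ≤ t - s := by
    intro s hs
    rw [Metric.mem_ball, Real.dist_eq, abs_lt] at hs
    have h1 : 2 * δ ≤ r := by simp only [δ]; linarith [min_le_left r (t - r)]
    have h2 : 2 * δ ≤ t - r := by simp only [δ]; linarith [min_le_right r (t - r)]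
    constructor <;> linarith
  have h := hasDerivAt_integral_of_dominated_loc_of_deriv_le
    (F := fun (r x : ℝ) => laplaceKernel H t (Complex.I * r + x))
    (F' := fun (r x : ℝ) => laplaceKernelDeriv H t (Complex.I * r + x) * Complex.I)
    (bound := fun x : ℝ => (2 * (3 / 2 - H)) * ((x + δ) / 2) ^ (-(4 - 2 * H)))
    (μ := volume.restrict (Set.Ioi 0))
    (Metric.ball_mem_nhds r hδ) ?_ ?_ ?_ ?_ ?_ ?_
  · refine h.2.congr_deriv ?_
    rw [integral_mul_const, integral_laplaceKernelDeriv hH1 hr]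
  · exact Eventually.of_forall fun s => (by fun_prop : Measurable fun x : ℝ =>
      laplaceKernel H t (Complex.I * s + x)).aestronglyMeasurable
  · simpa [IntegrableOn] using integrable_laplaceKernel hH1 hr le_rfl
  · exact (by fun_prop : Measurable fun x : ℝ =>
      laplaceKernelDeriv H t (Complex.I * r + x) * Complex.I).aestronglyMeasurable
  · refine (ae_restrict_iff' measurableSet_Ioi).2 (Eventually.of_forall fun x hx s hs => ?_)
    rw [norm_mul, Complex.norm_I, mul_one]
    exact norm_laplaceKernelDeriv_le hH1 hx hδ (hball s hs).1 (hball s hs).2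
  · exact integrableOn_kernelDeriv_bound hH1 hδ
  · refine Eventually.of_forall fun x s hs => ?_
    have hs' : s ∈ Set.Ioo 0 t :=
      ⟨hδ.trans_le (hball s hs).1, by linarith [(hball s hs).2]⟩
    have hp := mem_slitPlane_of_mem_Ioo (x := x) hs'
    have d := hasDerivAt_laplaceKernel (H := H) hp.1 hp.2
    have d2 : HasDerivAt (fun w : ℂ => Complex.I * w + x) Complex.I (s : ℂ) := by
      simpa using ((hasDerivAt_id (s : ℂ)).const_mul Complex.I).add_const (x : ℂ)
    exact (HasDerivAt.comp (s : ℂ) d d2).comp_ofReal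

/-- The derivative in r is -i times a real number, so the real part is constant on (0, t). This
constancy is why the increments of the fundamental martingale are uncorrelated. -/
theorem re_integral_laplaceKernel_eq {H t r : ℝ} (hH1 : H < 1) (hr : r ∈ Set.Ioo 0 t) :
    (∫ x in Set.Ioi (0 : ℝ), laplaceKernel H t (Complex.I * r + x)).re =
      (∫ x in Set.Ioi (0 : ℝ), laplaceKernel H t (Complex.I * (t / 2 : ℝ) + x)).re := by
  have hd : ∀ s ∈ Set.Ioo 0 t, HasDerivAt
      (fun r : ℝ => (∫ x in Set.Ioi (0 : ℝ), laplaceKernel H t (Complex.I * r + x)).re) 0 s := by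
    intro s hs
    have h := Complex.reCLM.hasFDerivAt.comp_hasDerivAt s (hasDerivAt_integral_laplaceKernel hH1 hs)
    refine HasDerivAt.congr_deriv h ?_
    simp [laplaceKernel_I_mul_im hs]
  have ht : 0 < t := hr.1.trans hr.2
  exact isOpen_Ioo.is_const_of_deriv_eq_zero isPreconnected_Ioo
    (fun s hs => (hd s hs).differentiableAt.differentiableWithinAt)
    (fun s hs => (hd s hs).deriv) hr ⟨by linarith, by linarith⟩

/-- With (x² + A)^{-b} Γ(b) = ∫ y^{b-1} e^{-(x²+A)y} dy and Fubini, the x-integral is Gaussian and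
the remaining y-integral is again a Gamma integral. -/
theorem integral_sq_add_rpow {b A : ℝ} (hb : 1 / 2 < b) (hA : 0 < A) :
    ∫ x in Set.Ioi (0 : ℝ), (x ^ 2 + A) ^ (-b) =
      A ^ (1 / 2 - b) * (Real.sqrt Real.pi * Real.Gamma (b - 1 / 2) / (2 * Real.Gamma b)) := by
  have hΓ := Real.Gamma_pos_of_pos (show 0 < b by linarith)
  have hy : ∀ x : ℝ, (x ^ 2 + A) ^ (-b) * Real.Gamma b =
      ∫ y in Set.Ioi (0 : ℝ), y ^ (b - 1) * Real.exp (-((x ^ 2 + A) * y)) := by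
    intro x
    have hp : 0 < x ^ 2 + A := by positivity
    rw [Real.integral_rpow_mul_exp_neg_mul_Ioi (by linarith) hp, one_div, Real.inv_rpow hp.le,
      Real.rpow_neg hp.le]
  have hx : ∀ y ∈ Set.Ioi (0 : ℝ),
      IntegrableOn (fun x : ℝ => y ^ (b - 1) * Real.exp (-((x ^ 2 + A) * y))) (Set.Ioi 0) ∧
      ∫ x in Set.Ioi (0 : ℝ), y ^ (b - 1) * Real.exp (-((x ^ 2 + A) * y)) =
        Real.sqrt Real.pi / 2 * (y ^ (b - 1 / 2 - 1) * Real.exp (-(A * y))) := by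
    intro y hy
    have hy : 0 < y := hy
    have e : ∀ x : ℝ, y ^ (b - 1) * Real.exp (-((x ^ 2 + A) * y)) =
        y ^ (b - 1) * Real.exp (-(A * y)) * Real.exp (-y * x ^ 2) := by
      intro x
      rw [mul_assoc, ← Real.exp_add]; congr 2; ring
    simp_rw [e]
    refine ⟨(integrable_exp_neg_mul_sq hy).integrableOn.const_mul _, ?_⟩
    rw [integral_const_mul, integral_gaussian_Ioi, Real.sqrt_div Real.pi_pos.le,
      show b - 1 = (b - 1 / 2 - 1) + 1 / 2 by ring, Real.rpow_add hy, ← Real.sqrt_eq_rpow]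
    have := (Real.sqrt_pos.2 hy).ne'
    field_simp
  have hi : Integrable (fun p : ℝ × ℝ => p.2 ^ (b - 1) * Real.exp (-((p.1 ^ 2 + A) * p.2)))
      ((volume.restrict (Set.Ioi 0)).prod (volume.restrict (Set.Ioi 0))) := by
    have hm : Measurable (fun p : ℝ × ℝ => p.2 ^ (b - 1) * Real.exp (-((p.1 ^ 2 + A) * p.2))) := by
      fun_prop
    rw [integrable_prod_iff' hm.aestronglyMeasurable]
    refine ⟨(ae_restrict_iff' measurableSet_Ioi).2 (Eventually.of_forall fun y hy => (hx y hy).1),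
      ?_⟩
    have h := (integrableOn_rpow_mul_exp_neg (s := b - 1 / 2 - 1) (by linarith) hA).const_mul
      (Real.sqrt Real.pi / 2)
    refine Integrable.congr h ((ae_restrict_iff' measurableSet_Ioi).2
      (Eventually.of_forall fun y hy => ?_))
    have e := (hx y hy).2
    have hy : 0 < y := hy
    simp only
    rw [neg_mul, ← e]
    refine integral_congr_ae (Eventually.of_forall fun x => ?_)
    simp only
    rw [Real.norm_of_nonneg (by positivity)]
  have h := integral_integral_swap
    (f := fun x y : ℝ => y ^ (b - 1) * Real.exp (-((x ^ 2 + A) * y))) hi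
  simp_rw [← hy] at h
  rw [setIntegral_congr_fun measurableSet_Ioi fun y hy => (hx y hy).2, integral_const_mul,
    integral_mul_const, Real.integral_rpow_mul_exp_neg_mul_Ioi (by linarith) hA, one_div,
    Real.inv_rpow hA.le, ← Real.rpow_neg hA.le, show -(b - 1 / 2) = 1 / 2 - b by ring] at h
  rw [← mul_left_inj' hΓ.ne', h]
  field_simp

/-- Above the midpoint of the segment, ζ - it is the conjugate of ζ, so the kernel is the positive
number |ζ|^{-(3-2H)}. -/
theorem integral_laplaceKernel_half {H t : ℝ} (hH1 : H < 1) (ht : 0 < t) :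
    (∫ x in Set.Ioi (0 : ℝ), laplaceKernel H t (Complex.I * (t / 2 : ℝ) + x)).re =
      (t ^ 2 / 4) ^ (1 / 2 - (3 / 2 - H)) * (Real.sqrt Real.pi * Real.Gamma (3 / 2 - H - 1 / 2) /
        (2 * Real.Gamma (3 / 2 - H))) := by
  rw [← integral_sq_add_rpow (by linarith) (by positivity)]
  have e : ∀ x ∈ Set.Ioi (0 : ℝ), laplaceKernel H t (Complex.I * (t / 2 : ℝ) + x) =
      (((x ^ 2 + t ^ 2 / 4) ^ (-(3 / 2 - H)) : ℝ) : ℂ) := by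
    intro x hx
    have hx : 0 < x := hx
    set z : ℂ := Complex.I * (t / 2 : ℝ) + x with hz
    have hzre : 0 < z.re := by simpa [hz] using hx
    have h2 : z - Complex.I * t = starRingEnd ℂ z := by
      simp only [hz, map_add, map_mul, Complex.conj_I, Complex.conj_ofReal]
      push_cast; ring
    have harg : z.arg ≠ Real.pi := by
      intro h
      rw [Complex.arg_eq_pi_iff] at h
      linarith [h.1]
    have hn : ‖z‖ ^ 2 = x ^ 2 + t ^ 2 / 4 := by
      rw [← Complex.normSq_eq_norm_sq, Complex.normSq_apply]
      simp [hz]; ring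
    have hnz : 0 < ‖z‖ := norm_pos_iff.2 fun h => by simp [h] at hzre
    rw [laplaceKernel, h2, Complex.conj_cpow _ _ harg, Complex.conj_ofReal, Complex.mul_conj,
      Complex.normSq_eq_norm_sq, Complex.norm_cpow_real, ← hn]
    congr 1
    rw [← Real.rpow_natCast, ← Real.rpow_natCast, ← Real.rpow_mul hnz.le, ← Real.rpow_mul hnz.le,
      mul_comm]
  rw [setIntegral_congr_fun measurableSet_Ioi e, integral_complex_ofReal, Complex.ofReal_re]

/-! ### The spectral measure and the Gram matrix of the functions m_t -/

/-- The constant in the spectral density. -/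
def specConst (H : ℝ) : ℝ :=
  (2 * Real.pi)⁻¹ * Real.sin (Real.pi * H) * Real.Gamma (1 + 2 * H)

/-- The spectral density. -/
def specDens (H l : ℝ) : ℝ := specConst H * |l| ^ (1 - 2 * H)

theorem specConst_pos {H : ℝ} (hH0 : 0 < H) (hH1 : H < 1) : 0 < specConst H := by
  have h1 := Real.Gamma_pos_of_pos (show (0 : ℝ) < 1 + 2 * H by linarith)
  have h2 : 0 < Real.sin (Real.pi * H) := Real.sin_pos_of_pos_of_lt_pi
    (mul_pos Real.pi_pos hH0) (by nlinarith [Real.pi_pos])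
  have := Real.pi_pos
  unfold specConst
  positivity

theorem specDens_nonneg {H : ℝ} (hH0 : 0 < H) (hH1 : H < 1) (l : ℝ) : 0 ≤ specDens H l :=
  mul_nonneg (specConst_pos hH0 hH1).le (Real.rpow_nonneg (abs_nonneg l) _)

theorem measurable_specDens (H : ℝ) : Measurable (specDens H) := by
  unfold specDens; fun_prop

theorem specMeasure_eq_withDensity (H : ℝ) :
    specMeasure H = volume.withDensity fun l => ENNReal.ofReal (specDens H l) := rfl

theorem integrable_specMeasure_iff {H : ℝ} (hH0 : 0 < H) (hH1 : H < 1) {g : ℝ → ℂ} :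
    Integrable g (specMeasure H) ↔ Integrable (fun l => (specDens H l : ℂ) * g l) := by
  rw [specMeasure_eq_withDensity, integrable_withDensity_iff_integrable_smul'
    (measurable_specDens H).ennreal_ofReal (Eventually.of_forall fun _ => ENNReal.ofReal_lt_top)]
  refine integrable_congr (Eventually.of_forall fun l => ?_)
  simp only
  rw [ENNReal.toReal_ofReal (specDens_nonneg hH0 hH1 l), Complex.real_smul]

theorem integral_specMeasure {H : ℝ} (hH0 : 0 < H) (hH1 : H < 1) (g : ℝ → ℂ) :
    ∫ l, g l ∂(specMeasure H) = ∫ l, (specDens H l : ℂ) * g l := by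
  rw [specMeasure_eq_withDensity, integral_withDensity_eq_integral_toReal_smul
    (measurable_specDens H).ennreal_ofReal (Eventually.of_forall fun _ => ENNReal.ofReal_lt_top)]
  refine integral_congr_ae (Eventually.of_forall fun l => ?_)
  simp only
  rw [ENNReal.toReal_ofReal (specDens_nonneg hH0 hH1 l), Complex.real_smul]

/-- A Hermitian function is determined by its values on the positive half line. -/
theorem integral_of_hermitian {f : ℝ → ℂ} (hf : ∀ x, f (-x) = starRingEnd ℂ (f x))
    (hi : IntegrableOn f (Set.Ioi 0)) :
    Integrable f ∧ ∫ x, f x = ((2 * (∫ x in Set.Ioi 0, f x).re : ℝ) : ℂ) := by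
  have hc : (fun x => f (-x)) = fun x => Complex.conjCLE (f x) := funext hf
  have h1 : IntegrableOn f (Set.Iic 0) := by
    rw [integrableOn_Iic_iff_integrableOn_Iio]
    have h := ((Measure.measurePreserving_neg (volume : Measure ℝ)).integrableOn_comp_preimage
      (Homeomorph.neg ℝ).measurableEmbedding (f := fun x => f (-x)) (s := Set.Ioi 0)).2 (by
        rw [hc]
        exact Complex.conjCLE.toContinuousLinearMap.integrable_comp hi)
    simpa [Function.comp_def] using h
  refine ⟨by rw [← integrableOn_univ, ← Set.Iic_union_Ioi (a := (0 : ℝ))]; exact h1.union hi, ?_⟩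
  rw [← intervalIntegral.integral_Iic_add_Ioi h1 hi, ← neg_zero, ← integral_comp_neg_Ioi, neg_zero]
  simp_rw [hf]
  rw [integral_conj, add_comm, Complex.add_conj]

/-- The powers of t cancel, and the duplication formula for Γ(H)Γ(H + 1/2) and the reflection
formula for Γ(H)Γ(1 - H) dispose of the rest. This is where the normalization of μ enters. -/
theorem gram_constant {H t : ℝ} (hH0 : 0 < H) (hH1 : H < 1) (ht : 0 < t) :
    2 * specConst H * laplaceConst H t * ((t ^ 2 / 4) ^ (1 / 2 - (3 / 2 - H)) *
      (Real.sqrt Real.pi * Real.Gamma (3 / 2 - H - 1 / 2) / (2 * Real.Gamma (3 / 2 - H)))) = 1 := by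
  have g1 := Real.Gamma_pos_of_pos (show 0 < H + 1 / 2 by linarith)
  have g2 := Real.Gamma_pos_of_pos (show 0 < 3 / 2 - H by linarith)
  have hd := Real.Gamma_mul_Gamma_add_half H
  have hr := Real.Gamma_mul_Gamma_one_sub H
  have hs : 0 < Real.sin (Real.pi * H) := Real.sin_pos_of_pos_of_lt_pi
    (mul_pos Real.pi_pos hH0) (by nlinarith [Real.pi_pos])
  have hπ := Real.pi_pos
  have ht2 : t ^ (2 - 2 * H) * (t ^ 2 / 4) ^ (1 / 2 - (3 / 2 - H)) = 2 * 2 ^ (1 - 2 * H) := by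
    rw [show t ^ 2 / 4 = (t / 2) ^ (2 : ℝ) by rw [Real.rpow_two]; ring, ← Real.rpow_mul (by positivity),
      Real.div_rpow ht.le (by norm_num), ← mul_div_assoc, ← Real.rpow_add ht,
      show 2 - 2 * H + 2 * (1 / 2 - (3 / 2 - H)) = 0 by ring, Real.rpow_zero, one_div,
      ← Real.rpow_neg (by norm_num), ← Real.rpow_one_add' (by norm_num) (by linarith)]
    congr 1
    ring
  have e1 : Real.Gamma (1 + 2 * H) = 2 * H * Real.Gamma (2 * H) := by
    rw [add_comm, Real.Gamma_add_one (by linarith)]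
  have e2 : 3 / 2 - H - 1 / 2 = 1 - H := by ring
  rw [laplaceConst, specConst, e1, e2]
  rw [eq_div_iff hs.ne'] at hr
  have hsp := Real.sqrt_pos.2 hπ
  have hspp := Real.mul_self_sqrt hπ.le
  generalize Real.Gamma (3 / 2 - H) = x1 at *
  generalize Real.Gamma (H + 1 / 2) = x2 at *
  generalize Real.Gamma (2 * H) = x3 at *
  generalize Real.Gamma (1 - H) = x4 at *
  generalize Real.Gamma H = x5 at *
  generalize Real.sin (Real.pi * H) = y at *
  generalize (2 : ℝ) ^ (1 - 2 * H) = p at *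
  generalize t ^ (2 - 2 * H) = q1 at *
  generalize (t ^ 2 / 4) ^ (1 / 2 - (3 / 2 - H)) = q2 at *
  generalize Real.sqrt Real.pi = w at *
  field_simp
  linear_combination (y * x3 * x4 * w) * ht2 + 2 * y * x4 * (-1) * hd + 2 * x2 * hr

/-- The part of the regularized Gram integral that comes from positive frequencies. -/
theorem integral_Ioi_martFun_mul_conj {H s t ε : ℝ} (hH0 : 0 < H) (hH1 : H < 1) (hs : 0 < s)
    (ht : 0 < t) (hε : 0 < ε) :
    ∫ l in Set.Ioi (0 : ℝ), ((l ^ (1 - 2 * H) : ℝ) : ℂ) *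
      (martFun H t l * starRingEnd ℂ (martFun H s l) * ((Real.exp (-ε * |l|) : ℝ) : ℂ)) =
    ∫ r in Set.Ioc 0 s, (weight H s r : ℂ) * (laplaceConst H t *
      ∫ x in Set.Ioi (0 : ℝ), laplaceKernel H t (ε + Complex.I * r + x)) := by
  have hm := (continuous_martFun hH0 hH1 ht.le).measurable
  have hw := measurable_weight H s
  have i1 : IntegrableOn (fun l : ℝ => ((l ^ (1 - 2 * H) : ℝ) : ℂ) * martFun H t l *
      Complex.exp (-(ε : ℂ) * l)) (Set.Ioi 0) := by
    have h := (integrableOn_rpow_mul_cexp_neg (s := 1 - 2 * H) (z := (ε : ℂ)) (by linarith)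
      (by simpa using hε)).bdd_mul (f := martFun H t) hm.aestronglyMeasurable
      (Eventually.of_forall (norm_martFun_le hH0 hH1 ht.le))
    refine h.congr (Eventually.of_forall fun l => ?_)
    simp only
    ring
  have i2 : IntegrableOn (fun r : ℝ => (weight H s r : ℂ)) (Set.Ioc 0 s) :=
    ((intervalIntegrable_iff_integrableOn_Ioc_of_le hs.le).1
      (intervalIntegrable_weight hH1 hs.le)).ofReal
  have hG : Integrable (fun p : ℝ × ℝ => ((p.1 ^ (1 - 2 * H) : ℝ) : ℂ) * martFun H t p.1 *
      Complex.exp (-(ε : ℂ) * p.1) * ((weight H s p.2 : ℂ) *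
        Complex.exp (Complex.I * ((p.2 * -p.1 : ℝ) : ℂ))))
      ((volume.restrict (Set.Ioi 0)).prod (volume.restrict (Set.Ioc 0 s))) := by
    refine (Integrable.mul_prod i1 i2).mono (by fun_prop : Measurable _).aestronglyMeasurable
      (Eventually.of_forall fun p => ?_)
    simp only [norm_mul, Complex.norm_exp_I_mul_ofReal, mul_one, le_refl]
  have h := integral_integral_swap (f := fun l r : ℝ => ((l ^ (1 - 2 * H) : ℝ) : ℂ) *
    martFun H t l * Complex.exp (-(ε : ℂ) * l) * ((weight H s r : ℂ) *
        Complex.exp (Complex.I * ((r * -l : ℝ) : ℂ)))) hG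
  refine Eq.trans ?_ (h.trans ?_)
  · refine setIntegral_congr_fun measurableSet_Ioi fun l hl => ?_
    have hl : 0 < l := hl
    rw [integral_const_mul, ← intervalIntegral.integral_of_le hs.le, ← martFun_neg, abs_of_pos hl,
      ← martFun]
    push_cast
    ring
  · refine setIntegral_congr_fun measurableSet_Ioc fun r hr => ?_
    have hz : 0 < (ε + Complex.I * r : ℂ).re := by simpa using hε
    rw [← laplace_martFun hH0 hH1 ht hz, ← integral_const_mul]
    refine integral_congr_ae (Eventually.of_forall fun l => ?_)
    simp only
    have : Complex.exp (-(ε + Complex.I * r : ℂ) * l) = Complex.exp (-(ε : ℂ) * l) *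
        Complex.exp (Complex.I * ((r * -l : ℝ) : ℂ)) := by
      rw [← Complex.exp_add]; congr 1; push_cast; ring
    rw [this]
    ring

/-- The regularized Gram integral. -/
def gramReg (H s t ε : ℝ) : ℂ :=
  ∫ l, martFun H t l * starRingEnd ℂ (martFun H s l) * ((Real.exp (-ε * |l|) : ℝ) : ℂ)
    ∂(specMeasure H)

/-- The damping makes the integral converge before m_t is known to be square integrable. Hermitian
symmetry of the integrand reduces the line to twice the real part over positive frequencies. -/
theorem integrable_gramReg {H s t ε : ℝ} (hH0 : 0 < H) (hH1 : H < 1) (hs : 0 < s)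
    (ht : 0 < t) (hε : 0 < ε) :
    Integrable (fun l => martFun H t l * starRingEnd ℂ (martFun H s l) *
      ((Real.exp (-ε * |l|) : ℝ) : ℂ)) (specMeasure H) ∧
    gramReg H s t ε = ((2 * specConst H * (∫ r in Set.Ioc 0 s, (weight H s r : ℂ) *
      (laplaceConst H t * ∫ x in Set.Ioi (0 : ℝ),
        laplaceKernel H t (ε + Complex.I * r + x))).re : ℝ) : ℂ) := by
  have hmt := continuous_martFun hH0 hH1 ht.le
  have hms := continuous_martFun hH0 hH1 hs.le
  have hi : IntegrableOn (fun l => (specDens H l : ℂ) * (martFun H t l *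
      starRingEnd ℂ (martFun H s l) * ((Real.exp (-ε * |l|) : ℝ) : ℂ))) (Set.Ioi 0) := by
    have h := ((integrableOn_rpow_mul_cexp_neg (s := 1 - 2 * H) (z := (ε : ℂ)) (by linarith)
      (by simpa using hε)).const_mul (specConst H : ℂ)).bdd_mul
      (f := fun l => martFun H t l * starRingEnd ℂ (martFun H s l))
      (c := (∫ r in (0 : ℝ)..t, weight H t r) * ∫ r in (0 : ℝ)..s, weight H s r)
      ((hmt.mul (Complex.continuous_conj.comp hms)).aestronglyMeasurable)
      (Eventually.of_forall fun l => by
        rw [norm_mul, RCLike.norm_conj]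
        exact mul_le_mul (norm_martFun_le hH0 hH1 ht.le l) (norm_martFun_le hH0 hH1 hs.le l)
          (norm_nonneg _) ((norm_nonneg _).trans (norm_martFun_le hH0 hH1 ht.le l)))
    refine h.congr ((ae_restrict_iff' measurableSet_Ioi).2 (Eventually.of_forall fun l hl => ?_))
    have hl : 0 < l := hl
    simp only [specDens, abs_of_pos hl]
    push_cast
    ring
  obtain ⟨h1, h2⟩ := integral_of_hermitian (fun l => by
    simp only [specDens, abs_neg, martFun_neg, map_mul, Complex.conj_ofReal, Complex.conj_conj]) hi
  refine ⟨(integrable_specMeasure_iff hH0 hH1).2 h1, ?_⟩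
  rw [gramReg, integral_specMeasure hH0 hH1, h2, ← integral_Ioi_martFun_mul_conj hH0 hH1 hs ht hε]
  have : ∫ l in Set.Ioi 0, (specDens H l : ℂ) * (martFun H t l *
      starRingEnd ℂ (martFun H s l) * ((Real.exp (-ε * |l|) : ℝ) : ℂ)) =
      (specConst H : ℂ) * ∫ l in Set.Ioi (0 : ℝ), ((l ^ (1 - 2 * H) : ℝ) : ℂ) *
      (martFun H t l * starRingEnd ℂ (martFun H s l) * ((Real.exp (-ε * |l|) : ℝ) : ℂ)) := by
    rw [← integral_const_mul]
    refine setIntegral_congr_fun measurableSet_Ioi fun l hl => ?_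
    have hl : 0 < l := hl
    simp only [specDens, abs_of_pos hl]
    push_cast
    ring
  rw [this, Complex.re_ofReal_mul, mul_assoc]

theorem laplaceConst_pos {H t : ℝ} (hH0 : 0 < H) (hH1 : H < 1) (ht : 0 < t) :
    0 < laplaceConst H t := by
  have g1 := Real.Gamma_pos_of_pos (show 0 < H + 1 / 2 by linarith)
  have g2 := Real.Gamma_pos_of_pos (show 0 < 3 / 2 - H by linarith)
  unfold laplaceConst
  positivity

/-- As ε → 0 the inner factor tends to its boundary value, whose real part is the same for all r in
(0, t). Since s ≤ t, this applies on the whole support of w_s, and `gram_constant` makes the factor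
equal to one. -/
theorem tendsto_gramReg {H s t : ℝ} (hH0 : 0 < H) (hH1 : H < 1) (hs : 0 < s) (hst : s ≤ t) :
    Tendsto (gramReg H s t) (𝓝[>] 0) (𝓝 ((∫ r in (0 : ℝ)..s, weight H s r : ℝ) : ℂ)) := by
  have ht : 0 < t := hs.trans_le hst
  have hC := laplaceConst_pos hH0 hH1 ht
  have hK := specConst_pos hH0 hH1
  have hm := measurable_laplaceKernel H t
  have hw := measurable_weight H s
  set c := (2 * H * Real.Gamma (H + 1 / 2) * Real.Gamma (3 / 2 - H))⁻¹ with hc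
  have hc0 : 0 < c := by
    have g1 := Real.Gamma_pos_of_pos (show 0 < H + 1 / 2 by linarith)
    have g2 := Real.Gamma_pos_of_pos (show 0 < 3 / 2 - H by linarith)
    positivity
  -- The exponent 1/4 - 1 is (1/2 - H) - (5/4 - H): the weight w_s tames the singularities of the
  -- kernel bound at both ends. The singularity in t - r is replaced by the worse one in s - r.
  set B : ℝ → ℝ := fun r => laplaceConst H t * (2 * c * (r ^ ((1 / 4 : ℝ) - 1) *
    (s - r) ^ ((1 / 4 : ℝ) - 1)) + weight H s r * (1 / (2 - 2 * H))) with hB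
  have hBi : IntegrableOn B (Set.Ioo 0 s) := by
    have j1 := (intervalIntegrable_iff_integrableOn_Ioo_of_le hs.le).1
      (intervalIntegrable_rpow_mul_sub_rpow (p := 1 / 4) (q := 1 / 4) (by norm_num) (by norm_num)
        hs.le)
    have j2 := (intervalIntegrable_iff_integrableOn_Ioo_of_le hs.le).1
      (intervalIntegrable_weight hH1 hs.le)
    exact ((j1.const_mul (2 * c)).add (j2.mul_const (1 / (2 - 2 * H)))).const_mul _
  have hrt : ∀ r ∈ Set.Ioo 0 s, r ∈ Set.Ioo 0 t := fun r hr => ⟨hr.1, hr.2.trans_le hst⟩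
  have hbound : ∀ ε : ℝ, 0 ≤ ε → ∀ r ∈ Set.Ioo 0 s, ‖(weight H s r : ℂ) * (laplaceConst H t *
      ∫ x in Set.Ioi (0 : ℝ), laplaceKernel H t (ε + Complex.I * r + x))‖ ≤ B r := by
    intro ε hε r hr
    have hsr : 0 < s - r := sub_pos.2 hr.2
    have h1 := norm_integral_laplaceKernel_le hH1 (hrt r hr) hε
    have hw0 := weight_nonneg hH0 hH1 (t := s) ⟨hr.1.le, hr.2.le⟩
    have h2 : (t - r) ^ (-(5 / 4 - H)) ≤ (s - r) ^ (-(5 / 4 - H)) :=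
      Real.rpow_le_rpow_of_nonpos hsr (by linarith) (by linarith)
    have e1 : weight H s r * (r ^ (-(5 / 4 - H)) * (s - r) ^ (-(5 / 4 - H))) =
        c * (r ^ ((1 / 4 : ℝ) - 1) * (s - r) ^ ((1 / 4 : ℝ) - 1)) := by
      have : ∀ x : ℝ, 0 < x → x ^ ((1 / 4 : ℝ) - 1) = x ^ (3 / 2 - H - 1) * x ^ (-(5 / 4 - H)) := by
        intro x hx
        rw [← Real.rpow_add hx]; congr 1; ring
      rw [this r hr.1, this _ hsr, weight]
      ring
    rw [norm_mul, norm_mul, Complex.norm_real, Complex.norm_real, Real.norm_of_nonneg hw0,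
      Real.norm_of_nonneg hC.le]
    have hr0 := Real.rpow_nonneg hr.1.le (-(5 / 4 - H))
    calc _ ≤ weight H s r * (laplaceConst H t * (2 * (r ^ (-(5 / 4 - H)) *
          (s - r) ^ (-(5 / 4 - H))) + 1 / (2 - 2 * H))) := by
          gcongr
          refine h1.trans ?_
          gcongr
      _ = B r := by
          simp only [hB]
          linear_combination 2 * laplaceConst H t * e1
  have hmeas : ∀ ε : ℝ, AEStronglyMeasurable (fun r : ℝ => (weight H s r : ℂ) * (laplaceConst H t *
      ∫ x in Set.Ioi (0 : ℝ), laplaceKernel H t (ε + Complex.I * r + x)))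
      (volume.restrict (Set.Ioo 0 s)) := by
    intro ε
    have h : StronglyMeasurable (fun p : ℝ × ℝ => laplaceKernel H t (ε + Complex.I * p.1 + p.2)) :=
      (by fun_prop : Measurable _).stronglyMeasurable
    have h2 := h.integral_prod_right' (ν := volume.restrict (Set.Ioi 0))
    exact ((by fun_prop : Measurable fun r : ℝ => (weight H s r : ℂ)).aestronglyMeasurable.mul
      (h2.aestronglyMeasurable.const_mul _))
  have hlim : Tendsto (fun ε : ℝ => ∫ r in Set.Ioo 0 s, (weight H s r : ℂ) * (laplaceConst H t *
      ∫ x in Set.Ioi (0 : ℝ), laplaceKernel H t (ε + Complex.I * r + x))) (𝓝[>] 0)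
      (𝓝 (∫ r in Set.Ioo 0 s, (weight H s r : ℂ) * (laplaceConst H t *
        ∫ x in Set.Ioi (0 : ℝ), laplaceKernel H t (Complex.I * r + x)))) := by
    refine tendsto_integral_filter_of_dominated_convergence B (Eventually.of_forall hmeas) ?_ hBi ?_
    · filter_upwards [self_mem_nhdsWithin] with ε hε
      exact (ae_restrict_iff' measurableSet_Ioo).2 (Eventually.of_forall (hbound ε (le_of_lt hε)))
    · exact (ae_restrict_iff' measurableSet_Ioo).2 (Eventually.of_forall fun r hr =>
        ((tendsto_integral_laplaceKernel hH1 (hrt r hr)).const_mul _).const_mul _)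
  have hi0 : IntegrableOn (fun r : ℝ => (weight H s r : ℂ) * (laplaceConst H t *
      ∫ x in Set.Ioi (0 : ℝ), laplaceKernel H t (Complex.I * r + x))) (Set.Ioo 0 s) := by
    refine hBi.mono' (by simpa using hmeas 0) ((ae_restrict_iff' measurableSet_Ioo).2
      (Eventually.of_forall fun r hr => ?_))
    simpa using hbound 0 le_rfl r hr
  have hval : 2 * specConst H * (∫ r in Set.Ioo 0 s, (weight H s r : ℂ) * (laplaceConst H t *
        ∫ x in Set.Ioi (0 : ℝ), laplaceKernel H t (Complex.I * r + x))).re =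
      ∫ r in (0 : ℝ)..s, weight H s r := by
    have h := integral_re hi0
    simp only [RCLike.re_to_complex] at h
    rw [← h, ← integral_const_mul, intervalIntegral.integral_of_le hs.le,
      integral_Ioc_eq_integral_Ioo]
    refine setIntegral_congr_fun measurableSet_Ioo fun r hr => ?_
    rw [Complex.re_ofReal_mul, Complex.re_ofReal_mul, re_integral_laplaceKernel_eq hH1 (hrt r hr),
      integral_laplaceKernel_half hH1 ht]
    linear_combination weight H s r * gram_constant hH0 hH1 ht
  have hfin := (Complex.continuous_ofReal.tendsto _).comp
    (((Complex.continuous_re.tendsto _).comp hlim).const_mul (2 * specConst H))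
  rw [hval] at hfin
  refine hfin.congr' ?_
  filter_upwards [self_mem_nhdsWithin] with ε hε
  rw [(integrable_gramReg hH0 hH1 hs ht hε).2]
  simp only [Function.comp, integral_Ioc_eq_integral_Ioo]

theorem tendsto_exp_neg_mul_abs (l : ℝ) :
    Tendsto (fun ε : ℝ => Real.exp (-ε * |l|)) (𝓝[>] 0) (𝓝 1) := by
  have h : Continuous fun ε : ℝ => Real.exp (-ε * |l|) := by fun_prop
  simpa using (h.tendsto 0).mono_left (nhdsWithin_le_nhds (s := Set.Ioi 0))

/-- Fatou's lemma: for s = t the regularized Gram integrals are damped squared norms with a finite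
limit. -/
theorem memLp_martFun {H t : ℝ} (hH0 : 0 < H) (hH1 : H < 1) (ht : 0 ≤ t) :
    MemLp (martFun H t) 2 (specMeasure H) := by
  rcases ht.eq_or_lt with rfl | ht
  · have h0 : martFun H 0 = 0 := funext fun l => by simp [martFun]
    rw [h0]
    exact MemLp.zero
  have hcont := continuous_martFun hH0 hH1 ht.le
  have hm := hcont.measurable
  rw [memLp_two_iff_integrable_sq_norm hcont.aestronglyMeasurable]
  refine ⟨(hcont.norm.pow 2).aestronglyMeasurable, ?_⟩
  set f : ℝ → ℝ → ENNReal := fun ε l =>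
    ENNReal.ofReal (‖martFun H t l‖ ^ 2 * Real.exp (-ε * |l|)) with hf
  have hint : ∀ ε : ℝ, 0 < ε → ∫⁻ l, f ε l ∂(specMeasure H) =
      ENNReal.ofReal (gramReg H t t ε).re := by
    intro ε hε
    have h := (integrable_gramReg hH0 hH1 ht ht hε).1
    have e : ∀ l, martFun H t l * starRingEnd ℂ (martFun H t l) *
        ((Real.exp (-ε * |l|) : ℝ) : ℂ) =
        ((‖martFun H t l‖ ^ 2 * Real.exp (-ε * |l|) : ℝ) : ℂ) := by
      intro l
      rw [Complex.mul_conj, Complex.normSq_eq_norm_sq]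
      push_cast
      ring
    simp_rw [gramReg, e, integral_complex_ofReal, Complex.ofReal_re]
    simp_rw [e] at h
    rw [ofReal_integral_eq_lintegral_ofReal]
    · exact h.re.congr (Eventually.of_forall fun l => by simp [-Complex.ofReal_mul])
    · exact Eventually.of_forall fun l => by positivity
  have hl : ∀ l, liminf (fun ε => f ε l) (𝓝[>] 0) = ‖‖martFun H t l‖ ^ 2‖ₑ := by
    intro l
    refine Tendsto.liminf_eq ?_
    have h := ENNReal.tendsto_ofReal ((tendsto_exp_neg_mul_abs l).const_mul (‖martFun H t l‖ ^ 2))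
    rwa [mul_one, ← Real.enorm_of_nonneg (by positivity)] at h
  have hfatou := lintegral_liminf_le (μ := specMeasure H) (u := 𝓝[>] (0 : ℝ)) (f := f)
    (fun ε => by fun_prop)
  simp_rw [hl] at hfatou
  refine hfatou.trans_lt ?_
  have h2 : Tendsto (fun ε => ∫⁻ l, f ε l ∂(specMeasure H)) (𝓝[>] 0)
      (𝓝 (ENNReal.ofReal (∫ r in (0 : ℝ)..t, weight H t r))) := by
    have h := ENNReal.tendsto_ofReal ((Complex.continuous_re.tendsto _).comp
      (tendsto_gramReg hH0 hH1 ht le_rfl))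
    refine h.congr' ?_
    filter_upwards [self_mem_nhdsWithin] with ε hε
    exact (hint ε hε).symm
  rw [h2.liminf_eq]
  exact ENNReal.ofReal_lt_top

/-- The fundamental martingale in the spectral domain has uncorrelated increments. -/
theorem integral_martFun_mul_conj {H s t : ℝ} (hH0 : 0 < H) (hH1 : H < 1) (hs : 0 ≤ s)
    (hst : s ≤ t) :
    ∫ l, martFun H t l * starRingEnd ℂ (martFun H s l) ∂(specMeasure H) =
      ((∫ u in (0 : ℝ)..s, varDens H u : ℝ) : ℂ) := by
  -- At λ = 0, where φ = 1, the formula for m_s says that w_s and dV have the same mass on (0, s].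
  have hws : ((∫ u in (0 : ℝ)..s, varDens H u : ℝ) : ℂ) =
      ((∫ r in (0 : ℝ)..s, weight H s r : ℝ) : ℂ) := by
    have h := martFun_eq_integral_phi hH0 hH1 hs 0
    rw [← intervalIntegral.integral_ofReal, ← intervalIntegral.integral_ofReal]
    simpa [martFun, phi] using h
  rcases hs.eq_or_lt with rfl | hs
  · simp [martFun]
  have ht : 0 < t := hs.trans_le hst
  rw [hws]
  have h1 := memLp_martFun hH0 hH1 ht.le
  have h2 := memLp_martFun hH0 hH1 hs.le
  have hi : Integrable (fun l => martFun H t l * starRingEnd ℂ (martFun H s l))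
      (specMeasure H) := h1.integrable_mul h2.star
  refine tendsto_nhds_unique ?_ (tendsto_gramReg hH0 hH1 hs hst)
  refine tendsto_integral_filter_of_dominated_convergence
    (fun l => ‖martFun H t l * starRingEnd ℂ (martFun H s l)‖)
    (Eventually.of_forall fun ε => hi.aestronglyMeasurable.mul
      (by fun_prop : Continuous fun l : ℝ => ((Real.exp (-ε * |l|) : ℝ) : ℂ)).aestronglyMeasurable)
    ?_ hi.norm (Eventually.of_forall fun l => ?_)
  · filter_upwards [self_mem_nhdsWithin] with ε hε
    refine Eventually.of_forall fun l => ?_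
    have hε : 0 < ε := hε
    rw [norm_mul, Complex.norm_real, Real.norm_of_nonneg (Real.exp_pos _).le]
    refine mul_le_of_le_one_right (norm_nonneg _) (Real.exp_le_one_iff.2 ?_)
    nlinarith [abs_nonneg l]
  · have h := ((Complex.continuous_ofReal.tendsto _).comp (tendsto_exp_neg_mul_abs l)).const_mul
      (martFun H t l * starRingEnd ℂ (martFun H s l))
    simpa using h

/-! ### The isometry on indicators and its integral formula -/

/-- Two families with the same Gram matrix, the first of which is total, are related by a linear
isometry. -/
theorem exists_linearIsometry_of_inner_eq {ι E F : Type*} [NormedAddCommGroup E]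
    [InnerProductSpace ℂ E] [NormedAddCommGroup F] [InnerProductSpace ℂ F] [CompleteSpace F]
    (a : ι → E) (b : ι → F) (hab : ∀ i j, ⟪a i, a j⟫_ℂ = ⟪b i, b j⟫_ℂ)
    (ha : (Submodule.span ℂ (Set.range a)).topologicalClosure = ⊤) :
    ∃ U : E →ₗᵢ[ℂ] F, ∀ i, U (a i) = b i := by
  set e := Finsupp.linearCombination ℂ a
  set f := Finsupp.linearCombination ℂ b
  have hn : ∀ x, ‖f x‖ = ‖e x‖ := by
    intro x
    have h : ⟪f x, f x⟫_ℂ = ⟪e x, e x⟫_ℂ := by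
      simp only [e, f, Finsupp.linearCombination_apply, Finsupp.sum, sum_inner, inner_sum,
        inner_smul_left, inner_smul_right, hab]
    rw [inner_self_eq_norm_sq_to_K, inner_self_eq_norm_sq_to_K] at h
    have h' : ‖f x‖ ^ 2 = ‖e x‖ ^ 2 := by exact_mod_cast h
    exact (pow_left_inj₀ (norm_nonneg _) (norm_nonneg _) two_ne_zero).1 h'
  have hd : DenseRange e := by
    rw [DenseRange, ← LinearMap.coe_range, Finsupp.range_linearCombination]
    exact Submodule.dense_iff_topologicalClosure_eq_top.2 ha
  have he : ∀ x, f.extendOfNorm e (e x) = f x :=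
    LinearMap.extendOfNorm_eq hd ⟨1, fun x => by rw [hn, one_mul]⟩
  refine ⟨⟨(f.extendOfNorm e).toLinearMap, fun y => ?_⟩, fun i => ?_⟩
  · refine hd.induction_on (p := fun y => ‖f.extendOfNorm e y‖ = ‖y‖) y
      (isClosed_eq (by fun_prop) (by fun_prop)) fun x => ?_
    rw [he, hn]
  · have := he (Finsupp.single i 1)
    simpa [e, f] using this

theorem ae_varMeasure_mem (H T : ℝ) : ∀ᵐ u ∂varMeasure H T, u ∈ Set.Ioc 0 T := by
  rw [varMeasure_eq_withDensity]
  exact (withDensity_absolutelyContinuous _ _).ae_le (ae_restrict_mem measurableSet_Ioc)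

theorem ae_varMeasure_mem_Ioo (H T : ℝ) : ∀ᵐ u ∂varMeasure H T, u ∈ Set.Ioo 0 T := by
  rw [varMeasure_eq_withDensity]
  refine (withDensity_absolutelyContinuous _ _).ae_le ?_
  rw [← Measure.restrict_congr_set Ioo_ae_eq_Ioc]
  exact ae_restrict_mem measurableSet_Ioo

/-- For a measure carried by `(0, T)`, an integrable function all of whose integrals over the
intervals `(0, t]`, `t < T`, vanish is zero almost everywhere. -/
theorem ae_eq_zero_of_setIntegral_Ioc_eq_zero {T : ℝ} {ν : Measure ℝ}
    -- Only t < T is assumed because m_t is later placed in 𝓛_T by an argument that needs room to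
    -- the right of t; total mass zero is recovered by letting t increase to T.
    (hν : ∀ᵐ u ∂ν, u ∈ Set.Ioo 0 T) {f : ℝ → ℂ} (hf : Integrable f ν)
    (h : ∀ t ∈ Set.Ioo 0 T, ∫ u in Set.Ioc 0 t, f u ∂ν = 0) : f =ᵐ[ν] 0 := by
  have huniv : ∫ u, f u ∂ν = 0 := by
    rcases le_or_gt T 0 with hT | hT
    · have : ν = 0 := by
        rw [← Measure.measure_univ_eq_zero, ← nonpos_iff_eq_zero]
        have h0 : ν {u | ¬ u ∈ Set.Ioo 0 T} = 0 := hν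
        rw [Set.Ioo_eq_empty (by linarith)] at h0
        simpa using h0
      simp [this]
    · have hm : Monotone fun n : ℕ => Set.Ioc (0 : ℝ) (T - T / (n + 2)) := by
        intro m n hmn
        refine Set.Ioc_subset_Ioc_right ?_
        have : (m : ℝ) ≤ n := by exact_mod_cast hmn
        gcongr
      have hU : (⋃ n : ℕ, Set.Ioc (0 : ℝ) (T - T / (n + 2))) = Set.Ioo 0 T := by
        ext u
        simp only [Set.mem_iUnion, Set.mem_Ioc, Set.mem_Ioo]
        constructor
        · rintro ⟨n, h0, h1⟩
          have : 0 < T / (n + 2) := by positivity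
          exact ⟨h0, by linarith⟩
        · rintro ⟨h0, h1⟩
          obtain ⟨n, hn⟩ := exists_nat_gt (T / (T - u))
          refine ⟨n, h0, ?_⟩
          have hn2 : T / (n + 2) ≤ T - u := by
            rw [div_le_iff₀ (by positivity)]
            rw [div_lt_iff₀ (by linarith)] at hn
            nlinarith
          linarith
      have hl := tendsto_setIntegral_of_monotone (μ := ν) (f := f)
        (fun n : ℕ => measurableSet_Ioc (a := (0 : ℝ)) (b := T - T / (n + 2))) hm hf.integrableOn
      rw [hU] at hl
      have h0 : ∀ n : ℕ, ∫ u in Set.Ioc (0 : ℝ) (T - T / (n + 2)), f u ∂ν = 0 := by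
        intro n
        have h1 : 0 < T / (n + 2) := by positivity
        have h2 : T / (n + 2) < T := by
          rw [div_lt_iff₀ (by positivity)]
          have : (0 : ℝ) ≤ n := n.cast_nonneg
          nlinarith
        exact h _ ⟨by linarith, by linarith⟩
      simp only [h0] at hl
      have := tendsto_nhds_unique hl tendsto_const_nhds
      rwa [Measure.restrict_eq_self_of_ae_mem hν] at this
  refine hf.ae_eq_zero_of_forall_setIntegral_eq_zero fun s hs hfin => ?_
  clear hfin
  -- The half lines form a π-system that generates the Borel sets; up to null sets each of them is
  -- empty, an interval (0, t] with t < T, or everything.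
  induction s, hs using MeasurableSpace.induction_on_inter
    (BorelSpace.measurable_eq.trans (borel_eq_generateFrom_Iic ℝ)) isPiSystem_Iic with
  | empty => simp
  | basic s hs =>
    obtain ⟨t, rfl⟩ := hs
    by_cases ht : t ∈ Set.Ioo 0 T
    · rw [← h t ht]
      refine setIntegral_congr_set ?_
      filter_upwards [hν] with u hu
      exact propext ⟨fun h => ⟨hu.1, h⟩, fun h => h.2⟩
    · rcases le_or_gt t 0 with h0 | h0
      · have : (Set.Iic t : Set ℝ) =ᵐ[ν] (∅ : Set ℝ) := by
          filter_upwards [hν] with u hu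
          exact propext ⟨fun h => absurd hu.1 (not_lt.2 (le_trans h h0)), fun h => h.elim⟩
        rw [setIntegral_congr_set this]; simp
      · have hT : T ≤ t := by
          by_contra hc
          exact ht ⟨h0, not_le.1 hc⟩
        have : (Set.Iic t : Set ℝ) =ᵐ[ν] (Set.univ : Set ℝ) := by
          filter_upwards [hν] with u hu
          exact propext ⟨fun _ => trivial, fun _ => hu.2.le.trans hT⟩
        rw [setIntegral_congr_set this]; simpa using huniv
  | compl s hs ih =>
    have := integral_add_compl hs hf
    rw [ih, huniv, zero_add] at this
    exact this
  | iUnion s hd hm ih =>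
    rw [integral_iUnion hm hd hf.integrableOn]
    simp [ih]

/-- The class of the indicator of `(0, t]` in `L²([0, T], V)`. -/
def indicatorLp {H T : ℝ} (hH0 : 0 < H) (hH1 : H < 1) (hT : 0 ≤ T) (t : ℝ) :
    Lp ℂ 2 (varMeasure H T) :=
  haveI := isFiniteMeasure_varMeasure hH0 hH1 hT
  indicatorConstLp 2 (measurableSet_Ioc (a := (0 : ℝ)) (b := t)) (measure_ne_top _ _) 1

/-- A function orthogonal to all these indicators has vanishing integrals over (0, t], hence is
zero. -/
theorem topologicalClosure_span_indicatorLp {H T : ℝ} (hH0 : 0 < H) (hH1 : H < 1) (hT : 0 ≤ T) :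
    (Submodule.span ℂ (Set.range fun t : Set.Ioo (0 : ℝ) T =>
      indicatorLp (T := T) hH0 hH1 hT t)).topologicalClosure = ⊤ := by
  have := isFiniteMeasure_varMeasure hH0 hH1 hT
  rw [Submodule.topologicalClosure_eq_top_iff, eq_bot_iff]
  intro f hf
  rw [Submodule.mem_bot, Lp.eq_zero_iff_ae_eq_zero]
  refine ae_eq_zero_of_setIntegral_Ioc_eq_zero (ae_varMeasure_mem_Ioo H T)
    ((Lp.memLp f).integrable one_le_two) fun t ht => ?_
  have := Submodule.inner_right_of_mem_orthogonal
    (Submodule.subset_span (Set.mem_range_self (⟨t, ht⟩ : Set.Ioo 0 T))) hf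
  rw [← this]
  exact (L2.inner_indicatorConstLp_one _ _ _).symm

theorem norm_phi_mul_le {H : ℝ} (hH1 : H < 1) {T u : ℝ} (hu : u ∈ Set.Ioc 0 T)
    (l : ℝ) : ‖phi H (u * l)‖ ≤ 1 + (2 - 2 * H)⁻¹ * T * |l| := by
  refine (norm_phi_le hH1 _).trans ?_
  have : 0 < (2 - 2 * H)⁻¹ := inv_pos.2 (by linarith)
  rw [abs_mul, abs_of_pos hu.1, ← mul_assoc]
  have := hu.2
  gcongr

theorem memLp_phi {H T : ℝ} (hH0 : 0 < H) (hH1 : H < 1) (hT : 0 ≤ T) (l : ℝ) (p : ENNReal) :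
    MemLp (fun u => phi H (u * l)) p (varMeasure H T) := by
  have := isFiniteMeasure_varMeasure hH0 hH1 hT
  refine MemLp.of_bound ((measurable_phi hH1).comp
    (measurable_id.mul_const l)).aestronglyMeasurable (1 + (2 - 2 * H)⁻¹ * T * |l|) ?_
  filter_upwards [ae_varMeasure_mem H T] with u hu
  exact norm_phi_mul_le hH1 hu l

theorem integrable_mul_phi {H T : ℝ} (hH0 : 0 < H) (hH1 : H < 1) (hT : 0 ≤ T)
    (f : Lp ℂ 2 (varMeasure H T)) (l : ℝ) :
    Integrable (fun u => f u * phi H (u * l)) (varMeasure H T) :=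
  (Lp.memLp f).integrable_mul (memLp_phi hH0 hH1 hT l 2)

/-- The linear functional `f ↦ ∫ f(u) φ(u λ) dV_u` as an inner product. -/
theorem integral_mul_phi_eq_inner {H T : ℝ} (hH0 : 0 < H) (hH1 : H < 1) (hT : 0 ≤ T)
    (f : Lp ℂ 2 (varMeasure H T)) (l : ℝ) :
    ∫ u, f u * phi H (u * l) ∂varMeasure H T =
      ⟪((memLp_phi hH0 hH1 hT l 2).star).toLp, f⟫_ℂ := by
  rw [L2.inner_def]
  refine integral_congr_ae ?_
  filter_upwards [(memLp_phi hH0 hH1 hT l 2).star.coeFn_toLp] with u hu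
  rw [hu]
  simp

theorem integral_indicatorLp_mul_phi {H T : ℝ} (hH0 : 0 < H) (hH1 : H < 1) (hT : 0 ≤ T)
    {t : ℝ} (ht : t ∈ Set.Icc 0 T) (l : ℝ) :
    ∫ u, indicatorLp (T := T) hH0 hH1 hT t u * phi H (u * l) ∂varMeasure H T =
      martFun H t l := by
  have := isFiniteMeasure_varMeasure hH0 hH1 hT
  have h1 : ∫ u, indicatorLp (T := T) hH0 hH1 hT t u * phi H (u * l) ∂varMeasure H T =
      ∫ u, (Set.Ioc 0 t).indicator (fun u => phi H (u * l)) u ∂varMeasure H T := by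
    refine integral_congr_ae ?_
    have := indicatorConstLp_coeFn (μ := varMeasure H T) (p := 2)
      (hs := measurableSet_Ioc (a := (0 : ℝ)) (b := t)) (hμs := measure_ne_top _ _) (c := (1 : ℂ))
    filter_upwards [this] with u hu
    rw [indicatorLp, hu]
    by_cases h : u ∈ Set.Ioc 0 t <;> simp [h]
  rw [h1, integral_varMeasure hH0 hH1, ← martFun_eq_integral_phi hH0 hH1 ht.1,
    intervalIntegral.integral_of_le ht.1]
  have h2 : ∀ u, (varDens H u : ℂ) * (Set.Ioc 0 t).indicator (fun u => phi H (u * l)) u =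
      (Set.Ioc 0 t).indicator (fun u => (varDens H u : ℂ) * phi H (u * l)) u := by
    intro u
    by_cases h : u ∈ Set.Ioc 0 t <;> simp [h]
  simp only [h2]
  rw [setIntegral_indicator measurableSet_Ioc, Set.inter_eq_right.2 (Set.Ioc_subset_Ioc_right ht.2)]

/-- The class of `martFun H t` in `L²(μ)`. -/
def martLp {H : ℝ} (hH0 : 0 < H) (hH1 : H < 1) {t : ℝ} (ht : 0 ≤ t) : Lp ℂ 2 (specMeasure H) :=
  (memLp_martFun hH0 hH1 ht).toLp

theorem inner_martLp {H : ℝ} (hH0 : 0 < H) (hH1 : H < 1) {s t : ℝ} (hs : 0 ≤ s) (hst : s ≤ t) :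
    ⟪martLp hH0 hH1 hs, martLp hH0 hH1 (hs.trans hst)⟫_ℂ =
      ((∫ u in (0 : ℝ)..s, varDens H u : ℝ) : ℂ) := by
  rw [← integral_martFun_mul_conj hH0 hH1 hs hst, L2.inner_def]
  refine integral_congr_ae ?_
  filter_upwards [(memLp_martFun hH0 hH1 hs).coeFn_toLp,
    (memLp_martFun hH0 hH1 (hs.trans hst)).coeFn_toLp] with l h1 h2
  rw [martLp, martLp, h1, h2]
  simp

theorem inner_indicatorLp {H T : ℝ} (hH0 : 0 < H) (hH1 : H < 1) (hT : 0 ≤ T) {s t : ℝ}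
    (hs : 0 ≤ s) (hst : s ≤ t) (hsT : s ≤ T) :
    ⟪indicatorLp (T := T) hH0 hH1 hT s, indicatorLp (T := T) hH0 hH1 hT t⟫_ℂ =
      ((∫ u in (0 : ℝ)..s, varDens H u : ℝ) : ℂ) := by
  have := isFiniteMeasure_varMeasure hH0 hH1 hT
  rw [indicatorLp, indicatorLp, L2.inner_indicatorConstLp_one_indicatorConstLp_one
    measurableSet_Ioc measurableSet_Ioc, Set.inter_eq_left.2 (Set.Ioc_subset_Ioc_right hst)]
  have h1 : (((varMeasure H T).real (Set.Ioc 0 s) : ℝ) : ℂ) =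
      ∫ u, (Set.Ioc 0 s).indicator (fun _ => (1 : ℂ)) u ∂varMeasure H T := by
    rw [integral_indicator measurableSet_Ioc]
    simp
  have h2 : ∀ u, (varDens H u : ℂ) * (Set.Ioc 0 s).indicator (fun _ => (1 : ℂ)) u =
      (Set.Ioc 0 s).indicator (fun u => (varDens H u : ℂ)) u := by
    intro u
    by_cases h : u ∈ Set.Ioc 0 s <;> simp [h]
  refine h1.trans ?_
  rw [integral_varMeasure hH0 hH1]
  simp only [h2]
  rw [setIntegral_indicator measurableSet_Ioc, Set.inter_eq_right.2
    (Set.Ioc_subset_Ioc_right hsT), intervalIntegral.integral_of_le hs, integral_complex_ofReal]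

/-- The spectral isometry as a map into `L²(μ)`. -/
theorem exists_linearIsometry_indicatorLp {H T : ℝ} (hH0 : 0 < H) (hH1 : H < 1) (hT : 0 ≤ T) :
    ∃ U : Lp ℂ 2 (varMeasure H T) →ₗᵢ[ℂ] Lp ℂ 2 (specMeasure H),
      ∀ t : Set.Ioo (0 : ℝ) T, U (indicatorLp hH0 hH1 hT t) = martLp hH0 hH1 t.2.1.le := by
  refine exists_linearIsometry_of_inner_eq _ _ (fun s t => ?_)
    (topologicalClosure_span_indicatorLp hH0 hH1 hT)
  rcases le_total (s : ℝ) t with h | h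
  · rw [inner_indicatorLp hH0 hH1 hT s.2.1.le h s.2.2.le, inner_martLp hH0 hH1 s.2.1.le h]
  · rw [← inner_conj_symm, inner_indicatorLp hH0 hH1 hT t.2.1.le h t.2.2.le,
      ← inner_martLp hH0 hH1 t.2.1.le h, inner_conj_symm]

/-- The formula is linear and holds on indicators. For a limit of step functions, U converges in
L²(μ), hence almost everywhere along a subsequence, while for each fixed λ the right-hand side is an
inner product with the conjugate of φ(·λ) and converges as well. -/
theorem ae_eq_integral_mul_phi {H T : ℝ} (hH0 : 0 < H) (hH1 : H < 1) (hT : 0 ≤ T)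
    {U : Lp ℂ 2 (varMeasure H T) →ₗᵢ[ℂ] Lp ℂ 2 (specMeasure H)}
    (hU : ∀ t : Set.Ioo (0 : ℝ) T, U (indicatorLp hH0 hH1 hT t) = martLp hH0 hH1 t.2.1.le)
    (f : Lp ℂ 2 (varMeasure H T)) :
    U f =ᵐ[specMeasure H] fun l => ∫ u, f u * phi H (u * l) ∂varMeasure H T := by
  simp only [integral_mul_phi_eq_inner hH0 hH1 hT]
  have hspan : ∀ f ∈ Submodule.span ℂ (Set.range fun t : Set.Ioo (0 : ℝ) T =>
      indicatorLp (T := T) hH0 hH1 hT t), U f =ᵐ[specMeasure H]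
        fun l => ⟪((memLp_phi hH0 hH1 hT l 2).star).toLp, f⟫_ℂ := by
    intro f hf
    induction hf using Submodule.span_induction with
    | mem f hf =>
      obtain ⟨t, rfl⟩ := hf
      filter_upwards [(memLp_martFun hH0 hH1 t.2.1.le).coeFn_toLp] with l hl
      rw [← integral_mul_phi_eq_inner hH0 hH1 hT,
        integral_indicatorLp_mul_phi hH0 hH1 hT ⟨t.2.1.le, t.2.2.le⟩, ← hl, hU, martLp]
    | zero =>
      rw [map_zero]
      filter_upwards [Lp.coeFn_zero ℂ 2 (specMeasure H)] with l hl
      rw [hl]; simp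
    | add f g _ _ hf hg =>
      rw [map_add]
      filter_upwards [Lp.coeFn_add (U f) (U g), hf, hg] with l h h1 h2
      rw [h, inner_add_right, ← h1, ← h2, Pi.add_apply]
    | smul c f _ hf =>
      rw [map_smul]
      filter_upwards [Lp.coeFn_smul c (U f), hf] with l h h1
      rw [h, inner_smul_right, ← h1, Pi.smul_apply, smul_eq_mul]
  have hf : f ∈ closure (Submodule.span ℂ (Set.range fun t : Set.Ioo (0 : ℝ) T =>
      indicatorLp (T := T) hH0 hH1 hT t) : Set (Lp ℂ 2 (varMeasure H T))) := by
    rw [← Submodule.topologicalClosure_coe, topologicalClosure_span_indicatorLp]; trivial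
  obtain ⟨g, hg, hgf⟩ := mem_closure_iff_seq_limit.1 hf
  have hUg : Tendsto (fun n => U (g n)) atTop (𝓝 (U f)) := (U.continuous.tendsto f).comp hgf
  obtain ⟨ns, hns, hae⟩ := (tendstoInMeasure_of_tendsto_Lp hUg).exists_seq_tendsto_ae
  have hall : ∀ᵐ l ∂specMeasure H, ∀ n,
      U (g n) l = ⟪((memLp_phi hH0 hH1 hT l 2).star).toLp, g n⟫_ℂ :=
    ae_all_iff.2 fun n => hspan _ (hg n)
  filter_upwards [hae, hall] with l h1 h2
  refine tendsto_nhds_unique h1 ?_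
  simp only [h2]
  exact tendsto_const_nhds.inner (hgf.comp hns.tendsto_atTop)

/-! ### Membership of functions in closed subspaces of L² -/

/-- The function `g` is square integrable and its class belongs to the subspace `K`. -/
def ClassMem {α : Type*} [MeasurableSpace α] {μ : Measure α} (K : Submodule ℂ (Lp ℂ 2 μ))
    (g : α → ℂ) : Prop :=
  ∃ h : MemLp g 2 μ, h.toLp ∈ K

section ClassMem

variable {α : Type*} [MeasurableSpace α] {μ : Measure α} {K : Submodule ℂ (Lp ℂ 2 μ)}

theorem ClassMem.sub {f g : α → ℂ} (hf : ClassMem K f) (hg : ClassMem K g) :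
    ClassMem K (fun x => f x - g x) := by
  obtain ⟨hf, hf'⟩ := hf
  obtain ⟨hg, hg'⟩ := hg
  exact ⟨hf.sub hg, MemLp.toLp_sub hf hg ▸ K.sub_mem hf' hg'⟩

theorem ClassMem.const_mul {f : α → ℂ} (hf : ClassMem K f) (c : ℂ) :
    ClassMem K (fun x => c * f x) := by
  obtain ⟨hf, hf'⟩ := hf
  exact ⟨hf.const_smul c, MemLp.toLp_const_smul c hf ▸ K.smul_mem c hf'⟩

theorem ClassMem.mem {f : Lp ℂ 2 μ} {g : α → ℂ} (hg : ClassMem K g) (h : f =ᵐ[μ] g) : f ∈ K := by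
  obtain ⟨hg, hg'⟩ := hg
  have : f = hg.toLp := Lp.ext (h.trans hg.coeFn_toLp.symm)
  rwa [this]

theorem inner_toLp {g : α → ℂ} (hg : MemLp g 2 μ) (h : Lp ℂ 2 μ) :
    ⟪h, hg.toLp⟫_ℂ = ∫ x, g x * starRingEnd ℂ (h x) ∂μ := by
  rw [L2.inner_def]
  refine integral_congr_ae ?_
  filter_upwards [hg.coeFn_toLp] with x hx
  rw [hx]
  rfl

/-- A closed subspace is its own biorthogonal. This replaces L²-valued limits and integrals by
scalar ones, to which dominated convergence and Fubini apply directly. -/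
theorem classMem_iff (hK : IsClosed (K : Set (Lp ℂ 2 μ))) {g : α → ℂ} (hg : MemLp g 2 μ) :
    ClassMem K g ↔ ∀ h ∈ Kᗮ, ∫ x, g x * starRingEnd ℂ (h x) ∂μ = 0 := by
  have h1 : ClassMem K g ↔ hg.toLp ∈ Kᗮᗮ := by
    rw [Submodule.orthogonal_orthogonal_eq_closure, hK.submodule_topologicalClosure_eq]
    exact ⟨fun h => h.2, fun h => ⟨hg, h⟩⟩
  rw [h1, Submodule.mem_orthogonal]
  simp only [inner_toLp]

/-- Dominated convergence in a closed subspace of `L²`. -/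
theorem ClassMem.of_tendsto (hK : IsClosed (K : Set (Lp ℂ 2 μ))) {ι : Type*} {l : Filter ι}
    [l.NeBot] [l.IsCountablyGenerated] {F : ι → α → ℂ} {g G : α → ℂ} (hG : MemLp G 2 μ)
    (hF : ∀ᶠ i in l, ClassMem K (F i)) (hb : ∀ᶠ i in l, ∀ x, ‖F i x‖ ≤ ‖G x‖)
    (hlim : ∀ x, Tendsto (fun i => F i x) l (𝓝 (g x))) : ClassMem K g := by
  obtain ⟨s, hs⟩ := exists_seq_tendsto l
  have hg : MemLp g 2 μ := by
    obtain ⟨N, hN⟩ := eventually_atTop.1 (hs.eventually hF)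
    have hm : AEStronglyMeasurable g μ :=
      aestronglyMeasurable_of_tendsto_ae atTop (f := fun n => F (s (n + N)))
        (fun n => (hN (n + N) (Nat.le_add_left _ _)).1.1)
        (Eventually.of_forall fun x => (hlim x).comp (hs.comp (tendsto_add_atTop_nat N)))
    refine hG.mono hm (Eventually.of_forall fun x => ?_)
    exact le_of_tendsto (hlim x).norm (hb.mono fun i hi => hi x)
  rw [classMem_iff hK hg]
  intro h hh
  have hlim' : Tendsto (fun i => ∫ x, F i x * starRingEnd ℂ (h x) ∂μ) l
      (𝓝 (∫ x, g x * starRingEnd ℂ (h x) ∂μ)) := by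
    refine tendsto_integral_filter_of_dominated_convergence (fun x => ‖G x‖ * ‖h x‖) ?_ ?_
      (hG.norm.integrable_mul (Lp.memLp h).norm)
      (Eventually.of_forall fun x => (hlim x).mul_const _)
    · filter_upwards [hF] with i hi
      exact hi.1.1.mul (Lp.memLp h).star.1
    · filter_upwards [hb] with i hi
      refine Eventually.of_forall fun x => ?_
      rw [norm_mul, RCLike.norm_conj]
      exact mul_le_mul_of_nonneg_right (hi x) (norm_nonneg _)
  refine tendsto_nhds_unique hlim' (tendsto_const_nhds.congr' ?_)
  filter_upwards [hF] with i hi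
  exact ((classMem_iff hK hi.1).1 hi h hh).symm

end ClassMem

/-! ### The functions e_t and m_t in the frequency domain -/

theorem continuous_intervalIntegral_mul_cexp {w : ℝ → ℝ} {s : ℝ}
    (hw : IntervalIntegrable w volume 0 s) :
    Continuous fun l : ℝ => ∫ r in (0 : ℝ)..s, (w r : ℂ) *
      Complex.exp (Complex.I * ((r * l : ℝ) : ℂ)) := by
  refine intervalIntegral.continuous_of_dominated_interval (bound := fun r => ‖w r‖)
    (fun l => ?_) (fun l => Eventually.of_forall fun r hr => ?_)
    hw.norm (Eventually.of_forall fun r _ => by fun_prop)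
  · have : AEStronglyMeasurable w (volume.restrict (Set.uIoc 0 s)) :=
      (intervalIntegrable_iff.1 hw).1
    exact (Complex.continuous_ofReal.comp_aestronglyMeasurable this).mul
      (by fun_prop : Continuous _).aestronglyMeasurable
  · rw [norm_mul, mul_comm Complex.I, Complex.norm_exp_ofReal_mul_I, mul_one, Complex.norm_real]

theorem norm_intervalIntegral_mul_cexp_le (w : ℝ → ℝ) {s : ℝ} (hs : 0 ≤ s) (l : ℝ) :
    ‖∫ r in (0 : ℝ)..s, (w r : ℂ) * Complex.exp (Complex.I * ((r * l : ℝ) : ℂ))‖ ≤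
      ∫ r in (0 : ℝ)..s, ‖w r‖ := by
  refine (intervalIntegral.norm_integral_le_integral_norm hs).trans (le_of_eq ?_)
  refine intervalIntegral.integral_congr fun r _ => ?_
  rw [norm_mul, mul_comm Complex.I, Complex.norm_exp_ofReal_mul_I, mul_one, Complex.norm_real]

/-- A closed subspace of `L²` that contains the modulations `e^{irλ} g` also contains their
superpositions. -/
theorem ClassMem.intervalIntegral_mul {μ : Measure ℝ} [SFinite μ] {K : Submodule ℂ (Lp ℂ 2 μ)}
    (hK : IsClosed (K : Set (Lp ℂ 2 μ))) {w : ℝ → ℝ} {s : ℝ} (hs : 0 ≤ s)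
    (hw : IntervalIntegrable w volume 0 s) {g : ℝ → ℂ} (hg : MemLp g 2 μ)
    (h : ∀ r ∈ Set.Ioc 0 s,
      ClassMem K fun l => Complex.exp (Complex.I * ((r * l : ℝ) : ℂ)) * g l) :
    ClassMem K fun l =>
      (∫ r in (0 : ℝ)..s, (w r : ℂ) * Complex.exp (Complex.I * ((r * l : ℝ) : ℂ))) * g l := by
  have hm : MemLp (fun l =>
      (∫ r in (0 : ℝ)..s, (w r : ℂ) * Complex.exp (Complex.I * ((r * l : ℝ) : ℂ))) * g l) 2 μ := by
    refine (hg.norm.const_mul (∫ r in (0 : ℝ)..s, ‖w r‖)).mono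
      ((continuous_intervalIntegral_mul_cexp hw).aestronglyMeasurable.mul hg.1)
      (Eventually.of_forall fun l => ?_)
    rw [norm_mul, norm_mul, norm_norm]
    gcongr
    exact (norm_intervalIntegral_mul_cexp_le w hs l).trans (le_abs_self _)
  rw [classMem_iff hK hm]
  intro f hf
  have hint : Integrable (fun l => g l * starRingEnd ℂ (f l)) μ :=
    hg.integrable_mul (Lp.memLp f).star
  have hwi : Integrable (fun r => (w r : ℂ)) (volume.restrict (Set.Ioc 0 s)) :=
    ((intervalIntegrable_iff_integrableOn_Ioc_of_le hs).1 hw).ofReal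
  have hprod : Integrable (fun p : ℝ × ℝ => Complex.exp (Complex.I * ((p.1 * p.2 : ℝ) : ℂ)) *
      ((w p.1 : ℂ) * (g p.2 * starRingEnd ℂ (f p.2))))
      ((volume.restrict (Set.Ioc 0 s)).prod μ) := by
    refine (hwi.mul_prod hint).bdd_mul (c := 1)
      (by fun_prop : Continuous _).aestronglyMeasurable (Eventually.of_forall fun p => ?_)
    rw [mul_comm Complex.I, Complex.norm_exp_ofReal_mul_I]
  have h1 : ∀ l, (∫ r in (0 : ℝ)..s, (w r : ℂ) * Complex.exp (Complex.I * ((r * l : ℝ) : ℂ))) *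
      g l * starRingEnd ℂ (f l) = ∫ r in Set.Ioc 0 s,
        Complex.exp (Complex.I * ((r * l : ℝ) : ℂ)) * ((w r : ℂ) *
          (g l * starRingEnd ℂ (f l))) := by
    intro l
    rw [intervalIntegral.integral_of_le hs, mul_assoc, ← integral_mul_const]
    exact integral_congr_ae (Eventually.of_forall fun r => by ring)
  simp only [h1]
  rw [← integral_integral_swap (f := fun r l => Complex.exp (Complex.I * ((r * l : ℝ) : ℂ)) *
    ((w r : ℂ) * (g l * starRingEnd ℂ (f l)))) hprod]
  refine (setIntegral_congr_fun measurableSet_Ioc fun r hr => ?_).trans (integral_zero _ _)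
  have h2 := (classMem_iff hK (h r hr).1).1 (h r hr) f hf
  have h3 : ∀ l, Complex.exp (Complex.I * ((r * l : ℝ) : ℂ)) *
      ((w r : ℂ) * (g l * starRingEnd ℂ (f l))) =
      (w r : ℂ) * (Complex.exp (Complex.I * ((r * l : ℝ) : ℂ)) * g l * starRingEnd ℂ (f l)) :=
    fun l => by ring
  simp only [h3]
  rw [integral_const_mul, h2, mul_zero]

theorem expFun_eq_integral (t l : ℝ) :
    expFun t l = ∫ r in (0 : ℝ)..t, Complex.exp (Complex.I * ((r * l : ℝ) : ℂ)) := by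
  by_cases hl : l = 0
  · simp [expFun, hl]
  · have hc : Complex.I * (l : ℂ) ≠ 0 := mul_ne_zero Complex.I_ne_zero (by exact_mod_cast hl)
    have h : ∀ r : ℝ, Complex.I * ((r * l : ℝ) : ℂ) = Complex.I * l * r := fun r => by
      push_cast; ring
    simp only [h]
    rw [integral_exp_mul_complex hc, expFun, if_neg hl]
    simp

theorem continuous_expFun (t : ℝ) : Continuous (expFun t) := by
  have h := continuous_intervalIntegral_mul_cexp (w := fun _ => 1) (s := t)
    intervalIntegrable_const
  simpa only [Complex.ofReal_one, one_mul, ← expFun_eq_integral] using h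

theorem hasDerivAt_expFun (t l : ℝ) :
    HasDerivAt (fun t => expFun t l) (Complex.exp (Complex.I * ((t * l : ℝ) : ℂ))) t := by
  simp only [expFun_eq_integral]
  have hc : Continuous fun r : ℝ => Complex.exp (Complex.I * ((r * l : ℝ) : ℂ)) := by fun_prop
  exact intervalIntegral.integral_hasDerivAt_right (hc.intervalIntegrable _ _)
    (hc.stronglyMeasurableAtFilter _ _) hc.continuousAt

theorem continuous_expFun_left (l : ℝ) : Continuous fun t => expFun t l :=
  continuous_iff_continuousAt.2 fun t => (hasDerivAt_expFun t l).continuousAt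

theorem norm_expFun_le {t : ℝ} (ht : 0 ≤ t) (l : ℝ) : ‖expFun t l‖ ≤ t := by
  have h := norm_intervalIntegral_mul_cexp_le (fun _ => 1) ht l
  simp only [Complex.ofReal_one, one_mul, ← expFun_eq_integral] at h
  simpa using h

theorem one_add_abs_mul_norm_expFun_le {t : ℝ} (ht : 0 ≤ t) (l : ℝ) :
    (1 + |l|) * ‖expFun t l‖ ≤ t + 2 := by
  have h1 := norm_expFun_le ht l
  have h2 : |l| * ‖expFun t l‖ ≤ 2 := by
    by_cases hl : l = 0
    · simp [hl]
    · rw [expFun, if_neg hl, norm_div, norm_mul, Complex.norm_I, one_mul, Complex.norm_real,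
        Real.norm_eq_abs, mul_div_cancel₀ _ (abs_pos.2 hl).ne']
      refine (norm_sub_le _ _).trans ?_
      have : Complex.I * (l : ℂ) * t = ((l * t : ℝ) : ℂ) * Complex.I := by push_cast; ring
      rw [this, Complex.norm_exp_ofReal_mul_I]
      norm_num
  linarith

/-- Multiplication by a character shifts the time interval. -/
theorem cexp_mul_expFun (r t l : ℝ) :
    Complex.exp (Complex.I * ((r * l : ℝ) : ℂ)) * expFun t l =
      expFun (r + t) l - expFun r l := by
  by_cases hl : l = 0
  · simp [expFun, hl]
  · have h1 : Complex.exp (Complex.I * l * (r + t : ℝ)) =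
        Complex.exp (Complex.I * ((r * l : ℝ) : ℂ)) * Complex.exp (Complex.I * l * t) := by
      rw [← Complex.exp_add]; congr 1; push_cast; ring
    have h2 : Complex.exp (Complex.I * l * r) = Complex.exp (Complex.I * ((r * l : ℝ) : ℂ)) := by
      congr 1; push_cast; ring
    simp only [expFun, if_neg hl]
    rw [h1, h2]
    ring

theorem tendsto_inv_mul_expFun (l : ℝ) :
    Tendsto (fun ε : ℝ => (ε : ℂ)⁻¹ * expFun ε l) (𝓝[>] 0) (𝓝 1) := by
  have h := (hasDerivAt_expFun 0 l).tendsto_slope_zero_right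
  have h0 : expFun 0 l = 0 := by simp [expFun_eq_integral]
  simpa [h0, Complex.real_smul] using h

theorem norm_inv_mul_expFun_le {ε : ℝ} (hε : 0 < ε) (l : ℝ) :
    ‖(ε : ℂ)⁻¹ * expFun ε l‖ ≤ 1 := by
  rw [norm_mul, norm_inv, Complex.norm_real, Real.norm_of_nonneg hε.le]
  rw [inv_mul_le_iff₀ hε, mul_one]
  exact norm_expFun_le hε.le l

/-- The spectral density is integrable at 0 because H < 1, and its product with λ⁻² is integrable at
infinity because H > 0. -/
theorem integrable_specMeasure_of_le {H : ℝ} (hH0 : 0 < H) (hH1 : H < 1) {g : ℝ → ℂ}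
    (hg : AEStronglyMeasurable g volume) {A : ℝ} (h : ∀ l, (1 + l ^ 2) * ‖g l‖ ≤ A) :
    Integrable g (specMeasure H) := by
  rw [integrable_specMeasure_iff hH0 hH1]
  have hA : 0 ≤ A := le_trans (by positivity) (h 0)
  have hb : IntegrableOn (fun l : ℝ => ((specDens H l * (1 + l ^ 2)⁻¹ * A : ℝ) : ℂ))
      (Set.Ioi 0) := by
    refine Integrable.ofReal ?_
    refine Integrable.mul_const ?_ _
    have hmeas : AEStronglyMeasurable (fun l : ℝ => specDens H l * (1 + l ^ 2)⁻¹) :=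
      ((measurable_specDens H).mul (by fun_prop)).aestronglyMeasurable
    have hc := (specConst_pos hH0 hH1).le
    rw [← IntegrableOn, ← Set.Ioc_union_Ioi_eq_Ioi zero_le_one, integrableOn_union]
    constructor
    · have hi : IntegrableOn (fun l : ℝ => specConst H * l ^ (1 - 2 * H)) (Set.Ioc 0 1) :=
        (((intervalIntegrable_iff_integrableOn_Ioc_of_le zero_le_one).1
          (intervalIntegral.intervalIntegrable_rpow' (by linarith))).const_mul _)
      refine hi.mono' hmeas.restrict ((ae_restrict_iff' measurableSet_Ioc).2
        (Eventually.of_forall fun l hl => ?_))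
      rw [Real.norm_of_nonneg (mul_nonneg (specDens_nonneg hH0 hH1 l) (by positivity)), specDens,
        abs_of_pos hl.1]
      have := Real.rpow_nonneg hl.1.le (1 - 2 * H)
      refine mul_le_of_le_one_right (by positivity) (inv_le_one_of_one_le₀ ?_)
      nlinarith
    · have hi : IntegrableOn (fun l : ℝ => specConst H * l ^ (-1 - 2 * H)) (Set.Ioi 1) :=
        (integrableOn_Ioi_rpow_of_lt (by linarith) zero_lt_one).const_mul _
      refine hi.mono' hmeas.restrict ((ae_restrict_iff' measurableSet_Ioi).2
        (Eventually.of_forall fun l (hl : 1 < l) => ?_))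
      have hl0 : 0 < l := zero_lt_one.trans hl
      rw [Real.norm_of_nonneg (mul_nonneg (specDens_nonneg hH0 hH1 l) (by positivity)), specDens,
        abs_of_pos hl0, mul_assoc]
      have h2 : l ^ (1 - 2 * H) = l ^ (-1 - 2 * H) * l ^ 2 := by
        rw [← Real.rpow_natCast l 2, ← Real.rpow_add hl0]
        congr 1
        push_cast
        ring
      have := Real.rpow_nonneg hl0.le (-1 - 2 * H)
      refine mul_le_mul_of_nonneg_left ?_ hc
      rw [h2, mul_assoc]
      refine mul_le_of_le_one_right this ?_
      rw [← div_eq_mul_inv, div_le_one (by positivity)]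
      linarith
  refine (integral_of_hermitian (fun l => ?_) hb).1.mono
    ((Complex.measurable_ofReal.comp (measurable_specDens H)).aestronglyMeasurable.mul hg)
    (Eventually.of_forall fun l => ?_)
  · rw [Complex.conj_ofReal, specDens, specDens, abs_neg, neg_sq]
  · have h0 := specDens_nonneg hH0 hH1 l
    rw [norm_mul, Complex.norm_real, Complex.norm_real, Real.norm_of_nonneg h0,
      Real.norm_of_nonneg (by positivity), mul_assoc]
    refine mul_le_mul_of_nonneg_left ?_ h0
    rw [← div_eq_inv_mul, le_div_iff₀ (by positivity), mul_comm]
    exact h l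

theorem memLp_specMeasure_of_le {H : ℝ} (hH0 : 0 < H) (hH1 : H < 1) {g : ℝ → ℂ}
    (hg : Continuous g) {A : ℝ} (h : ∀ l, (1 + |l|) * ‖g l‖ ≤ A) :
    MemLp g 2 (specMeasure H) := by
  rw [memLp_two_iff_integrable_sq_norm hg.aestronglyMeasurable]
  have := (integrable_specMeasure_of_le hH0 hH1 (g := fun l => g l ^ 2) (A := A ^ 2)
    (hg.pow 2).aestronglyMeasurable fun l => ?_).norm
  · simpa only [norm_pow] using this
  · rw [norm_pow]
    have h0 : 0 ≤ (1 + |l|) * ‖g l‖ := by positivity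
    refine le_trans ?_ (pow_le_pow_left₀ h0 (h l) 2)
    rw [mul_pow]
    gcongr
    nlinarith [abs_nonneg l, sq_abs l]

theorem memLp_expFun {H t : ℝ} (hH0 : 0 < H) (hH1 : H < 1) (ht : 0 ≤ t) :
    MemLp (expFun t) 2 (specMeasure H) :=
  memLp_specMeasure_of_le hH0 hH1 (continuous_expFun t) (one_add_abs_mul_norm_expFun_le ht)

theorem isClosed_freqDomain (H T : ℝ) :
    IsClosed (freqDomain H T : Set (Lp ℂ 2 (specMeasure H))) :=
  Submodule.isClosed_topologicalClosure _

instance instSFiniteSpecMeasure (H : ℝ) : SFinite (specMeasure H) := by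
  unfold specMeasure; infer_instance

theorem classMem_expFun {H T t : ℝ} (hH0 : 0 < H) (hH1 : H < 1) (ht : t ∈ Set.Icc 0 T) :
    ClassMem (freqDomain H T) (expFun t) :=
  ⟨memLp_expFun hH0 hH1 ht.1, Submodule.le_topologicalClosure _
    (Submodule.subset_span ⟨t, ht, MemLp.coeFn_toLp _⟩)⟩

/-- The modulated function is the difference of the e's at r + t and r; both times must lie in [0,
T]. -/
theorem classMem_cexp_mul_expFun {H T r t : ℝ} (hH0 : 0 < H) (hH1 : H < 1) (hr : 0 ≤ r)
    (ht : 0 ≤ t) (hrt : r + t ≤ T) :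
    ClassMem (freqDomain H T) fun l => Complex.exp (Complex.I * ((r * l : ℝ) : ℂ)) * expFun t l := by
  simp only [cexp_mul_expFun]
  exact (classMem_expFun hH0 hH1 ⟨by linarith, hrt⟩).sub
    (classMem_expFun hH0 hH1 ⟨hr, by linarith⟩)

theorem ClassMem.expFun_mul {μ : Measure ℝ} [SFinite μ] {K : Submodule ℂ (Lp ℂ 2 μ)}
    (hK : IsClosed (K : Set (Lp ℂ 2 μ))) {s : ℝ} (hs : 0 ≤ s) {g : ℝ → ℂ} (hg : MemLp g 2 μ)
    (h : ∀ r ∈ Set.Ioc 0 s,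
      ClassMem K fun l => Complex.exp (Complex.I * ((r * l : ℝ) : ℂ)) * g l) :
    ClassMem K fun l => expFun s l * g l := by
  have := ClassMem.intervalIntegral_mul hK hs (w := fun _ => 1) intervalIntegrable_const hg h
  simpa only [Complex.ofReal_one, one_mul, ← expFun_eq_integral] using this

/-- Although m_s is a superposition of characters, a single character is not in L²(μ).
Multiplication by e_ε/ε replaces characters by averages over [r, r + ε], which lie in 𝓛_T as long as
s + ε ≤ T. As ε → 0 the products are dominated by |m_s| and tend to m_s. The room for ε is why s <
T. -/
theorem classMem_martFun {H T s : ℝ} (hH0 : 0 < H) (hH1 : H < 1) (hs : s ∈ Set.Ioo 0 T) :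
    ClassMem (freqDomain H T) (martFun H s) := by
  have hT : ∀ᶠ ε : ℝ in 𝓝[>] 0, ε ∈ Set.Ioo 0 (T - s) :=
    Ioo_mem_nhdsGT (by linarith [hs.2])
  refine ClassMem.of_tendsto (isClosed_freqDomain H T) (l := 𝓝[>] (0 : ℝ))
    (F := fun ε l => (ε : ℂ)⁻¹ * (martFun H s l * expFun ε l)) (memLp_martFun hH0 hH1 hs.1.le)
    ?_ ?_ fun l => ?_
  · filter_upwards [hT] with ε hε
    exact (ClassMem.intervalIntegral_mul (isClosed_freqDomain H T) hs.1.le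
      (intervalIntegrable_weight hH1 hs.1.le) (memLp_expFun hH0 hH1 hε.1.le) fun r hr =>
        classMem_cexp_mul_expFun hH0 hH1 hr.1.le hε.1.le (by linarith [hr.2, hε.2])).const_mul _
  · filter_upwards [hT] with ε hε l
    rw [mul_left_comm, norm_mul]
    exact mul_le_of_le_one_right (norm_nonneg _) (norm_inv_mul_expFun_le hε.1 l)
  · have := (tendsto_inv_mul_expFun l).const_mul (martFun H s l)
    rw [mul_one] at this
    exact this.congr fun ε => by ring

/-! ### Density of the class 𝓛'_T -/

/-- The function `e_t (e_ε / ε)²`, a version of `e_t` that decays like `|λ|⁻³`. -/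
def expReg (t ε l : ℝ) : ℂ :=
  (ε : ℂ)⁻¹ * (expFun ε l * ((ε : ℂ)⁻¹ * (expFun ε l * expFun t l)))

theorem continuous_expReg (t ε : ℝ) : Continuous (expReg t ε) := by
  have h1 := continuous_expFun t
  have h2 := continuous_expFun ε
  unfold expReg
  fun_prop

/-- Each factor e_ε/ε averages over shifts of length at most ε, so two of them need the room t + 2ε
≤ T. The intermediate function must be handled together with all its shifts by r, since the second
average runs over them. -/
theorem classMem_expReg {H T t ε : ℝ} (hH0 : 0 < H) (hH1 : H < 1) (ht : 0 ≤ t) (hε : 0 ≤ ε)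
    (hT : t + 2 * ε ≤ T) : ClassMem (freqDomain H T) (expReg t ε) := by
  have h1 : ∀ r ∈ Set.Icc 0 ε, ClassMem (freqDomain H T) fun l =>
      (ε : ℂ)⁻¹ * (expFun ε l * (Complex.exp (Complex.I * ((r * l : ℝ) : ℂ)) * expFun t l)) := by
    intro r hr
    have h := classMem_cexp_mul_expFun hH0 hH1 hr.1 ht (show r + t ≤ T by linarith [hr.2])
    refine (ClassMem.expFun_mul (isClosed_freqDomain H T) hε h.1 fun q hq => ?_).const_mul _
    have h' := classMem_cexp_mul_expFun (T := T) hH0 hH1 (add_nonneg hq.1.le hr.1) ht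
      (by linarith [hr.2, hq.2])
    convert h' using 2 with l
    rw [← mul_assoc, ← Complex.exp_add]
    congr 2
    push_cast
    ring
  refine (ClassMem.expFun_mul (isClosed_freqDomain H T) hε ?_ fun r hr => ?_).const_mul _
  · simpa using (h1 0 ⟨le_rfl, hε⟩).1
  · convert h1 r ⟨hr.1.le, hr.2⟩ using 2 with l
    ring

theorem norm_expReg_le {t ε : ℝ} (hε : 0 < ε) (l : ℝ) : ‖expReg t ε l‖ ≤ ‖expFun t l‖ := by
  have h := norm_inv_mul_expFun_le hε l
  have : expReg t ε l = ((ε : ℂ)⁻¹ * expFun ε l) ^ 2 * expFun t l := by unfold expReg; ring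
  rw [this, norm_mul, norm_pow]
  exact mul_le_of_le_one_left (norm_nonneg _) (pow_le_one₀ (norm_nonneg _) h)

theorem mul_norm_expReg_le {t ε : ℝ} (ht : 0 ≤ t) (hε : 0 < ε) (l : ℝ) :
    (1 + |l|) ^ 3 * ‖expReg t ε l‖ ≤ (ε⁻¹ * (ε + 2)) ^ 2 * (t + 2) := by
  have h1 := one_add_abs_mul_norm_expFun_le ht l
  have h2 := one_add_abs_mul_norm_expFun_le hε.le l
  have h3 : ‖expReg t ε l‖ = (ε⁻¹ * ‖expFun ε l‖) ^ 2 * ‖expFun t l‖ := by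
    have : expReg t ε l = ((ε : ℂ)⁻¹ * expFun ε l) ^ 2 * expFun t l := by unfold expReg; ring
    rw [this, norm_mul, norm_pow, norm_mul, norm_inv, Complex.norm_real, Real.norm_of_nonneg hε.le]
  have h4 : (1 + |l|) ^ 3 * ‖expReg t ε l‖ =
      (ε⁻¹ * ((1 + |l|) * ‖expFun ε l‖)) ^ 2 * ((1 + |l|) * ‖expFun t l‖) := by
    rw [h3]; ring
  rw [h4]
  gcongr

/-- The subspace of all `ψ ∈ L²(μ)` such that `(1 + c |λ|) ψ(λ)` is integrable. -/
def weightedL1 (H c : ℝ) : Submodule ℂ (Lp ℂ 2 (specMeasure H)) where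
  carrier := {ψ | Integrable (fun l => ((1 + c * |l| : ℝ) : ℂ) * ψ l) (specMeasure H)}
  add_mem' {f g} hf hg := by
    refine (hf.add hg).congr ?_
    filter_upwards [Lp.coeFn_add f g] with l hl
    rw [hl, Pi.add_apply, Pi.add_apply, mul_add]
  zero_mem' := by
    refine (integrable_zero _ _ _).congr ?_
    filter_upwards [Lp.coeFn_zero ℂ 2 (specMeasure H)] with l hl
    rw [hl]; simp
  smul_mem' a f hf := by
    refine (Integrable.const_mul hf a).congr ?_
    filter_upwards [Lp.coeFn_smul a f] with l hl
    rw [hl, Pi.smul_apply, smul_eq_mul, mul_left_comm]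

/-- The weight costs one power of |λ|, so decay |λ|⁻³ leaves |λ|⁻², enough against μ for every H. A
single factor e_ε/ε would leave |λ|⁻¹, which suffices only for H > 1/2. -/
theorem classMem_expReg_weightedL1 {H T t ε c : ℝ} (hH0 : 0 < H) (hH1 : H < 1) (ht : 0 ≤ t)
    (hε : 0 < ε) (hT : t + 2 * ε ≤ T) (hc : 0 ≤ c) :
    ClassMem (weightedL1 H c ⊓ freqDomain H T) (expReg t ε) := by
  obtain ⟨h1, h2⟩ := classMem_expReg hH0 hH1 ht hε.le hT
  refine ⟨h1, ?_, h2⟩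
  have hi : Integrable (fun l => ((1 + c * |l| : ℝ) : ℂ) * expReg t ε l) (specMeasure H) := by
    have := continuous_expReg t ε
    refine integrable_specMeasure_of_le hH0 hH1
      (by fun_prop : Continuous _).aestronglyMeasurable
      (A := (1 + c) * ((ε⁻¹ * (ε + 2)) ^ 2 * (t + 2))) fun l => ?_
    have h3 := mul_norm_expReg_le ht hε l
    have hl := abs_nonneg l
    rw [norm_mul, Complex.norm_real, Real.norm_of_nonneg (by positivity), ← mul_assoc]
    have e1 : 1 + l ^ 2 ≤ (1 + |l|) ^ 2 := by nlinarith [sq_abs l]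
    have e2 : 1 + c * |l| ≤ (1 + c) * (1 + |l|) := by nlinarith
    have e3 : (1 + l ^ 2) * (1 + c * |l|) ≤ (1 + c) * (1 + |l|) ^ 3 :=
      (mul_le_mul e1 e2 (by positivity) (by positivity)).trans_eq (by ring)
    refine (mul_le_mul_of_nonneg_right e3 (norm_nonneg _)).trans ?_
    rw [mul_assoc]
    gcongr
  refine hi.congr ?_
  filter_upwards [h1.coeFn_toLp] with l hl
  rw [hl]

theorem freqDomain_le_closure_weightedL1 {H T c : ℝ} (hH0 : 0 < H) (hH1 : H < 1) (hc : 0 ≤ c) :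
    freqDomain H T ≤ (weightedL1 H c ⊓ freqDomain H T).topologicalClosure := by
  refine Submodule.topologicalClosure_minimal _ (Submodule.span_le.2 ?_)
    (Submodule.isClosed_topologicalClosure _)
  rintro ψ ⟨t, ht, hψ⟩
  have hcl := Submodule.isClosed_topologicalClosure (weightedL1 H c ⊓ freqDomain H T)
  rcases ht.1.eq_or_lt with rfl | h0
  · have : ψ = 0 := by
      rw [Lp.eq_zero_iff_ae_eq_zero]
      filter_upwards [hψ] with l hl
      rw [hl]; simp [expFun_eq_integral]
    rw [this]
    exact zero_mem _
  refine ClassMem.mem ?_ hψ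
  have hs : ∀ᶠ ε : ℝ in 𝓝[>] 0, ε ∈ Set.Ioo 0 (t / 2) := Ioo_mem_nhdsGT (by linarith)
  -- A majorant that does not depend on ε: the regularized functions are bounded by the e's at times
  -- below t, and those by (t + 2)/(1 + |λ|).
  have hG : MemLp (fun l : ℝ => (((t + 2) * (1 + |l|)⁻¹ : ℝ) : ℂ)) 2 (specMeasure H) := by
    refine memLp_specMeasure_of_le hH0 hH1 (A := t + 2) ?_ fun l => ?_
    · have : ∀ l : ℝ, 1 + |l| ≠ 0 := fun l => by positivity
      fun_prop (disch := assumption)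
    · have := abs_nonneg l
      rw [Complex.norm_real, Real.norm_of_nonneg (by positivity)]
      exact le_of_eq (by field_simp)
  -- The time is shortened by 2ε so that the two averages end at t ≤ T; this treats t = T like any
  -- other time.
  refine ClassMem.of_tendsto hcl (l := 𝓝[>] (0 : ℝ)) (F := fun ε => expReg (t - 2 * ε) ε) hG
    ?_ ?_ fun l => ?_
  · filter_upwards [hs] with ε hε
    obtain ⟨h1, h2⟩ := classMem_expReg_weightedL1 (T := T) hH0 hH1
      (show 0 ≤ t - 2 * ε by linarith [hε.2]) hε.1 (by linarith [ht.2]) hc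
    exact ⟨h1, Submodule.le_topologicalClosure _ h2⟩
  · filter_upwards [hs] with ε hε l
    refine (norm_expReg_le hε.1 l).trans ?_
    have h1 := one_add_abs_mul_norm_expFun_le (show 0 ≤ t - 2 * ε by linarith [hε.2]) l
    have := abs_nonneg l
    rw [Complex.norm_real, Real.norm_of_nonneg (by positivity), ← div_eq_mul_inv,
      le_div_iff₀ (by positivity), mul_comm]
    linarith [hε.1]
  · have h1 : Tendsto (fun ε : ℝ => expFun (t - 2 * ε) l) (𝓝[>] 0) (𝓝 (expFun t l)) := by
      have : Continuous fun ε : ℝ => expFun (t - 2 * ε) l :=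
        (continuous_expFun_left l).comp (by fun_prop)
      have h := (this.tendsto 0).mono_left (nhdsWithin_le_nhds (s := Set.Ioi 0))
      simpa using h
    have h2 := ((tendsto_inv_mul_expFun l).pow 2).mul h1
    rw [one_pow, one_mul] at h2
    exact h2.congr fun ε => by unfold expReg; ring

theorem eLpNorm_phi_le {H T : ℝ} (hH1 : H < 1) (l : ℝ) :
    eLpNorm (fun u => phi H (u * l)) 2 (varMeasure H T) ≤
      varMeasure H T Set.univ ^ ((2 : ENNReal).toReal)⁻¹ *
        ENNReal.ofReal (1 + (2 - 2 * H)⁻¹ * T * |l|) := by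
  refine eLpNorm_le_of_ae_bound ?_
  filter_upwards [ae_varMeasure_mem H T] with u hu
  exact norm_phi_mul_le hH1 hu l

/-- The linear bound on φ and the finiteness of dV bound ‖φ(·λ)‖_V by a multiple of 1 + c|λ|, so the
weighted class is contained in 𝓛'_T. -/
theorem dense_freqDomain' {H T : ℝ} (hH0 : 0 < H) (hH1 : H < 1) (hT : 0 ≤ T) :
    Dense (freqDomain' H T) := by
  have := isFiniteMeasure_varMeasure hH0 hH1 hT
  have hc : 0 ≤ (2 - 2 * H)⁻¹ * T := mul_nonneg (inv_nonneg.2 (by linarith)) hT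
  intro ψ
  rw [closure_subtype]
  refine closure_mono ?_ (freqDomain_le_closure_weightedL1 hH0 hH1 hc ψ.2)
  rintro f ⟨hf, hfF⟩
  refine ⟨⟨f, hfF⟩, ?_, rfl⟩
  have hf' : Integrable (fun l => ((1 + (2 - 2 * H)⁻¹ * T * |l| : ℝ) : ℂ) * f l)
    (specMeasure H) := hf
  have hV : varMeasure H T Set.univ ^ ((2 : ENNReal).toReal)⁻¹ ≠ ⊤ :=
    ENNReal.rpow_ne_top_of_nonneg (by positivity) (measure_ne_top _ _)
  refine lt_of_le_of_lt (lintegral_mono fun l =>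
    (mul_le_mul_left (eLpNorm_phi_le (T := T) hH1 l) ‖f l‖ₑ).trans_eq (mul_assoc _ _ _)) ?_
  rw [lintegral_const_mul' _ _ hV]
  refine ENNReal.mul_lt_top hV.lt_top (lt_of_le_of_lt (lintegral_mono fun l => ?_) hf'.2)
  have := abs_nonneg l
  rw [enorm_mul, ← ofReal_norm (((1 + (2 - 2 * H)⁻¹ * T * |l| : ℝ) : ℂ)), Complex.norm_real,
    Real.norm_of_nonneg (by positivity)]

/-! ### The range of the isometry, existence and uniqueness -/

theorem integral_maKernel_mul_phi_varMeasure {H T t : ℝ} (hH0 : 0 < H) (hH1 : H < 1)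
    (ht : t ∈ Set.Icc 0 T) (l : ℝ) :
    ∫ u, (maKernel H t u : ℂ) * phi H (u * l) ∂varMeasure H T = expFun t l := by
  rw [integral_varMeasure hH0 hH1, ← integral_maKernel_mul_phi hH0 hH1 ht.1,
    intervalIntegral.integral_of_le ht.1]
  rw [← setIntegral_eq_of_subset_of_forall_sdiff_eq_zero measurableSet_Ioc
    (Set.Ioc_subset_Ioc_right ht.2)]
  · exact integral_congr_ae (Eventually.of_forall fun u => by push_cast; ring)
  · rintro u ⟨hu, hu'⟩
    have : maKernel H t u = 0 := Set.indicator_of_notMem (fun h => hu' ⟨h.1, h.2.le⟩) _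
    simp [this]

theorem toLp_maKernel_ae_eq {H T : ℝ} (hH0 : 0 < H) (hH1 : H < 1)
    {U : Lp ℂ 2 (varMeasure H T) → Lp ℂ 2 (specMeasure H)}
    (hU : ∀ f, U f =ᵐ[specMeasure H] fun l => ∫ u, f u * phi H (u * l) ∂varMeasure H T) {t : ℝ}
    (ht : t ∈ Set.Icc 0 T) :
    U ((memLp_maKernel hH0 hH1 ht.1 ht.2).toLp) =ᵐ[specMeasure H] expFun t := by
  refine (hU _).trans (Eventually.of_forall fun l => ?_)
  simp only
  rw [← integral_maKernel_mul_phi_varMeasure hH0 hH1 ht]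
  refine integral_congr_ae ?_
  filter_upwards [(memLp_maKernel hH0 hH1 ht.1 ht.2).coeFn_toLp] with u hu
  rw [hu]

theorem martLp_mem_freqDomain {H T t : ℝ} (hH0 : 0 < H) (hH1 : H < 1) (ht : t ∈ Set.Ioo 0 T) :
    martLp hH0 hH1 ht.1.le ∈ freqDomain H T :=
  (classMem_martFun hH0 hH1 ht).mem (MemLp.coeFn_toLp _)

theorem apply_mem_freqDomain {H T : ℝ} (hH0 : 0 < H) (hH1 : H < 1) (hT : 0 ≤ T)
    {U : Lp ℂ 2 (varMeasure H T) →ₗᵢ[ℂ] Lp ℂ 2 (specMeasure H)}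
    (hU : ∀ t : Set.Ioo (0 : ℝ) T, U (indicatorLp hH0 hH1 hT t) = martLp hH0 hH1 t.2.1.le)
    (f : Lp ℂ 2 (varMeasure H T)) : U f ∈ freqDomain H T := by
  have hle : (Submodule.span ℂ (Set.range fun t : Set.Ioo (0 : ℝ) T =>
      indicatorLp (T := T) hH0 hH1 hT t)).topologicalClosure ≤
      (freqDomain H T).comap U.toLinearMap := by
    refine Submodule.topologicalClosure_minimal _ (Submodule.span_le.2 ?_)
      ((isClosed_freqDomain H T).preimage U.continuous)
    rintro f ⟨t, ht⟩
    have h : U f = martLp hH0 hH1 t.2.1.le := by rw [← ht, ← hU t]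
    rw [SetLike.mem_coe, Submodule.mem_comap, LinearIsometry.coe_toLinearMap, h]
    exact martLp_mem_freqDomain hH0 hH1 t.2
  rw [topologicalClosure_span_indicatorLp hH0 hH1 hT] at hle
  exact hle Submodule.mem_top

/-- The kernel formula gives U x_t = e_t, and the range of an isometry of a complete space is
closed. In this way surjectivity needs no density statement about the x_t. -/
theorem freqDomain_le_range {H T : ℝ} (hH0 : 0 < H) (hH1 : H < 1)
    {U : Lp ℂ 2 (varMeasure H T) →ₗᵢ[ℂ] Lp ℂ 2 (specMeasure H)}
    (hU : ∀ f, U f =ᵐ[specMeasure H] fun l => ∫ u, f u * phi H (u * l) ∂varMeasure H T) :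
    freqDomain H T ≤ LinearMap.range U.toLinearMap := by
  have hcl : IsClosed (Set.range U) := U.isometry.isClosedEmbedding.isClosed_range
  refine Submodule.topologicalClosure_minimal _ (Submodule.span_le.2 ?_) ?_
  · rintro ψ ⟨t, ht, hψ⟩
    exact ⟨(memLp_maKernel hH0 hH1 ht.1 ht.2).toLp,
      Lp.ext ((toLp_maKernel_ae_eq hH0 hH1 hU ht).trans hψ.symm)⟩
  · rw [LinearMap.coe_range]
    exact hcl

/-- The range of the isometry induced by `1_{(0, t]} ↦ m_t` is the frequency domain. -/
theorem range_eq_freqDomain {H T : ℝ} (hH0 : 0 < H) (hH1 : H < 1) (hT : 0 ≤ T)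
    {U : Lp ℂ 2 (varMeasure H T) →ₗᵢ[ℂ] Lp ℂ 2 (specMeasure H)}
    (hU : ∀ t : Set.Ioo (0 : ℝ) T, U (indicatorLp hH0 hH1 hT t) = martLp hH0 hH1 t.2.1.le) :
    LinearMap.range U.toLinearMap = freqDomain H T := by
  refine le_antisymm ?_ (freqDomain_le_range hH0 hH1 (ae_eq_integral_mul_phi hH0 hH1 hT hU))
  rintro _ ⟨f, rfl⟩
  exact apply_mem_freqDomain hH0 hH1 hT hU f

theorem exists_isSpectralIsometry {H T : ℝ} (hH0 : 0 < H) (hH1 : H < 1) (hT : 0 ≤ T) :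
    ∃ U : Lp ℂ 2 (varMeasure H T) ≃ₗᵢ[ℂ] freqDomain H T, IsSpectralIsometry H T U ∧
      ∀ f, (U f : Lp ℂ 2 (specMeasure H)) =ᵐ[specMeasure H]
        fun l => ∫ u, f u * phi H (u * l) ∂varMeasure H T := by
  obtain ⟨U, hU⟩ := exists_linearIsometry_indicatorLp hH0 hH1 hT
  have hf := ae_eq_integral_mul_phi hH0 hH1 hT hU
  let V : Lp ℂ 2 (varMeasure H T) ≃ₗᵢ[ℂ] freqDomain H T :=
    U.equivRange.trans (LinearIsometryEquiv.ofEq _ _ (range_eq_freqDomain hH0 hH1 hT hU))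
  exact ⟨V, fun t ht => ⟨_, (memLp_maKernel hH0 hH1 ht.1 ht.2).coeFn_toLp,
    toLp_maKernel_ae_eq hH0 hH1 hf ht⟩, hf⟩

/-- The inverses are compared rather than the maps: they agree on the e_t, which are total in 𝓛_T by
definition, whereas totality of the x_t is only a consequence. -/
theorem IsSpectralIsometry.unique {H T : ℝ}
    {U U' : Lp ℂ 2 (varMeasure H T) ≃ₗᵢ[ℂ] freqDomain H T} (hU : IsSpectralIsometry H T U)
    (hU' : IsSpectralIsometry H T U') : U = U' := by
  let S : Submodule ℂ (freqDomain H T) :=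
    LinearMap.eqLocus U.symm.toLinearEquiv.toLinearMap U'.symm.toLinearEquiv.toLinearMap
  have hS : IsClosed (S : Set (freqDomain H T)) :=
    isClosed_eq U.symm.continuous U'.symm.continuous
  have hle : freqDomain H T ≤ S.map (freqDomain H T).subtype := by
    refine Submodule.topologicalClosure_minimal _ (Submodule.span_le.2 ?_) ?_
    · rintro ψ ⟨t, ht, hψ⟩
      obtain ⟨x, hx, hUx⟩ := hU t ht
      obtain ⟨x', hx', hUx'⟩ := hU' t ht
      obtain rfl : x = x' := Lp.ext (hx.trans hx'.symm)
      have h1 : (U x : Lp ℂ 2 (specMeasure H)) = ψ := Lp.ext (hUx.trans hψ.symm)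
      have h2 : U' x = U x := Subtype.ext (Lp.ext (hUx'.trans hUx.symm))
      refine ⟨U x, ?_, h1⟩
      change U.symm (U x) = U'.symm (U x)
      rw [U.symm_apply_apply, ← h2, U'.symm_apply_apply]
    · exact (isClosed_freqDomain H T).isClosedEmbedding_subtypeVal.isClosedMap _ hS
  have hsymm : ∀ ψ, U.symm ψ = U'.symm ψ := by
    intro ψ
    obtain ⟨χ, hχ, hχψ⟩ := hle ψ.2
    obtain rfl : χ = ψ := Subtype.ext hχψ
    exact hχ
  ext1 f
  rw [← U'.symm_apply_eq.1 ((hsymm (U f)).symm.trans (U.symm_apply_apply f))]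

/-! ### The inversion formula -/

/-- As dV is finite, the L¹(V) norm of φ(·λ) is at most a constant times its L²(V) norm, so the
condition that defines 𝓛'_T makes the kernel jointly integrable. Fubini is then available, including
integrability in λ for almost every u. -/
theorem integrable_prod_mul_conj_phi {H T : ℝ} (hH0 : 0 < H) (hH1 : H < 1) (hT : 0 ≤ T)
    {ψ : freqDomain H T} (hψ : ψ ∈ freqDomain' H T) :
    Integrable (fun p : ℝ × ℝ => (ψ : Lp ℂ 2 (specMeasure H)) p.2 *
      starRingEnd ℂ (phi H (p.1 * p.2))) ((varMeasure H T).prod (specMeasure H)) := by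
  have := isFiniteMeasure_varMeasure hH0 hH1 hT
  have hm : AEStronglyMeasurable (fun p : ℝ × ℝ => (ψ : Lp ℂ 2 (specMeasure H)) p.2 *
      starRingEnd ℂ (phi H (p.1 * p.2))) ((varMeasure H T).prod (specMeasure H)) :=
    (Lp.aestronglyMeasurable _).comp_snd.mul (RCLike.continuous_conj.comp_aestronglyMeasurable
      ((measurable_phi hH1).comp (measurable_fst.mul measurable_snd)).aestronglyMeasurable)
  refine ⟨hm, ?_⟩
  rw [HasFiniteIntegral, lintegral_prod_symm _ hm.enorm]
  set C := varMeasure H T Set.univ ^ (1 / (1 : ENNReal).toReal - 1 / (2 : ENNReal).toReal)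
  have hC : C ≠ ⊤ := ENNReal.rpow_ne_top_of_nonneg (by norm_num) (measure_ne_top _ _)
  have hψ' : ∫⁻ l, eLpNorm (fun u => phi H (u * l)) 2 (varMeasure H T) *
      ‖(ψ : Lp ℂ 2 (specMeasure H)) l‖ₑ ∂specMeasure H < ⊤ := hψ
  refine lt_of_le_of_lt (lintegral_mono fun l => ?_)
    ((lintegral_const_mul' C _ hC).trans_lt (ENNReal.mul_lt_top hC.lt_top hψ'))
  simp only [enorm_mul, RCLike.enorm_conj]
  have hφ := ((measurable_phi hH1).comp (measurable_id.mul_const l)).aestronglyMeasurable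
    (μ := varMeasure H T)
  have h1 := eLpNorm_le_eLpNorm_mul_rpow_measure_univ (p := 1) (q := 2) one_le_two hφ
  rw [eLpNorm_one_eq_lintegral_enorm] at h1
  rw [lintegral_const_mul' _ _ enorm_ne_top, mul_comm, ← mul_assoc, mul_comm C]
  exact mul_le_mul_left h1 _

/-- The inversion formula for an isometry that is given by the kernel `φ`. -/
theorem symm_ae_eq_integral {H T : ℝ} (hH0 : 0 < H) (hH1 : H < 1) (hT : 0 ≤ T)
    {U : Lp ℂ 2 (varMeasure H T) ≃ₗᵢ[ℂ] freqDomain H T}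
    (hU : ∀ f, (U f : Lp ℂ 2 (specMeasure H)) =ᵐ[specMeasure H]
      fun l => ∫ u, f u * phi H (u * l) ∂varMeasure H T)
    {ψ : freqDomain H T} (hψ : ψ ∈ freqDomain' H T) :
    U.symm ψ =ᵐ[varMeasure H T] fun u => ∫ l, (ψ : Lp ℂ 2 (specMeasure H)) l *
      starRingEnd ℂ (phi H (u * l)) ∂specMeasure H := by
  have := isFiniteMeasure_varMeasure hH0 hH1 hT
  have hG := integrable_prod_mul_conj_phi hH0 hH1 hT hψ
  refine Integrable.ae_eq_of_forall_setIntegral_eq _ _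
    ((Lp.memLp _).integrable one_le_two) hG.integral_prod_left fun s hs hfin => ?_
  -- The integral of U⁻¹ψ over s is ⟨1_s, U⁻¹ψ⟩ = ⟨U1_s, ψ⟩, and U1_s is known from the kernel
  -- formula; conjugation in the first slot produces the conjugate of φ.
  rw [← L2.inner_indicatorConstLp_one (𝕜 := ℂ) hs hfin.ne, ← U.inner_map_map,
    U.apply_symm_apply, Submodule.coe_inner, L2.inner_def]
  have hGs : Integrable (fun p : ℝ × ℝ => (ψ : Lp ℂ 2 (specMeasure H)) p.2 *
      starRingEnd ℂ (phi H (p.1 * p.2))) (((varMeasure H T).restrict s).prod (specMeasure H)) := by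
    have := hG.integrableOn (s := s ×ˢ Set.univ)
    rwa [IntegrableOn, ← Measure.prod_restrict, Measure.restrict_univ] at this
  rw [integral_integral_swap (f := fun u l => (ψ : Lp ℂ 2 (specMeasure H)) l *
    starRingEnd ℂ (phi H (u * l))) hGs]
  refine integral_congr_ae ?_
  filter_upwards [hU (indicatorConstLp 2 hs hfin.ne 1)] with l hl
  have h1 : ∫ u, indicatorConstLp 2 hs hfin.ne (1 : ℂ) u * phi H (u * l) ∂varMeasure H T =
      ∫ u in s, phi H (u * l) ∂varMeasure H T := by
    rw [← integral_indicator hs]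
    refine integral_congr_ae ?_
    filter_upwards [indicatorConstLp_coeFn (μ := varMeasure H T) (p := 2) (hs := hs)
      (hμs := hfin.ne) (c := (1 : ℂ))] with u hu
    rw [hu]
    by_cases h : u ∈ s <;> simp [h]
  rw [hl, h1, RCLike.inner_apply, integral_const_mul, integral_conj]

end FBM

end

theorem theorem3p2 (H T : ℝ) (hH0 : 0 < H) (hH1 : H < 1) (hT : 0 ≤ T) :
    (∃! U : Lp ℂ 2 (FBM.varMeasure H T) ≃ₗᵢ[ℂ] FBM.freqDomain H T,
      FBM.IsSpectralIsometry H T U) ∧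
    Dense (FBM.freqDomain' H T) ∧
    ∀ U : Lp ℂ 2 (FBM.varMeasure H T) ≃ₗᵢ[ℂ] FBM.freqDomain H T,
      FBM.IsSpectralIsometry H T U →
        (∀ f : Lp ℂ 2 (FBM.varMeasure H T),
          (∀ l : ℝ, Integrable (fun u => f u * FBM.phi H (u * l)) (FBM.varMeasure H T)) ∧
          ∀ᵐ l ∂(FBM.specMeasure H),
            (U f : Lp ℂ 2 (FBM.specMeasure H)) l =
              ∫ u, f u * FBM.phi H (u * l) ∂(FBM.varMeasure H T)) ∧
        ContinuousLinearMap.adjoint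
            (U : Lp ℂ 2 (FBM.varMeasure H T) →L[ℂ] FBM.freqDomain H T) =
          (U.symm : FBM.freqDomain H T →L[ℂ] Lp ℂ 2 (FBM.varMeasure H T)) ∧
        ∀ ψ ∈ FBM.freqDomain' H T,
          ∀ᵐ u ∂(FBM.varMeasure H T),
            Integrable (fun l => (ψ : Lp ℂ 2 (FBM.specMeasure H)) l *
              starRingEnd ℂ (FBM.phi H (u * l))) (FBM.specMeasure H) ∧
            U.symm ψ u =
              ∫ l, (ψ : Lp ℂ 2 (FBM.specMeasure H)) l *
                starRingEnd ℂ (FBM.phi H (u * l)) ∂(FBM.specMeasure H) := by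
  have := FBM.isFiniteMeasure_varMeasure hH0 hH1 hT
  obtain ⟨U₀, hU₀, hf⟩ := FBM.exists_isSpectralIsometry hH0 hH1 hT
  refine ⟨⟨U₀, hU₀, fun U hU => hU.unique hU₀⟩, FBM.dense_freqDomain' hH0 hH1 hT, fun U hU => ?_⟩
  obtain rfl := hU.unique hU₀
  refine ⟨fun f => ⟨FBM.integrable_mul_phi hH0 hH1 hT f, hf f⟩,
    LinearIsometryEquiv.adjoint_eq_symm U, fun ψ hψ => ?_⟩
  filter_upwards [(FBM.integrable_prod_mul_conj_phi hH0 hH1 hT hψ).prod_right_ae,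
    FBM.symm_ae_eq_integral hH0 hH1 hT hf hψ] with u h1 h2
  exact ⟨h1, h2⟩
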